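/- Let $d\ge 1$, $0<\gamma<d$, $\lambda\in\mathbb R$, $K(x)=\lambda|x|^{-\gamma}$ on $\mathbb R^d$, and consider the Hartree Cauchy problem $$i\partial_t u+\Delta u=(K*|u|^2)u,\qquad u|_{t=0}=\varphi. \tag{H}$$ Let $W=\{f\in\mathcal S'(\mathbb R^d;\mathbb C):\widehat f\in L^1(\mathbb R^d)\}$ be the Wiener algebra, with $\|f\|_W=\|\widehat f\|_{L^1}$, and let $L^2\cap W$ carry the norm $\max(\|f\|_W,\|f\|_{L^2})$. A solution of (H) on $[0,T]$ is a function $u\in C([0,T];W)$ such that, for every $\tau\in[0,T]$, the integrals defining $K*|u(\tau)|^2$ converge absolutely at every point and $(K*|u(\tau)|^2)u(\tau)\in W$, such that $\tau\mapsto (K*|u(\tau)|^2)u(\tau)$ belongs to $L^1([0,T];W)$, and such that in $W$ $$u(t)=e^{it\Delta}\varphi-i\int_0^t e^{i(t-\tau)\Delta}\big((K*|u|^2)u\big)(\tau)\,d\tau\qquad\text{for all } t\in[0,T].$$ For $S=W$ or $S=L^2\cap W$, problem (H) is called locally well-posed in $S$ if for every bounded $B\subset S$ there are $T>0$ and a Banach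 space $X_T\hookrightarrow C([0,T];S)$ such that every $\varphi\in B$ has a unique solution $\psi\in X_T$ of (H), and the map $\varphi\in B\mapsto\psi\in C([0,T];S)$ is uniformly continuous. Then: 1. (H) is locally well-posed in $L^2\cap W$. Moreover, for every $T>0$ and $\varphi\in L^2\cap W$ there is at most one solution of (H) in $C([0,T];L^2\cap W)$. 2. If $\lambda\neq 0$, (H) is not locally well-posed in $W$. More precisely, for every ball $B$ of $W$ (of any center and any radius $r>0$): * for every $T>0$, there is no uniformly continuous map $B\to C([0,T];W)$ which sends each $\varphi\in B$ to a solution of (H) on $[0,T]$ with initial datum $\varphi$; * uniform continuity already fails for the solutions with data in $L^2$: there is $T_0>0$ such that for every $T\in(0,T_0]$ there is $\varepsilon>0$ such that for every $\delta>0$ there are $\varphi_1,\varphi_2\in B\cap L^2$ with $\|\varphi_1-\varphi_2\|_W<\delta$ whose solutions $u_1,u_2$ exist in $C([0,T];L^2\cap W)$ and satisfy $\sup_{t\in[0,T]}\|u_1(t)-u_2(t)\|_W\ge\varepsilon$. -/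

import Mathlib

open MeasureTheory Set
open scoped FourierTransform SchwartzMap ENNReal

noncomputable section

namespace Hartree

/-- The Euclidean space `ℝ^d`. -/
abbrev Rd (d : ℕ) : Type := EuclideanSpace ℝ (Fin d)

/-! ### The Wiener algebra -/

/-- The embedding of `L¹(ℝ^d)` into the tempered distributions. -/
def l1Emb (d : ℕ) : Lp ℂ 1 (volume : Measure (Rd d)) →ₗ[ℂ] 𝓢'(Rd d, ℂ) :=
  (Lp.toTemperedDistributionCLM ℂ (volume : Measure (Rd d)) 1).toLinearMap

theorem l1Emb_injective (d : ℕ) : Function.Injective (l1Emb d) :=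
  LinearMap.ker_eq_bot.mp
    (Lp.ker_toTemperedDistributionCLM_eq_bot (F := ℂ) (μ := (volume : Measure (Rd d))) (p := 1))

/-- The tempered distributions `f` on `ℝ^d` whose Fourier transform belongs to `L¹(ℝ^d)`, as a
linear subspace of `𝓢'`. -/
def wienerSubmodule (d : ℕ) : Submodule ℂ 𝓢'(Rd d, ℂ) where
  carrier := {f | ∃ g : Lp ℂ 1 (volume : Measure (Rd d)), 𝓕 f = l1Emb d g}
  zero_mem' := ⟨0, by rw [map_zero, FourierTransform.fourier_zero]⟩
  add_mem' := by
    rintro f₁ f₂ ⟨g₁, h₁⟩ ⟨g₂, h₂⟩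
    exact ⟨g₁ + g₂, by rw [map_add, FourierTransform.fourier_add, h₁, h₂]⟩
  smul_mem' := by
    rintro c f ⟨g, h⟩
    exact ⟨c • g, by rw [map_smul, FourierTransform.fourier_smul, h]⟩

/-- The Wiener algebra `W = {f ∈ 𝓢'(ℝ^d; ℂ) : f̂ ∈ L¹(ℝ^d)}`. It is a separate type because its
topology is that of the norm below and not the one induced by `𝓢'`. -/
def Wiener (d : ℕ) : Type := wienerSubmodule d

namespace Wiener

variable {d : ℕ}

instance : AddCommGroup (Wiener d) := inferInstanceAs (AddCommGroup (wienerSubmodule d))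

instance : Module ℂ (Wiener d) := inferInstanceAs (Module ℂ (wienerSubmodule d))

/-- The tempered distribution underlying an element of the Wiener algebra. -/
def toDistribution : Wiener d →ₗ[ℂ] 𝓢'(Rd d, ℂ) := (wienerSubmodule d).subtype

/-- The Fourier transform `f̂ ∈ L¹` of an element `f` of the Wiener algebra. -/
def hat (f : Wiener d) : Lp ℂ 1 (volume : Measure (Rd d)) := Classical.choose f.2

theorem l1Emb_hat (f : Wiener d) : l1Emb d (hat f) = 𝓕 (toDistribution f) :=
  (Classical.choose_spec f.2).symm

theorem toDistribution_injective : Function.Injective (toDistribution (d := d)) :=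
  Subtype.val_injective

/-- The element of the Wiener algebra with a given Fourier transform in `L¹`. -/
def ofHat (g : Lp ℂ 1 (volume : Measure (Rd d))) : Wiener d :=
  (⟨𝓕⁻ (l1Emb d g), g, FourierTransform.fourier_fourierInv_eq _⟩ : wienerSubmodule d)

theorem toDistribution_ofHat (g : Lp ℂ 1 (volume : Measure (Rd d))) :
    toDistribution (ofHat g) = 𝓕⁻ (l1Emb d g) := rfl

/-- The Fourier transform as a linear isomorphism between the Wiener algebra and `L¹`. -/
def hatEquiv : Wiener d ≃ₗ[ℂ] Lp ℂ 1 (volume : Measure (Rd d)) where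
  toFun := hat
  invFun := ofHat
  map_add' f₁ f₂ := l1Emb_injective d <| by
    rw [map_add, l1Emb_hat, l1Emb_hat, l1Emb_hat, map_add, FourierTransform.fourier_add]
  map_smul' c f := l1Emb_injective d <| by
    rw [RingHom.id_apply, map_smul, l1Emb_hat, l1Emb_hat, map_smul,
      FourierTransform.fourier_smul]
  left_inv f := toDistribution_injective <| by
    rw [toDistribution_ofHat, l1Emb_hat, FourierTransform.fourierInv_fourier_eq]
  right_inv g := l1Emb_injective d <| by
    rw [l1Emb_hat, toDistribution_ofHat, FourierTransform.fourier_fourierInv_eq]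

/-- The norm `‖f‖_W = ‖f̂‖_{L¹}`, for Mathlib's Fourier transform `f̂(ξ) = ∫ e^{-2πi x·ξ} f(x) dx`;
another normalization of the Fourier transform multiplies this norm by a constant. -/
instance : NormedAddCommGroup (Wiener d) :=
  NormedAddCommGroup.induced (Wiener d) _ (hatEquiv (d := d)).toLinearMap hatEquiv.injective

theorem norm_eq (f : Wiener d) : ‖f‖ = ‖hat f‖ := rfl

instance : NormedSpace ℂ (Wiener d) where
  norm_smul_le c f := by
    rw [norm_eq, norm_eq, show hat (c • f) = c • hat f from map_smul hatEquiv c f]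
    exact norm_smul_le c (hat f)

instance : CompleteSpace (Wiener d) := by
  have h : IsometryEquiv (Wiener d) (Lp ℂ 1 (volume : Measure (Rd d))) :=
    ⟨(hatEquiv (d := d)).toEquiv, fun _ _ => rfl⟩
  exact h.completeSpace

/-- The (continuous) function on `ℝ^d` which represents an element `f` of the Wiener algebra,
`f(x) = ∫ e^{2πi x·ξ} f̂(ξ) dξ`. -/
def val (f : Wiener d) (x : Rd d) : ℂ := 𝓕⁻ (hat f : Rd d → ℂ) x

theorem integrable_hat (f : Wiener d) : Integrable (hat f : Rd d → ℂ) := L1.integrable_coeFn _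

theorem integrable_char_smul (f : Wiener d) (x : Rd d) :
    Integrable fun ξ : Rd d => Real.fourierChar (inner ℝ ξ x) • (hat f : Rd d → ℂ) ξ := by
  refine (integrable_hat f).mono ?_ (Filter.Eventually.of_forall fun ξ => by simp)
  exact (Continuous.aestronglyMeasurable (by fun_prop)).smul (integrable_hat f).1

theorem val_add (f g : Wiener d) : val (f + g) = val f + val g := by
  funext x
  simp only [val, Pi.add_apply, Real.fourierInv_eq]
  rw [← integral_add (integrable_char_smul f x) (integrable_char_smul g x)]
  refine integral_congr_ae ?_
  have h : hat (f + g) = hat f + hat g := map_add hatEquiv f g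
  rw [h]
  filter_upwards [Lp.coeFn_add (hat f) (hat g)] with ξ hξ
  rw [hξ, Pi.add_apply, smul_add]

theorem val_smul (c : ℂ) (f : Wiener d) : val (c • f) = c • val f := by
  funext x
  simp only [val, Pi.smul_apply, Real.fourierInv_eq]
  rw [← integral_smul]
  refine integral_congr_ae ?_
  have h : hat (c • f) = c • hat f := map_smul hatEquiv c f
  rw [h]
  filter_upwards [Lp.coeFn_smul c (hat f)] with ξ hξ
  rw [hξ, Pi.smul_apply, smul_comm]

/-- The distribution `f ∈ W` is the function `f.val`. -/
theorem toDistribution_apply (f : Wiener d) (η : 𝓢(Rd d, ℂ)) :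
    toDistribution f η = ∫ x, η x * val f x := by
  have h1 : toDistribution f η = ∫ ξ, (𝓕⁻ η) ξ • (hat f : Rd d → ℂ) ξ := by
    rw [← Lp.toTemperedDistribution_apply]
    change _ = l1Emb d (hat f) (𝓕⁻ η)
    rw [l1Emb_hat, TemperedDistribution.fourier_apply, FourierTransform.fourier_fourierInv_eq]
  rw [h1]
  have hL : Continuous fun p : Rd d × Rd d => (-innerₗ (Rd d)) p.1 p.2 := by
    simp only [LinearMap.neg_apply, innerₗ_apply_apply]
    fun_prop
  have hflip : (-innerₗ (Rd d)).flip = -innerₗ (Rd d) := by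
    ext x y
    simp [real_inner_comm]
  have h2 := VectorFourier.integral_fourierIntegral_smul_eq_flip (μ := (volume : Measure (Rd d)))
    (ν := (volume : Measure (Rd d))) (f := (η : Rd d → ℂ)) (g := (hat f : Rd d → ℂ))
    Real.continuous_fourierChar hL η.integrable (integrable_hat f)
  rw [hflip] at h2
  rw [SchwartzMap.fourierInv_coe]
  exact h2

/-- The free Schrödinger group `e^{itΔ}` on the Wiener algebra: the Fourier transform is
multiplied by the symbol `e^{-it|2πξ|²}`. -/
def schrodinger (t : ℝ) (f : Wiener d) : Wiener d :=
  ofHat (Integrable.toL1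
    (fun ξ : Rd d =>
      Complex.exp (-(Complex.I * ((t * (2 * Real.pi * ‖ξ‖) ^ 2 : ℝ) : ℂ))) * hat f ξ)
    (by
      refine (integrable_hat f).mono ?_ (Filter.Eventually.of_forall fun ξ => ?_)
      · exact (Continuous.aestronglyMeasurable (by fun_prop)).mul (integrable_hat f).1
      · rw [norm_mul, mul_comm Complex.I, ← neg_mul, ← Complex.ofReal_neg,
          Complex.norm_exp_ofReal_mul_I, one_mul]))

end Wiener

/-! ### The space `L² ∩ W` -/

/-- The space `L²(ℝ^d) ∩ W`: the pairs of an element of `W` and an element of `L²` which are the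
same function. The norm is the maximum of the `W` norm and the `L²` norm. -/
def L2W (d : ℕ) : Submodule ℂ (Wiener d × Lp ℂ 2 (volume : Measure (Rd d))) where
  carrier := {p | Wiener.val p.1 =ᵐ[volume] p.2}
  zero_mem' := by
    have h : Wiener.val (0 : Wiener d) = 0 := by
      simpa using Wiener.val_smul (0 : ℂ) (0 : Wiener d)
    simpa [h] using (Lp.coeFn_zero ℂ 2 (volume : Measure (Rd d))).symm
  add_mem' := by
    rintro ⟨f₁, g₁⟩ ⟨f₂, g₂⟩ (h₁ : Wiener.val f₁ =ᵐ[volume] g₁) (h₂ : Wiener.val f₂ =ᵐ[volume] g₂)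
    change Wiener.val (f₁ + f₂) =ᵐ[volume] (g₁ + g₂ : Lp ℂ 2 (volume : Measure (Rd d)))
    rw [Wiener.val_add]
    exact (h₁.add h₂).trans (Lp.coeFn_add g₁ g₂).symm
  smul_mem' := by
    rintro c ⟨f, g⟩ (h : Wiener.val f =ᵐ[volume] g)
    change Wiener.val (c • f) =ᵐ[volume] (c • g : Lp ℂ 2 (volume : Measure (Rd d)))
    rw [Wiener.val_smul]
    exact (h.const_smul c).trans (Lp.coeFn_smul c g).symm

/-- The continuous inclusion `L² ∩ W ⊆ W`. -/
def L2W.toWiener (d : ℕ) : L2W d →L[ℂ] Wiener d :=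
  (ContinuousLinearMap.fst ℂ (Wiener d) (Lp ℂ 2 (volume : Measure (Rd d)))).comp (L2W d).subtypeL

/-! ### The Hartree equation -/

/-- The Hartree kernel `K(x) = lam / |x|^γ`. -/
def kernel (d : ℕ) (lam γ : ℝ) (x : Rd d) : ℝ := lam / ‖x‖ ^ γ

/-- The convolution `(K ∗ |f|²)(x) = ∫ K(y) |f(x - y)|² dy`. -/
def potential {d : ℕ} (K : Rd d → ℝ) (f : Wiener d) : Rd d → ℝ :=
  convolution K (fun y => ‖f.val y‖ ^ 2) (ContinuousLinearMap.mul ℝ ℝ) volume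

/-- `F = (K ∗ |f|²) f`: the integrals which define `K ∗ |f|²` converge, and the product
`(K ∗ |f|²) f` is the element `F` of the Wiener algebra. -/
def IsNonlinearity {d : ℕ} (K : Rd d → ℝ) (f F : Wiener d) : Prop :=
  ConvolutionExists K (fun y => ‖f.val y‖ ^ 2) (ContinuousLinearMap.mul ℝ ℝ) volume ∧
    ∀ x, F.val x = (potential K f x : ℂ) * f.val x

/-- `u : [0,T] → W` solves `i ∂ₜu + Δu = (K ∗ |u|²) u`, `u(0) = φ`, in the sense of Duhamel's
formula `u(t) = e^{itΔ} φ - i ∫₀ᵗ e^{i(t-τ)Δ} ((K ∗ |u|²) u)(τ) dτ` in `W`. Here the nonlinearity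
`(K ∗ |u|²) u` is well defined with values in `W` at each time, and it is integrable in time. -/
def IsSolution {d : ℕ} (K : Rd d → ℝ) (T : ℝ) (φ : Wiener d) (u : Icc (0 : ℝ) T → Wiener d) :
    Prop :=
  ∃ F : ℝ → Wiener d, IntegrableOn F (Icc 0 T) ∧
    (∀ τ : Icc (0 : ℝ) T, IsNonlinearity K (u τ) (F τ)) ∧
    ∀ t : Icc (0 : ℝ) T,
      u t = Wiener.schrodinger t φ
        - Complex.I • ∫ τ in (0 : ℝ)..t, Wiener.schrodinger (t - τ) (F τ)

/-- Local well-posedness, from `S` to `S`, of the Hartree equation in a normed space `S` which is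
embedded into `W` by `j`: for all bounded `B ⊆ S` there are `T > 0` and a Banach space
`X ↪ C([0,T]; S)` such that each `φ ∈ B` has a unique solution in `X`, and the map from `φ ∈ B` to
this solution is uniformly continuous from `B` (with the norm of `S`) to `C([0,T]; S)`. -/
def LocallyWellPosed {d : ℕ} (K : Rd d → ℝ) {S : Type} [NormedAddCommGroup S] [NormedSpace ℂ S]
    (j : S →L[ℂ] Wiener d) : Prop :=
  ∀ B : Set S, Bornology.IsBounded B → ∃ T : ℝ, 0 < T ∧
    ∃ (X : Type) (_ : NormedAddCommGroup X) (_ : NormedSpace ℂ X) (_ : CompleteSpace X)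
      (ι : X →L[ℂ] C(Icc (0 : ℝ) T, S)), Function.Injective ι ∧
      (∀ φ ∈ B, ∃! ψ : X, IsSolution K T (j φ) (fun t => j (ι ψ t))) ∧
      ∃ Ψ : S → X, (∀ φ ∈ B, IsSolution K T (j φ) (fun t => j (ι (Ψ φ) t))) ∧
        UniformContinuousOn (fun φ => ι (Ψ φ)) B

end Hartree

end

/-!
The equation is studied in the interaction picture: `z(t) = e^{-itΔ} u(t)` solves the ordinary
differential equation `z' = -i e^{-itΔ} N(e^{itΔ} z)` with `N(u) = (K ∗ |u|²) u`, and Duhamel's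
formula is its integrated form (`CubicEvolution.IsTrajectory.duhamel`,
`CubicEvolution.exists_isTrajectory_of_duhamel`). No derivatives are lost, so that everything
follows from bounds of `N` by the Picard–Lindelöf theorem and Grönwall's inequality.

*Well-posedness in `L² ∩ W`.* Writing `|x|^{-γ}` as a superposition of Gaussians, one sees that
`|x|^{-γ} ∗ f` belongs to `W` for `f ∈ L¹ ∩ W`: the low frequencies are controlled by `‖f‖_{L¹}` and
the high ones by `‖f‖_W` (`norm_rieszPotential_le`). For `f = |u|²` with `u ∈ L² ∩ W` this makes `N`
a locally Lipschitz cubic map of `L² ∩ W`. Splitting the frequencies at a scale which depends on `s`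
gives more: the bound is the same for all the norms `max (e^{(d-γ)s} ‖u‖_W, e^{-γs} ‖u‖_{L²})`
(`norm_hartreePotential_le_scaledNorm`).

*Data without solutions.* A function `f ∈ W` need not decay, and `K ∗ |f|²` may diverge. A sum of
slowly decreasing multiples of ever wider Gaussians, each of norm one in `W`, is such a function
(`exists_not_integrable_kernel`). Hence in each ball of `W` there are data without any solution, and
there is no solution map at all.

*Failure of uniform continuity for data in `L²`.* Let `p` be a fixed datum with a Schwartz function
as its Fourier transform, and perturb it by the multiple `w` of a Gaussian of width `e^{2s}` which
has the norm `α e^{-(d-γ)s}` in `W`. As `s → ∞` the perturbation tends to zero in `W`, but its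
potential `K ∗ |w|²` is of size `α²` on the set where `p` lives. The solutions with data `p` and `p + w`
therefore drift apart with a speed independent of `s`: tested with the conjugate of `p`, the
difference of the two Hartree terms is bounded from below (`exists_growth`). To see that the first
Picard iterate is accurate on a time interval which does not shrink as `s → ∞`, the solution is
decomposed as `v + ω` with `v(0) = p`, `ω(0) = w`, and `(v, ω)` is estimated in `L² ∩ W` with the
usual norm for `v` and the norm of scale `s` for `ω` (`pairEvolution`). In these norms the data stay
bounded and the nonlinearity has a constant which does not depend on `s`.
-/

namespace Hartree

open Filter Topology
open scoped BoundedContinuousFunction ComplexConjugate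

noncomputable section

-- shortcuts for the instance search, needed in the proofs only
local instance (d : ℕ) : NormedAddCommGroup (L2W d) := inferInstance

local instance (d : ℕ) : NormedSpace ℂ (L2W d) := inferInstance

/-! ### Multiplication of `L^p` functions by bounded continuous functions -/

section BoundedMultiplication

variable {X : Type*} [TopologicalSpace X] [MeasurableSpace X] [OpensMeasurableSpace X]
  {p : ℝ≥0∞} {μ : Measure X}

theorem memLp_bcf_mul (m : X →ᵇ ℂ) (f : Lp ℂ p μ) : MemLp (fun x => m x * f x) p μ :=
  (Lp.memLp f).of_le_mul (c := ‖m‖) (m.continuous.aestronglyMeasurable.mul (Lp.memLp f).1)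
    (Eventually.of_forall fun x => by
      rw [norm_mul]; gcongr; exact m.norm_coe_le_norm x)

variable [Fact (1 ≤ p)]

variable (p μ) in
/-- Multiplication of `L^p` functions by bounded continuous functions. -/
def bddMul : (X →ᵇ ℂ) →L[ℂ] Lp ℂ p μ →L[ℂ] Lp ℂ p μ :=
  LinearMap.mkContinuous₂
    (LinearMap.mk₂ ℂ (fun m f => (memLp_bcf_mul m f).toLp)
      (fun m n f => by
        rw [← MemLp.toLp_add]
        exact MemLp.toLp_congr _ _ (Eventually.of_forall fun x => by simp [add_mul]))
      (fun c m f => by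
        rw [← MemLp.toLp_const_smul]
        exact MemLp.toLp_congr _ _ (Eventually.of_forall fun x => by simp [mul_assoc]))
      (fun m f g => by
        rw [← MemLp.toLp_add]
        refine MemLp.toLp_congr _ _ ?_
        filter_upwards [Lp.coeFn_add f g] with x hx
        rw [hx, Pi.add_apply, Pi.add_apply, mul_add])
      (fun c m f => by
        rw [← MemLp.toLp_const_smul]
        refine MemLp.toLp_congr _ _ ?_
        filter_upwards [Lp.coeFn_smul c f] with x hx
        simp only [hx, Pi.smul_apply, smul_eq_mul]
        ring)) 1
    (fun m f => by
      rw [one_mul]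
      refine Lp.norm_le_mul_norm_of_ae_le_mul ?_
      filter_upwards [(memLp_bcf_mul m f).coeFn_toLp] with x hx
      simp only [LinearMap.mk₂_apply]
      rw [hx, norm_mul]
      gcongr
      exact m.norm_coe_le_norm x)

theorem coeFn_bddMul (m : X →ᵇ ℂ) (f : Lp ℂ p μ) :
    bddMul p μ m f =ᵐ[μ] fun x => m x * f x := (memLp_bcf_mul m f).coeFn_toLp

theorem norm_bddMul_le (m : X →ᵇ ℂ) (f : Lp ℂ p μ) : ‖bddMul p μ m f‖ ≤ ‖m‖ * ‖f‖ := by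
  refine Lp.norm_le_mul_norm_of_ae_le_mul ?_
  filter_upwards [coeFn_bddMul m f] with x hx
  rw [hx, norm_mul]
  gcongr
  exact m.norm_coe_le_norm x

theorem bddMul_mul (m n : X →ᵇ ℂ) (f : Lp ℂ p μ) :
    bddMul p μ (m * n) f = bddMul p μ m (bddMul p μ n f) := by
  refine Lp.ext ?_
  filter_upwards [coeFn_bddMul (m * n) f, coeFn_bddMul m (bddMul p μ n f), coeFn_bddMul n f]
    with x h1 h2 h3
  rw [h1, h2, h3, BoundedContinuousFunction.mul_apply, mul_assoc]

theorem bddMul_one (f : Lp ℂ p μ) : bddMul p μ 1 f = f := by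
  refine Lp.ext ?_
  filter_upwards [coeFn_bddMul 1 f] with x h1
  rw [h1, BoundedContinuousFunction.coe_one, Pi.one_apply, one_mul]

/-- Pointwise bounded convergence of the multipliers implies strong convergence on `L^p`,
by dominated convergence. -/
theorem tendsto_bddMul (hp : p ≠ ∞) {ι : Type*} {l : Filter ι} [l.IsCountablyGenerated]
    {m : ι → X →ᵇ ℂ} {m₀ : X →ᵇ ℂ} {C : ℝ} (hC : ∀ᶠ i in l, ‖m i‖ ≤ C)
    (h : ∀ x, Tendsto (fun i => m i x) l (𝓝 (m₀ x))) (f : Lp ℂ p μ) :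
    Tendsto (fun i => bddMul p μ (m i) f) l (𝓝 (bddMul p μ m₀ f)) := by
  have hp0 : p ≠ 0 := (lt_of_lt_of_le one_pos (Fact.out : 1 ≤ p)).ne'
  have hpr : 0 < p.toReal := ENNReal.toReal_pos hp0 hp
  rw [Lp.tendsto_Lp_iff_tendsto_eLpNorm']
  have key : Tendsto (fun i => ∫⁻ x, (‖(m i x - m₀ x) * f x‖ₑ) ^ p.toReal ∂μ) l (𝓝 0) := by
    have := tendsto_lintegral_filter_of_dominated_convergence' (μ := μ) (l := l)
      (F := fun i x => (‖(m i x - m₀ x) * f x‖ₑ) ^ p.toReal) (f := fun _ => 0)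
      (fun x => (ENNReal.ofReal (C + ‖m₀‖) * ‖f x‖ₑ) ^ p.toReal) ?_ ?_ ?_ ?_
    · simpa using this
    · refine Eventually.of_forall fun i => ?_
      exact ((((m i).continuous.sub m₀.continuous).aestronglyMeasurable.mul
        (Lp.aestronglyMeasurable f)).enorm).pow_const _
    · filter_upwards [hC] with i hi
      refine Eventually.of_forall fun x => ?_
      rw [enorm_mul]
      gcongr
      rw [← ofReal_norm]
      refine ENNReal.ofReal_le_ofReal ((norm_sub_le _ _).trans ?_)
      gcongr
      · exact ((m i).norm_coe_le_norm x).trans hi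
      · exact m₀.norm_coe_le_norm x
    · simp_rw [ENNReal.mul_rpow_of_nonneg _ _ hpr.le]
      rw [lintegral_const_mul' _ _ (ENNReal.rpow_ne_top_of_nonneg hpr.le ENNReal.ofReal_ne_top)]
      refine ENNReal.mul_ne_top (ENNReal.rpow_ne_top_of_nonneg hpr.le ENNReal.ofReal_ne_top) ?_
      exact (lintegral_rpow_enorm_lt_top_of_eLpNorm_lt_top hp0 hp (Lp.eLpNorm_lt_top f)).ne
    · refine Eventually.of_forall fun x => ?_
      have h1 : Tendsto (fun i => ‖(m i x - m₀ x) * f x‖ₑ) l (𝓝 0) := by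
        have := ((h x).sub_const (m₀ x)).mul_const (f x)
        simpa using this.enorm
      have := (ENNReal.continuous_rpow_const (y := p.toReal)).tendsto 0 |>.comp h1
      simpa [ENNReal.zero_rpow_of_pos hpr, Function.comp_def] using this
  have h2 := (ENNReal.continuous_rpow_const (y := 1 / p.toReal)).tendsto 0 |>.comp key
  rw [ENNReal.zero_rpow_of_pos (by positivity)] at h2
  refine h2.congr fun i => ?_
  rw [Function.comp_apply, ← eLpNorm_eq_lintegral_rpow_enorm_toReal hp0 hp]
  refine eLpNorm_congr_ae ?_
  filter_upwards [coeFn_bddMul (m i) f, coeFn_bddMul m₀ f] with x h1 h2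
  simp [h1, h2, sub_mul]

end BoundedMultiplication

/-! ### Basic facts on the Wiener algebra -/

section Basic

variable {d : ℕ}

/-- The Fourier transform as an isometric isomorphism between the Wiener algebra and `L¹`. -/
def hatIso : Wiener d ≃ₗᵢ[ℂ] Lp ℂ 1 (volume : Measure (Rd d)) :=
  ⟨Wiener.hatEquiv, fun _ => rfl⟩

theorem hatIso_apply (f : Wiener d) : hatIso f = f.hat := rfl

theorem hat_hatIso_symm (g : Lp ℂ 1 (volume : Measure (Rd d))) :
    Wiener.hat (hatIso.symm g) = g := hatIso.apply_symm_apply g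

theorem wiener_norm_eq_integral (f : Wiener d) : ‖f‖ = ∫ ξ, ‖f.hat ξ‖ := by
  rw [Wiener.norm_eq, L1.norm_eq_integral_norm]

theorem norm_val_le (f : Wiener d) (x : Rd d) : ‖f.val x‖ ≤ ‖f‖ := by
  rw [wiener_norm_eq_integral, Wiener.val, Real.fourierInv_eq]
  refine (norm_integral_le_integral_norm _).trans_eq ?_
  simp

theorem continuous_val (f : Wiener d) : Continuous f.val := by
  have := VectorFourier.fourierIntegral_continuous (μ := (volume : Measure (Rd d)))
    (L := -innerₗ (Rd d)) Real.continuous_fourierChar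
    (by simp only [LinearMap.neg_apply, innerₗ_apply_apply]; fun_prop) f.integrable_hat
  exact this

/-- The elements of the Wiener algebra as bounded continuous functions. -/
def valBCF : Wiener d →L[ℂ] (Rd d →ᵇ ℂ) :=
  LinearMap.mkContinuous
    { toFun := fun f => BoundedContinuousFunction.ofNormedAddCommGroup f.val (continuous_val f) ‖f‖
        (norm_val_le f)
      map_add' := fun f g => by ext x; simp [Wiener.val_add]
      map_smul' := fun c f => by ext x; simp [Wiener.val_smul] } 1
    (fun f => by
      rw [one_mul]
      exact BoundedContinuousFunction.norm_ofNormedAddCommGroup_le (continuous_val f)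
        (norm_nonneg f) (norm_val_le f))

@[simp] theorem valBCF_apply (f : Wiener d) (x : Rd d) : valBCF f x = f.val x := rfl

theorem norm_valBCF_le (f : Wiener d) : ‖valBCF f‖ ≤ ‖f‖ :=
  BoundedContinuousFunction.norm_ofNormedAddCommGroup_le (continuous_val f) (norm_nonneg f)
    (norm_val_le f)

theorem val_sub (f g : Wiener d) (x : Rd d) : (f - g).val x = f.val x - g.val x := by
  rw [← valBCF_apply, map_sub]; rfl

theorem val_injective : Function.Injective (Wiener.val (d := d)) := fun f g h =>
  Wiener.toDistribution_injective <| by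
    ext η
    rw [Wiener.toDistribution_apply, Wiener.toDistribution_apply, h]

/-- Locally integrable functions which define the same tempered distribution agree a.e. -/
theorem ae_eq_of_integral_schwartz_mul_eq {f g : Rd d → ℂ} (hf : LocallyIntegrable f)
    (hg : LocallyIntegrable g) (h : ∀ η : 𝓢(Rd d, ℂ), ∫ x, η x * f x = ∫ x, η x * g x) :
    f =ᵐ[volume] g := by
  refine ae_eq_of_integral_contDiff_smul_eq hf hg fun φ hφ hφs => ?_
  have hc : HasCompactSupport fun x => (φ x : ℂ) := hφs.comp_left Complex.ofReal_zero
  exact h (hc.toSchwartzMap (Complex.ofRealCLM.contDiff.comp hφ))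

theorem memLp_two_val (p : L2W d) : MemLp p.1.1.val 2 :=
  (Lp.memLp p.1.2).ae_eq (show p.1.1.val =ᵐ[volume] p.1.2 from p.2).symm

/-- Plancherel: a pair in `W × L²` is one function if and only if the two Fourier transforms,
that in `L¹` and that in `L²`, agree. -/
theorem mem_L2W_iff (p : Wiener d × Lp ℂ 2 (volume : Measure (Rd d))) :
    p ∈ L2W d ↔ p.1.hat =ᵐ[volume] (𝓕 p.2 : Lp ℂ 2 (volume : Measure (Rd d))) := by
  have h1 : ∀ η : 𝓢(Rd d, ℂ), ∫ x, η x * p.1.hat x = Wiener.toDistribution p.1 (𝓕 η) := by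
    intro η
    have h := Lp.toTemperedDistribution_apply p.1.hat η
    simp only [smul_eq_mul] at h
    rw [← h]
    change l1Emb d p.1.hat η = _
    rw [Wiener.l1Emb_hat, TemperedDistribution.fourier_apply]
  have h2 : ∀ η : 𝓢(Rd d, ℂ), ∫ x, η x * (𝓕 p.2 : Lp ℂ 2 (volume : Measure (Rd d))) x
      = ∫ x, (𝓕 η) x * p.2 x := by
    intro η
    have h := Lp.toTemperedDistribution_apply (𝓕 p.2 : Lp ℂ 2 (volume : Measure (Rd d))) η
    simp only [smul_eq_mul] at h
    rw [← h, ← Lp.fourier_toTemperedDistribution_eq, TemperedDistribution.fourier_apply]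
    simp
  constructor
  · intro (h : p.1.val =ᵐ[volume] p.2)
    refine ae_eq_of_integral_schwartz_mul_eq p.1.integrable_hat.locallyIntegrable
      ((Lp.memLp _).locallyIntegrable (by norm_num)) fun η => ?_
    rw [h1, h2, Wiener.toDistribution_apply]
    exact integral_congr_ae (h.mono fun x hx => by simp [hx])
  · intro h
    change p.1.val =ᵐ[volume] p.2
    refine ae_eq_of_integral_schwartz_mul_eq (continuous_val _).locallyIntegrable
      ((Lp.memLp _).locallyIntegrable (by norm_num)) fun η => ?_
    have h3 := h1 (𝓕⁻ η)
    have h4 := h2 (𝓕⁻ η)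
    rw [FourierTransform.fourier_fourierInv_eq] at h3 h4
    rw [← Wiener.toDistribution_apply, ← h3, ← h4]
    exact integral_congr_ae (h.mono fun x hx => by simp [hx])

theorem L2W.hat_ae_eq (p : L2W d) :
    p.1.1.hat =ᵐ[volume] (𝓕 p.1.2 : Lp ℂ 2 (volume : Measure (Rd d))) := (mem_L2W_iff p.1).1 p.2

theorem L2W.norm_eq_max (p : L2W d) : ‖p‖ = max ‖p.1.1‖ ‖p.1.2‖ := rfl

/-- An element of `L² ∩ W` is determined by the function it represents. -/
theorem L2W.toWiener_injective : Function.Injective (L2W.toWiener d) := by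
  intro p q h
  have h' : p.1.1 = q.1.1 := h
  refine Subtype.ext (Prod.ext h' (Lp.ext ?_))
  have hp : p.1.1.val =ᵐ[volume] p.1.2 := p.2
  have hq : q.1.1.val =ᵐ[volume] q.1.2 := q.2
  rw [h'] at hp
  exact hp.symm.trans hq

instance : CompleteSpace (L2W d) := by
  have : IsClosed (L2W d : Set (Wiener d × Lp ℂ 2 (volume : Measure (Rd d)))) := by
    refine isSeqClosed_iff_isClosed.1 fun u p hu hp => ?_
    have h2 := (tendstoInMeasure_of_tendsto_Lp ((continuous_snd.tendsto p).comp hp))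
    obtain ⟨φ, hφ, hφ'⟩ := h2.exists_seq_tendsto_ae
    have hae : ∀ᵐ x, ∀ n, (u n).1.val x = (u n).2 x := ae_all_iff.2 fun n => hu n
    change p.1.val =ᵐ[volume] p.2
    filter_upwards [hφ', hae] with x hx hx'
    refine tendsto_nhds_unique ?_ hx
    have h3 : Tendsto (fun n => (valBCF (u n).1) x) atTop (𝓝 (valBCF p.1 x)) :=
      ((BoundedContinuousFunction.evalCLM ℂ x).continuous.tendsto _).comp
        ((valBCF.continuous.tendsto _).comp ((continuous_fst.tendsto p).comp hp))
    refine (h3.comp hφ.tendsto_atTop).congr fun n => ?_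
    exact hx' _
  exact this.completeSpace_coe

end Basic

section Multipliers

variable {d : ℕ}

/-! ### Fourier multipliers and the Schrödinger group -/

/-- The Fourier multiplier on the Wiener algebra with a bounded continuous symbol. -/
def wienerMultiplier (m : Rd d →ᵇ ℂ) : Wiener d →L[ℂ] Wiener d :=
  ((hatIso (d := d)).symm.toContinuousLinearEquiv : _ →L[ℂ] Wiener d).comp
    ((bddMul 1 volume m).comp
      ((hatIso (d := d)).toContinuousLinearEquiv : Wiener d →L[ℂ] _))

theorem wienerMultiplier_apply (m : Rd d →ᵇ ℂ) (f : Wiener d) :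
    wienerMultiplier m f = hatIso.symm (bddMul 1 volume m (hatIso f)) := rfl

theorem hat_wienerMultiplier (m : Rd d →ᵇ ℂ) (f : Wiener d) :
    (wienerMultiplier m f).hat = bddMul 1 volume m f.hat := by
  rw [wienerMultiplier_apply, hat_hatIso_symm, hatIso_apply]

theorem norm_wienerMultiplier_le (m : Rd d →ᵇ ℂ) (f : Wiener d) :
    ‖wienerMultiplier m f‖ ≤ ‖m‖ * ‖f‖ := by
  rw [Wiener.norm_eq, Wiener.norm_eq, hat_wienerMultiplier]
  exact norm_bddMul_le m _

/-- The Fourier multiplier on `L² ∩ W` with a bounded continuous symbol. -/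
def multiplier (m : Rd d →ᵇ ℂ) : L2W d →L[ℂ] L2W d :=
  ContinuousLinearMap.codRestrict
    ((((wienerMultiplier m).comp (ContinuousLinearMap.fst ℂ _ _)).prod
      (((Lp.fourierTransformₗᵢ (Rd d) ℂ).symm.toContinuousLinearEquiv : _ →L[ℂ] _).comp
        ((bddMul 2 volume m).comp
          (((Lp.fourierTransformₗᵢ (Rd d) ℂ).toContinuousLinearEquiv : _ →L[ℂ] _).comp
            (ContinuousLinearMap.snd ℂ _ _))))).comp (L2W d).subtypeL) (L2W d)
    (fun p => by
      rw [mem_L2W_iff]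
      change (wienerMultiplier m p.1.1).hat =ᵐ[volume]
        (𝓕 (𝓕⁻ (bddMul 2 volume m (𝓕 p.1.2))) : Lp ℂ 2 (volume : Measure (Rd d)))
      rw [FourierTransform.fourier_fourierInv_eq, hat_wienerMultiplier]
      filter_upwards [coeFn_bddMul m p.1.1.hat, coeFn_bddMul m (𝓕 p.1.2), L2W.hat_ae_eq p]
        with x h1 h2 h3
      rw [h1, h2, h3])

theorem multiplier_snd (m : Rd d →ᵇ ℂ) (p : L2W d) :
    (multiplier m p).1.2 = 𝓕⁻ (bddMul 2 volume m (𝓕 p.1.2)) := rfl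

theorem toWiener_multiplier (m : Rd d →ᵇ ℂ) (p : L2W d) :
    L2W.toWiener d (multiplier m p) = wienerMultiplier m (L2W.toWiener d p) := rfl

theorem norm_multiplier_snd_le (m : Rd d →ᵇ ℂ) (p : L2W d) :
    ‖(multiplier m p).1.2‖ ≤ ‖m‖ * ‖p.1.2‖ := by
  rw [multiplier_snd, ← Lp.norm_fourier_eq (𝓕⁻ _), FourierTransform.fourier_fourierInv_eq,
    ← Lp.norm_fourier_eq p.1.2]
  exact norm_bddMul_le m _

theorem multiplier_mul (m n : Rd d →ᵇ ℂ) (p : L2W d) :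
    multiplier (m * n) p = multiplier m (multiplier n p) := by
  refine L2W.toWiener_injective ?_
  simp only [toWiener_multiplier, wienerMultiplier_apply, bddMul_mul,
    LinearIsometryEquiv.apply_symm_apply]

theorem multiplier_one (p : L2W d) : multiplier 1 p = p := by
  refine L2W.toWiener_injective ?_
  simp only [toWiener_multiplier, wienerMultiplier_apply, bddMul_one,
    LinearIsometryEquiv.symm_apply_apply]

theorem tendsto_wienerMultiplier {ι : Type*} {l : Filter ι} [l.IsCountablyGenerated]
    {m : ι → Rd d →ᵇ ℂ} {m₀ : Rd d →ᵇ ℂ} {C : ℝ} (hC : ∀ᶠ i in l, ‖m i‖ ≤ C)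
    (h : ∀ x, Tendsto (fun i => m i x) l (𝓝 (m₀ x))) (f : Wiener d) :
    Tendsto (fun i => wienerMultiplier (m i) f) l (𝓝 (wienerMultiplier m₀ f)) := by
  simp only [wienerMultiplier_apply]
  exact (hatIso.symm.continuous.tendsto _).comp (tendsto_bddMul ENNReal.one_ne_top hC h _)

theorem tendsto_multiplier {ι : Type*} {l : Filter ι} [l.IsCountablyGenerated]
    {m : ι → Rd d →ᵇ ℂ} {m₀ : Rd d →ᵇ ℂ} {C : ℝ} (hC : ∀ᶠ i in l, ‖m i‖ ≤ C)
    (h : ∀ x, Tendsto (fun i => m i x) l (𝓝 (m₀ x))) (p : L2W d) :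
    Tendsto (fun i => multiplier (m i) p) l (𝓝 (multiplier m₀ p)) := by
  rw [tendsto_subtype_rng]
  refine Prod.tendsto_iff _ _ |>.2 ⟨tendsto_wienerMultiplier hC h _, ?_⟩
  simp only [multiplier_snd]
  exact ((Lp.fourierTransformₗᵢ (Rd d) ℂ).symm.continuous.tendsto _).comp
    (tendsto_bddMul ENNReal.ofNat_ne_top hC h _)

/-- The symbol `e^{-it|2πξ|²}` of the free Schrödinger group. -/
def phase (t : ℝ) : Rd d →ᵇ ℂ :=
  BoundedContinuousFunction.ofNormedAddCommGroup
    (fun ξ : Rd d => Complex.exp (-(Complex.I * ((t * (2 * Real.pi * ‖ξ‖) ^ 2 : ℝ) : ℂ))))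
    (by fun_prop) 1 (fun ξ => by
      rw [mul_comm Complex.I, ← neg_mul, ← Complex.ofReal_neg, Complex.norm_exp_ofReal_mul_I])

theorem phase_apply (t : ℝ) (ξ : Rd d) :
    phase t ξ = Complex.exp (-(Complex.I * ((t * (2 * Real.pi * ‖ξ‖) ^ 2 : ℝ) : ℂ))) := rfl

theorem norm_phase_le (t : ℝ) : ‖(phase t : Rd d →ᵇ ℂ)‖ ≤ 1 :=
  BoundedContinuousFunction.norm_ofNormedAddCommGroup_le _ zero_le_one _

theorem phase_add (s t : ℝ) : (phase (s + t) : Rd d →ᵇ ℂ) = phase s * phase t := by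
  ext ξ
  rw [BoundedContinuousFunction.mul_apply, phase_apply, phase_apply, phase_apply, ← Complex.exp_add]
  congr 1
  push_cast
  ring

theorem phase_zero : (phase 0 : Rd d →ᵇ ℂ) = 1 := by
  ext ξ
  simp [phase_apply]

theorem schrodinger_eq (t : ℝ) (f : Wiener d) :
    Wiener.schrodinger t f = wienerMultiplier (phase t) f := by
  refine hatIso.injective ?_
  rw [hatIso_apply, hatIso_apply, hat_wienerMultiplier]
  refine Lp.ext ?_
  have h : (Wiener.schrodinger t f).hat = _ := hat_hatIso_symm _
  rw [h]
  refine (Integrable.coeFn_toL1 _).trans (coeFn_bddMul (phase t) f.hat).symm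

/-- The free Schrödinger group on `L² ∩ W`. -/
def freeGroup (t : ℝ) : L2W d →L[ℂ] L2W d := multiplier (phase t)

theorem toWiener_freeGroup (t : ℝ) (p : L2W d) :
    L2W.toWiener d (freeGroup t p) = Wiener.schrodinger t (L2W.toWiener d p) :=
  (schrodinger_eq t _).symm

theorem freeGroup_add (s t : ℝ) (p : L2W d) :
    freeGroup (s + t) p = freeGroup s (freeGroup t p) := by
  rw [freeGroup, phase_add, multiplier_mul]; rfl

theorem freeGroup_zero (p : L2W d) : freeGroup 0 p = p := by
  rw [freeGroup, phase_zero, multiplier_one]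

theorem norm_freeGroup_fst_le (t : ℝ) (p : L2W d) : ‖(freeGroup t p).1.1‖ ≤ ‖p.1.1‖ :=
  (norm_wienerMultiplier_le _ _).trans
    (mul_le_of_le_one_left (norm_nonneg _) (norm_phase_le t))

theorem norm_freeGroup_snd_le (t : ℝ) (p : L2W d) : ‖(freeGroup t p).1.2‖ ≤ ‖p.1.2‖ :=
  (norm_multiplier_snd_le _ _).trans
    (mul_le_of_le_one_left (norm_nonneg _) (norm_phase_le t))

theorem continuous_freeGroup (p : L2W d) : Continuous fun t => freeGroup t p := by
  refine continuous_iff_continuousAt.2 fun t => ?_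
  refine tendsto_multiplier (C := 1) (Eventually.of_forall fun s => norm_phase_le s)
    (fun ξ => ?_) p
  have : Continuous fun s : ℝ => (phase s : Rd d →ᵇ ℂ) ξ := by
    simp only [phase_apply]; fun_prop
  exact this.tendsto t

/-! ### Products in the Wiener algebra -/

theorem integral_schwartz_mul_hat (f : Wiener d) (η : 𝓢(Rd d, ℂ)) :
    ∫ x, η x * f.hat x = ∫ x, (𝓕 η) x * f.val x := by
  have h := Lp.toTemperedDistribution_apply f.hat η
  simp only [smul_eq_mul] at h
  rw [← h, ← Wiener.toDistribution_apply]
  change l1Emb d f.hat η = _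
  rw [Wiener.l1Emb_hat, TemperedDistribution.fourier_apply]

theorem hat_ae_eq_fourier_val (f : Wiener d) (hf : Integrable f.val) :
    f.hat =ᵐ[volume] 𝓕 f.val := by
  have hL : Continuous fun p : Rd d × Rd d => (innerₗ (Rd d)) p.1 p.2 := by
    simp only [innerₗ_apply_apply]
    fun_prop
  refine ae_eq_of_integral_schwartz_mul_eq f.integrable_hat.locallyIntegrable ?_ fun η => ?_
  · exact (VectorFourier.fourierIntegral_continuous (μ := (volume : Measure (Rd d)))
      Real.continuous_fourierChar hL hf).locallyIntegrable
  · rw [integral_schwartz_mul_hat, SchwartzMap.fourier_coe]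
    have h2 := VectorFourier.integral_fourierIntegral_smul_eq_flip (μ := (volume : Measure (Rd d)))
      (ν := (volume : Measure (Rd d))) (f := (η : Rd d → ℂ)) (g := f.val)
      Real.continuous_fourierChar hL η.integrable hf
    rw [flip_innerₗ] at h2
    exact h2

/-- If `f ∈ W` is integrable, then `|f̂| ≤ ‖f‖_{L¹}` a.e. -/
theorem norm_hat_le_integral_norm_val (f : Wiener d) (hf : Integrable f.val) :
    ∀ᵐ ξ, ‖f.hat ξ‖ ≤ ∫ x, ‖f.val x‖ := by
  filter_upwards [hat_ae_eq_fourier_val f hf] with ξ hξ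
  rw [hξ]
  exact VectorFourier.norm_fourierIntegral_le_integral_norm _ _ _ _ _

/-- The element of the Wiener algebra with Fourier transform `g`. -/
def wienerOfHat (g : Rd d → ℂ) (hg : Integrable g) : Wiener d := hatIso.symm hg.toL1

theorem hat_wienerOfHat (g : Rd d → ℂ) (hg : Integrable g) :
    (wienerOfHat g hg).hat =ᵐ[volume] g := by
  rw [wienerOfHat, hat_hatIso_symm]
  exact hg.coeFn_toL1

theorem val_eq_of_hat_ae_eq {f : Wiener d} {g : Rd d → ℂ} (h : f.hat =ᵐ[volume] g) :
    f.val = 𝓕⁻ g := by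
  funext x
  rw [Wiener.val, Real.fourierInv_eq, Real.fourierInv_eq]
  exact integral_congr_ae (h.mono fun ξ hξ => by simp [hξ])

theorem val_wienerOfHat (g : Rd d → ℂ) (hg : Integrable g) :
    (wienerOfHat g hg).val = 𝓕⁻ g := val_eq_of_hat_ae_eq (hat_wienerOfHat g hg)

theorem norm_wienerOfHat (g : Rd d → ℂ) (hg : Integrable g) :
    ‖wienerOfHat g hg‖ = ∫ ξ, ‖g ξ‖ := by
  rw [wiener_norm_eq_integral]
  exact integral_congr_ae ((hat_wienerOfHat g hg).mono fun ξ hξ => by simp [hξ])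

theorem integrable_convolution_hat (f g : Wiener d) :
    Integrable (convolution f.hat g.hat (ContinuousLinearMap.mul ℂ ℂ) volume) :=
  f.integrable_hat.integrable_convolution _ g.integrable_hat

theorem val_wienerOfHat_convolution (f g : Wiener d) :
    (wienerOfHat _ (integrable_convolution_hat f g)).val = f.val * g.val := by
  funext x
  rw [val_wienerOfHat, Pi.mul_apply, Wiener.val, Wiener.val]
  simp only [Real.fourierInv_eq_fourier_neg]
  exact Real.fourier_mul_convolution_eq f.integrable_hat g.integrable_hat _

theorem norm_wienerOfHat_convolution_le (f g : Wiener d) :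
    ‖wienerOfHat _ (integrable_convolution_hat f g)‖ ≤ ‖f‖ * ‖g‖ := by
  rw [norm_wienerOfHat, wiener_norm_eq_integral, wiener_norm_eq_integral]
  have h := integral_convolution (ContinuousLinearMap.mul ℝ ℝ) (μ := (volume : Measure (Rd d)))
    (ν := (volume : Measure (Rd d))) f.integrable_hat.norm g.integrable_hat.norm
  rw [ContinuousLinearMap.mul_apply'] at h
  rw [← h]
  refine integral_mono (integrable_convolution_hat f g).norm
    (f.integrable_hat.norm.integrable_convolution _ g.integrable_hat.norm) fun x => ?_
  refine (norm_integral_le_integral_norm _).trans_eq ?_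
  simp [convolution]

/-- The product of the Wiener algebra; on the Fourier side it is convolution. -/
def wienerMul : Wiener d →L[ℂ] Wiener d →L[ℂ] Wiener d :=
  LinearMap.mkContinuous₂
    (LinearMap.mk₂ ℂ (fun f g => wienerOfHat _ (integrable_convolution_hat f g))
      (fun f f' g => val_injective <| by
        simp only [val_wienerOfHat_convolution, Wiener.val_add, add_mul])
      (fun c f g => val_injective <| by
        simp only [val_wienerOfHat_convolution, Wiener.val_smul, smul_mul_assoc])
      (fun f g g' => val_injective <| by
        simp only [val_wienerOfHat_convolution, Wiener.val_add, mul_add])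
      (fun c f g => val_injective <| by
        simp only [val_wienerOfHat_convolution, Wiener.val_smul, mul_smul_comm])) 1
    (fun f g => by rw [one_mul]; exact norm_wienerOfHat_convolution_le f g)

theorem val_wienerMul (f g : Wiener d) : (wienerMul f g).val = f.val * g.val :=
  val_wienerOfHat_convolution f g

theorem norm_wienerMul_le (f g : Wiener d) : ‖wienerMul f g‖ ≤ ‖f‖ * ‖g‖ :=
  norm_wienerOfHat_convolution_le f g

theorem integrable_conj_hat_neg (f : Wiener d) :
    Integrable fun ξ => conj (f.hat (-ξ)) :=
  Complex.conjCLE.toContinuousLinearMap.integrable_comp f.integrable_hat.comp_neg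

theorem val_wienerOfHat_conj (f : Wiener d) (x : Rd d) :
    (wienerOfHat _ (integrable_conj_hat_neg f)).val x = conj (f.val x) := by
  rw [val_wienerOfHat, Wiener.val, Real.fourierInv_eq, Real.fourierInv_eq, ← integral_conj,
    ← integral_neg_eq_self]
  refine integral_congr_ae (Eventually.of_forall fun ξ => ?_)
  simp [Circle.smul_def, AddChar.map_neg_eq_inv]

/-- Complex conjugation on the Wiener algebra. -/
def wienerConj : Wiener d →L[ℝ] Wiener d :=
  LinearMap.mkContinuous
    { toFun := fun f => wienerOfHat _ (integrable_conj_hat_neg f)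
      map_add' := fun f g => val_injective <| by
        funext x
        simp only [val_wienerOfHat_conj, Wiener.val_add, Pi.add_apply, map_add]
      map_smul' := fun c f => val_injective <| by
        funext x
        have h : ∀ g : Wiener d, c • g = (c : ℂ) • g := fun g => rfl
        simp only [RingHom.id_apply, h, val_wienerOfHat_conj, Wiener.val_smul, Pi.smul_apply,
          smul_eq_mul, map_mul, Complex.conj_ofReal] } 1
    (fun f => by
      rw [one_mul, wiener_norm_eq_integral f]
      refine ((norm_wienerOfHat _ _).trans ?_).le
      simp only [RCLike.norm_conj]
      exact integral_neg_eq_self (fun ξ => ‖f.hat ξ‖) volume)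

theorem val_wienerConj (f : Wiener d) (x : Rd d) : (wienerConj f).val x = conj (f.val x) :=
  val_wienerOfHat_conj f x

theorem norm_wienerConj_le (f : Wiener d) : ‖wienerConj f‖ ≤ ‖f‖ := by
  refine ((norm_wienerOfHat _ (integrable_conj_hat_neg f)).trans ?_).le
  rw [wiener_norm_eq_integral f]
  simp only [RCLike.norm_conj]
  exact integral_neg_eq_self (fun ξ => ‖f.hat ξ‖) volume

/-- The product of an element of `W` and an element of `L² ∩ W`. -/
def wienerAct (m : Wiener d) (p : L2W d) : L2W d :=
  ⟨(wienerMul m p.1.1, bddMul 2 volume (valBCF m) p.1.2), by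
    change (wienerMul m p.1.1).val =ᵐ[volume] (bddMul 2 volume (valBCF m) p.1.2)
    have hp : p.1.1.val =ᵐ[volume] p.1.2 := p.2
    filter_upwards [coeFn_bddMul (valBCF m) p.1.2, hp] with x h1 h2
    rw [h1, val_wienerMul, Pi.mul_apply, h2, valBCF_apply]⟩

theorem toWiener_wienerAct (m : Wiener d) (p : L2W d) :
    L2W.toWiener d (wienerAct m p) = wienerMul m (L2W.toWiener d p) := rfl

theorem norm_wienerAct_fst_le (m : Wiener d) (p : L2W d) :
    ‖(wienerAct m p).1.1‖ ≤ ‖m‖ * ‖p.1.1‖ := norm_wienerMul_le m p.1.1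

theorem norm_wienerAct_snd_le (m : Wiener d) (p : L2W d) :
    ‖(wienerAct m p).1.2‖ ≤ ‖m‖ * ‖p.1.2‖ :=
  (norm_bddMul_le (valBCF m) p.1.2).trans (by gcongr; exact norm_valBCF_le m)

theorem wienerAct_add_left (m n : Wiener d) (p : L2W d) :
    wienerAct (m + n) p = wienerAct m p + wienerAct n p :=
  L2W.toWiener_injective (by simp only [map_add, toWiener_wienerAct, add_apply])

theorem wienerAct_add_right (m : Wiener d) (p q : L2W d) :
    wienerAct m (p + q) = wienerAct m p + wienerAct m q :=
  L2W.toWiener_injective (by simp only [map_add, toWiener_wienerAct])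

theorem wienerAct_zero (m : Wiener d) : wienerAct m (0 : L2W d) = 0 :=
  L2W.toWiener_injective (by simp only [map_zero, toWiener_wienerAct])

/-- The density `f conj(g)` of two elements of `L² ∩ W`, as an element of `W`. -/
def density (p q : L2W d) : Wiener d := wienerMul p.1.1 (wienerConj q.1.1)

theorem val_density (p q : L2W d) (x : Rd d) :
    (density p q).val x = p.1.1.val x * conj (q.1.1.val x) := by
  rw [density, val_wienerMul, Pi.mul_apply, val_wienerConj]

theorem norm_density_le (p q : L2W d) : ‖density p q‖ ≤ ‖p.1.1‖ * ‖q.1.1‖ :=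
  (norm_wienerMul_le _ _).trans (by gcongr; exact norm_wienerConj_le _)

theorem integrable_density (p q : L2W d) : Integrable (density p q).val := by
  have h := (memLp_two_val p).integrable_mul (memLp_two_val q).star
  refine h.congr (Eventually.of_forall fun x => ?_)
  simp [val_density]

theorem integral_norm_density_le (p q : L2W d) :
    ∫ x, ‖(density p q).val x‖ ≤ ‖p.1.2‖ * ‖q.1.2‖ := by
  have hp : p.1.1.val =ᵐ[volume] p.1.2 := p.2
  have hq : q.1.1.val =ᵐ[volume] q.1.2 := q.2
  have h := integral_mul_norm_le_Lp_mul_Lq (μ := (volume : Measure (Rd d)))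
    (f := (p.1.2 : Rd d → ℂ)) (g := (q.1.2 : Rd d → ℂ)) Real.HolderConjugate.two_two
    (by simpa using Lp.memLp p.1.2) (by simpa using Lp.memLp q.1.2)
  have hn : ∀ f : Lp ℂ 2 (volume : Measure (Rd d)),
      ‖f‖ = (∫ x, ‖f x‖ ^ (2 : ℝ)) ^ (1 / (2 : ℝ)) := by
    intro f
    rw [Lp.norm_def, (Lp.memLp f).eLpNorm_eq_integral_rpow_norm (by norm_num) (by norm_num),
      ENNReal.toReal_ofReal (by positivity)]
    norm_num
  rw [hn, hn]
  refine (integral_congr_ae ?_).trans_le h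
  filter_upwards [hp, hq] with x h1 h2
  rw [val_density, norm_mul, RCLike.norm_conj, h1, h2]

end Multipliers

section Riesz

variable {d : ℕ}

/-! ### Riesz potentials by Gaussian subordination -/

section Subordination

variable {E : Type*} [NormedAddCommGroup E] {a b A B : ℝ} {g : ℝ → E}

theorem integrableOn_Ioi_of_norm_le_rpow (ha : -1 < a) (hb : b < -1)
    (hg : AEStronglyMeasurable g (volume.restrict (Ioi 0)))
    (hA : ∀ s, 0 < s → ‖g s‖ ≤ A * s ^ a) (hB : ∀ s, 0 < s → ‖g s‖ ≤ B * s ^ b) :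
    IntegrableOn g (Ioi 0) := by
  rw [← Ioc_union_Ioi_eq_Ioi zero_le_one]
  refine IntegrableOn.union ?_ ?_
  · have h1 : IntegrableOn (fun s : ℝ => A * s ^ a) (Ioc 0 1) :=
      ((intervalIntegrable_iff_integrableOn_Ioc_of_le zero_le_one).1
        (intervalIntegral.intervalIntegrable_rpow' ha)).const_mul A
    refine h1.mono' (hg.mono_measure (Measure.restrict_mono Ioc_subset_Ioi_self le_rfl)) ?_
    exact (ae_restrict_iff' measurableSet_Ioc).2 (Eventually.of_forall fun s hs => hA s hs.1)
  · have h1 : IntegrableOn (fun s : ℝ => B * s ^ b) (Ioi 1) :=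
      (integrableOn_Ioi_rpow_of_lt hb one_pos).const_mul B
    refine h1.mono' (hg.mono_measure
      (Measure.restrict_mono (Ioi_subset_Ioi zero_le_one) le_rfl)) ?_
    exact (ae_restrict_iff' measurableSet_Ioi).2
      (Eventually.of_forall fun s hs => hB s (one_pos.trans hs))

/-- A function on the half-line which is dominated by two powers, one integrable at `0` and one
integrable at `∞`: the bound is split at an arbitrary point `σ`. -/
theorem norm_integral_Ioi_le_rpow [NormedSpace ℝ E] (ha : -1 < a) (hb : b < -1)
    (hg : AEStronglyMeasurable g (volume.restrict (Ioi 0)))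
    (hA : ∀ s, 0 < s → ‖g s‖ ≤ A * s ^ a) (hB : ∀ s, 0 < s → ‖g s‖ ≤ B * s ^ b)
    {σ : ℝ} (hσ : 0 < σ) :
    ‖∫ s in Ioi 0, g s‖ ≤ A * (σ ^ (a + 1) / (a + 1)) + B * (-σ ^ (b + 1) / (b + 1)) := by
  have hi := integrableOn_Ioi_of_norm_le_rpow ha hb hg hA hB
  have hi1 : IntegrableOn g (Ioc 0 σ) := hi.mono_set Ioc_subset_Ioi_self
  have hi2 : IntegrableOn g (Ioi σ) := hi.mono_set (Ioi_subset_Ioi hσ.le)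
  rw [← Ioc_union_Ioi_eq_Ioi hσ.le, setIntegral_union (Ioc_disjoint_Ioi le_rfl)
    measurableSet_Ioi hi1 hi2]
  refine (norm_add_le _ _).trans (add_le_add ?_ ?_)
  · have h1 : IntegrableOn (fun s : ℝ => A * s ^ a) (Ioc 0 σ) :=
      ((intervalIntegrable_iff_integrableOn_Ioc_of_le hσ.le).1
        (intervalIntegral.intervalIntegrable_rpow' ha)).const_mul A
    refine (norm_integral_le_of_norm_le h1 ((ae_restrict_iff' measurableSet_Ioc).2
      (Eventually.of_forall fun s hs => hA s hs.1))).trans_eq ?_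
    rw [← intervalIntegral.integral_of_le hσ.le, intervalIntegral.integral_const_mul,
      integral_rpow (Or.inl ha), Real.zero_rpow (by linarith), sub_zero]
  · have h1 : IntegrableOn (fun s : ℝ => B * s ^ b) (Ioi σ) :=
      (integrableOn_Ioi_rpow_of_lt hb hσ).const_mul B
    refine (norm_integral_le_of_norm_le h1 ((ae_restrict_iff' measurableSet_Ioi).2
      (Eventually.of_forall fun s hs => hB s (hσ.trans hs)))).trans_eq ?_
    rw [integral_const_mul, integral_Ioi_rpow_of_lt hb hσ]

end Subordination

/-- The symbol `e^{-π|ξ|²/s}`, for `s > 0`. The absolute value makes it a bounded function for all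
`s`. -/
def gaussSymbol (s : ℝ) : Rd d →ᵇ ℂ :=
  BoundedContinuousFunction.ofNormedAddCommGroup
    (fun ξ : Rd d => ((Real.exp (-(Real.pi * |s|⁻¹) * ‖ξ‖ ^ 2) : ℝ) : ℂ))
    (by fun_prop) 1 (fun ξ => by
      rw [Complex.norm_real, Real.norm_eq_abs, Real.abs_exp, Real.exp_le_one_iff, neg_mul]
      exact neg_nonpos.2 (by positivity))

theorem gaussSymbol_apply (s : ℝ) (ξ : Rd d) :
    gaussSymbol s ξ = ((Real.exp (-(Real.pi * |s|⁻¹) * ‖ξ‖ ^ 2) : ℝ) : ℂ) := rfl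

theorem norm_gaussSymbol_le (s : ℝ) : ‖(gaussSymbol s : Rd d →ᵇ ℂ)‖ ≤ 1 :=
  BoundedContinuousFunction.norm_ofNormedAddCommGroup_le _ zero_le_one _

theorem integrable_gaussian {b : ℝ} (hb : 0 < b) :
    Integrable fun x : Rd d => Real.exp (-b * ‖x‖ ^ 2) := by
  have h := GaussianFourier.integrable_cexp_neg_mul_sq_norm_add (V := Rd d) (b := b)
    (by simpa using hb) 0 0
  refine h.norm.congr (Eventually.of_forall fun x => ?_)
  simp only [zero_mul, add_zero]
  rw [Complex.norm_exp]
  congr 1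
  rw [← Complex.ofReal_pow, ← Complex.ofReal_neg, ← Complex.ofReal_mul, Complex.ofReal_re]

theorem integral_gaussian {b : ℝ} (hb : 0 < b) :
    ∫ x : Rd d, Real.exp (-b * ‖x‖ ^ 2) = (Real.pi / b) ^ ((d : ℝ) / 2) := by
  rw [GaussianFourier.integral_rexp_neg_mul_sq_norm hb, finrank_euclideanSpace_fin]

theorem fourier_gaussian {b : ℝ} (hb : 0 < b) (ξ : Rd d) :
    𝓕 (fun x : Rd d => ((Real.exp (-b * ‖x‖ ^ 2) : ℝ) : ℂ)) ξ =
      (((Real.pi / b) ^ ((d : ℝ) / 2) * Real.exp (-(Real.pi ^ 2 / b) * ‖ξ‖ ^ 2) : ℝ) : ℂ) := by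
  have h := fourier_gaussian_innerProductSpace (V := Rd d) (b := (b : ℂ)) (by simpa using hb) ξ
  rw [finrank_euclideanSpace_fin] at h
  have hf : (fun x : Rd d => ((Real.exp (-b * ‖x‖ ^ 2) : ℝ) : ℂ))
      = fun x => Complex.exp (-b * ‖x‖ ^ 2) := by
    funext x; push_cast; rfl
  rw [hf, h, Complex.ofReal_mul, Complex.ofReal_cpow (by positivity)]
  push_cast
  congr 2
  ring

/-- A Fourier multiplier with a Gaussian symbol is the convolution with a Gaussian. -/
theorem val_wienerMultiplier_gaussSymbol (f : Wiener d) {s : ℝ} (hs : 0 < s) (x : Rd d) :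
    (wienerMultiplier (gaussSymbol s) f).val x =
      ((s ^ ((d : ℝ) / 2) : ℝ) : ℂ) *
        ∫ y, ((Real.exp (-(Real.pi * s) * ‖y‖ ^ 2) : ℝ) : ℂ) * f.val (x - y) := by
  have hL : Continuous fun p : Rd d × Rd d => (innerₗ (Rd d)) p.1 p.2 := by
    simp only [innerₗ_apply_apply]
    fun_prop
  have hb : 0 < Real.pi * s := by positivity
  have h2 := VectorFourier.integral_fourierIntegral_smul_eq_flip (μ := (volume : Measure (Rd d)))
    (ν := (volume : Measure (Rd d)))
    (f := fun y : Rd d => ((Real.exp (-(Real.pi * s) * ‖y‖ ^ 2) : ℝ) : ℂ))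
    (g := fun ξ : Rd d => Real.fourierChar (inner ℝ ξ x) • f.hat ξ)
    Real.continuous_fourierChar hL (integrable_gaussian hb).ofReal (f.integrable_char_smul x)
  rw [flip_innerₗ] at h2
  have h3 : ∀ y, VectorFourier.fourierIntegral Real.fourierChar volume (innerₗ (Rd d))
      (fun ξ : Rd d => Real.fourierChar (inner ℝ ξ x) • f.hat ξ) y = f.val (x - y) := by
    intro y
    rw [Wiener.val, Real.fourierInv_eq, VectorFourier.fourierIntegral]
    refine integral_congr_ae (Eventually.of_forall fun ξ => ?_)
    simp only [innerₗ_apply_apply, Circle.smul_def, smul_smul]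
    rw [← Circle.coe_mul, ← AddChar.map_add_eq_mul, inner_sub_right]
    congr 3
    ring
  have h4 : ∀ ξ, VectorFourier.fourierIntegral Real.fourierChar volume (innerₗ (Rd d))
      (fun y : Rd d => ((Real.exp (-(Real.pi * s) * ‖y‖ ^ 2) : ℝ) : ℂ)) ξ
      = ((s ^ (-((d : ℝ) / 2)) : ℝ) : ℂ) * gaussSymbol s ξ := by
    intro ξ
    have := fourier_gaussian (d := d) hb ξ
    rw [Real.fourier_eq] at this
    rw [VectorFourier.fourierIntegral]
    simp only [innerₗ_apply_apply]
    rw [this, gaussSymbol_apply, ← Complex.ofReal_mul, abs_of_pos hs]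
    congr 2
    · rw [Real.rpow_neg hs.le, ← Real.inv_rpow hs.le]
      congr 1
      field_simp
    · congr 2
      field_simp
  simp only [h3, h4, smul_eq_mul] at h2
  rw [← h2, Wiener.val, Real.fourierInv_eq, ← integral_const_mul]
  refine integral_congr_ae ?_
  rw [hat_wienerMultiplier]
  filter_upwards [coeFn_bddMul (gaussSymbol s) f.hat] with ξ hξ
  rw [hξ, Circle.smul_def, Circle.smul_def, smul_eq_mul, smul_eq_mul]
  have : ((s ^ ((d : ℝ) / 2) : ℝ) : ℂ) * ((s ^ (-((d : ℝ) / 2)) : ℝ) : ℂ) = 1 := by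
    rw [← Complex.ofReal_mul, ← Real.rpow_add hs, add_neg_cancel, Real.rpow_zero,
      Complex.ofReal_one]
  linear_combination (-((Real.fourierChar (inner ℝ ξ x) : Circle) : ℂ) * gaussSymbol s ξ * f.hat ξ)
    * this

theorem norm_wienerMultiplier_gaussSymbol_le (f : Wiener d) (hf : Integrable f.val)
    {s : ℝ} (hs : 0 < s) :
    ‖wienerMultiplier (gaussSymbol s) f‖ ≤ s ^ ((d : ℝ) / 2) * ∫ x, ‖f.val x‖ := by
  have hb : 0 < Real.pi * s⁻¹ := by positivity
  rw [wiener_norm_eq_integral, hat_wienerMultiplier]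
  have h1 : ∀ᵐ ξ, ‖bddMul 1 volume (gaussSymbol s) f.hat ξ‖
      ≤ Real.exp (-(Real.pi * s⁻¹) * ‖ξ‖ ^ 2) * ∫ x, ‖f.val x‖ := by
    filter_upwards [coeFn_bddMul (gaussSymbol s) f.hat, norm_hat_le_integral_norm_val f hf]
      with ξ h1 h2
    rw [h1, norm_mul, gaussSymbol_apply, Complex.norm_real, Real.norm_eq_abs, Real.abs_exp,
      abs_of_pos hs]
    gcongr
  refine (integral_mono_ae (L1.integrable_coeFn _).norm
    ((integrable_gaussian hb).mul_const _) h1).trans_eq ?_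
  rw [integral_mul_const, integral_gaussian hb]
  congr 2
  field_simp

/-- The integrand in the subordination formula for the Riesz potential. -/
def rieszIntegrand (γ : ℝ) (f : Wiener d) (s : ℝ) : Wiener d :=
  (s ^ (γ / 2 - 1 - (d : ℝ) / 2)) • wienerMultiplier (gaussSymbol s) f

theorem norm_rieszIntegrand_le (γ : ℝ) (f : Wiener d) {s : ℝ} (hs : 0 < s) :
    ‖rieszIntegrand γ f s‖ ≤ ‖f‖ * s ^ (γ / 2 - 1 - (d : ℝ) / 2) := by
  rw [rieszIntegrand, norm_smul, Real.norm_of_nonneg (by positivity), mul_comm]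
  gcongr
  exact (norm_wienerMultiplier_le _ _).trans
    (mul_le_of_le_one_left (norm_nonneg _) (norm_gaussSymbol_le s))

theorem norm_rieszIntegrand_le' (γ : ℝ) (f : Wiener d) (hf : Integrable f.val)
    {s : ℝ} (hs : 0 < s) :
    ‖rieszIntegrand γ f s‖ ≤ (∫ x, ‖f.val x‖) * s ^ (γ / 2 - 1) := by
  rw [rieszIntegrand, norm_smul, Real.norm_of_nonneg (by positivity)]
  refine (mul_le_mul_of_nonneg_left (norm_wienerMultiplier_gaussSymbol_le f hf hs)
    (by positivity)).trans_eq ?_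
  rw [← mul_assoc, ← Real.rpow_add hs, sub_add_cancel, mul_comm]

theorem continuousOn_rieszIntegrand (γ : ℝ) (f : Wiener d) :
    ContinuousOn (rieszIntegrand γ f) (Ioi 0) := by
  intro s hs
  have hs' : (0 : ℝ) < s := hs
  have h1 : ContinuousAt (fun s : ℝ => s ^ (γ / 2 - 1 - (d : ℝ) / 2)) s :=
    Real.continuousAt_rpow_const _ _ (Or.inl hs'.ne')
  have h2 : ContinuousAt (fun s => wienerMultiplier (gaussSymbol s) f) s := by
    refine tendsto_wienerMultiplier (C := 1)
      (Eventually.of_forall fun s => norm_gaussSymbol_le s) (fun ξ => ?_) f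
    simp only [gaussSymbol_apply]
    have : ContinuousAt (fun s : ℝ => |s|⁻¹) s :=
      continuous_abs.continuousAt.inv₀ (abs_pos.2 hs'.ne').ne'
    refine ContinuousAt.tendsto (f := fun i : ℝ =>
      ((Real.exp (-(Real.pi * |i|⁻¹) * ‖ξ‖ ^ 2) : ℝ) : ℂ)) ?_
    fun_prop
  exact (h1.smul h2).continuousWithinAt

theorem aestronglyMeasurable_rieszIntegrand (γ : ℝ) (f : Wiener d) :
    AEStronglyMeasurable (rieszIntegrand γ f) (volume.restrict (Ioi 0)) :=
  (continuousOn_rieszIntegrand γ f).aestronglyMeasurable measurableSet_Ioi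

/-- The constant in `|y|^{-γ} = c_γ ∫₀^∞ s^{γ/2-1} e^{-πs|y|²} ds`. -/
def rieszConst (γ : ℝ) : ℝ := Real.pi ^ (γ / 2) / Real.Gamma (γ / 2)

theorem rieszConst_nonneg {γ : ℝ} (hγ : 0 < γ) : 0 ≤ rieszConst γ :=
  div_nonneg (by positivity) (Real.Gamma_pos_of_pos (by positivity)).le

/-- The element `|x|^{-γ} ∗ f` of the Wiener algebra, for `f ∈ W` integrable. It is the
superposition of convolutions of `f` with Gaussians. -/
def rieszPotential (γ : ℝ) (f : Wiener d) : Wiener d :=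
  rieszConst γ • ∫ s in Ioi 0, rieszIntegrand γ f s

variable {γ : ℝ}

theorem integrableOn_rieszIntegrand (hγ : 0 < γ) (hγd : γ < d) (f : Wiener d)
    (hf : Integrable f.val) : IntegrableOn (rieszIntegrand γ f) (Ioi 0) :=
  integrableOn_Ioi_of_norm_le_rpow (by linarith) (by linarith)
    (aestronglyMeasurable_rieszIntegrand γ f) (fun _ hs => norm_rieszIntegrand_le' γ f hf hs)
    (fun _ hs => norm_rieszIntegrand_le γ f hs)

/-- A constant for the bound of Riesz potentials. -/
def rieszBound (d : ℕ) (γ : ℝ) : ℝ := rieszConst γ * (2 / γ + 2 / (d - γ))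

theorem rieszBound_nonneg (hγ : 0 < γ) (hγd : γ < d) : 0 ≤ rieszBound d γ :=
  mul_nonneg (rieszConst_nonneg hγ)
    (add_nonneg (by positivity) (div_nonneg zero_le_two (by linarith)))

/-- The bound of a Riesz potential in `W`, split at the frequency `e^{-τ}`. -/
theorem norm_rieszPotential_le (hγ : 0 < γ) (hγd : γ < d) (f : Wiener d)
    (hf : Integrable f.val) (τ : ℝ) :
    ‖rieszPotential γ f‖ ≤ rieszBound d γ *
      (Real.exp (-γ * τ) * (∫ x, ‖f.val x‖) + Real.exp ((d - γ) * τ) * ‖f‖) := by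
  have h := norm_integral_Ioi_le_rpow (a := γ / 2 - 1) (b := γ / 2 - 1 - (d : ℝ) / 2)
    (by linarith) (by linarith) (aestronglyMeasurable_rieszIntegrand γ f)
    (fun _ hs => norm_rieszIntegrand_le' γ f hf hs)
    (fun _ hs => norm_rieszIntegrand_le γ f hs) (Real.exp_pos (-(2 * τ)))
  rw [← Real.exp_mul, ← Real.exp_mul] at h
  have e1 : -(2 * τ) * (γ / 2 - 1 + 1) = -γ * τ := by ring
  have e2 : -(2 * τ) * (γ / 2 - 1 - (d : ℝ) / 2 + 1) = (d - γ) * τ := by ring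
  rw [e1, e2] at h
  rw [rieszPotential, norm_smul, Real.norm_of_nonneg (rieszConst_nonneg hγ), rieszBound, mul_assoc]
  refine mul_le_mul_of_nonneg_left (h.trans ?_) (rieszConst_nonneg hγ)
  have hI : 0 ≤ ∫ x, ‖f.val x‖ := integral_nonneg fun _ => norm_nonneg _
  have hdγ : 0 < d - γ := by linarith
  have e3 : Real.exp (-γ * τ) / (γ / 2 - 1 + 1) = 2 / γ * Real.exp (-γ * τ) := by
    rw [sub_add_cancel]; field_simp
  have e4 : -Real.exp ((d - γ) * τ) / (γ / 2 - 1 - (d : ℝ) / 2 + 1)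
      = 2 / (d - γ) * Real.exp ((d - γ) * τ) := by
    have : γ / 2 - 1 - (d : ℝ) / 2 + 1 = -((d - γ) / 2) := by ring
    rw [this]; field_simp
  rw [e3, e4]
  have p1 : 0 ≤ 2 / (d - γ) * (Real.exp (-γ * τ) * ∫ x, ‖f.val x‖) := by positivity
  have p2 : 0 ≤ 2 / γ * (Real.exp ((d - γ) * τ) * ‖f‖) := by positivity
  linarith

theorem rieszPotential_add (hγ : 0 < γ) (hγd : γ < d) {f g : Wiener d}
    (hf : Integrable f.val) (hg : Integrable g.val) :
    rieszPotential γ (f + g) = rieszPotential γ f + rieszPotential γ g := by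
  rw [rieszPotential, rieszPotential, rieszPotential, ← smul_add,
    ← integral_add (integrableOn_rieszIntegrand hγ hγd f hf)
      (integrableOn_rieszIntegrand hγ hγd g hg)]
  simp only [rieszIntegrand, map_add, smul_add]

theorem norm_rpow_neg_eq_integral (hγ : 0 < γ) {y : Rd d} (hy : y ≠ 0) :
    1 / ‖y‖ ^ γ = rieszConst γ *
      ∫ s in Ioi (0 : ℝ), s ^ (γ / 2 - 1) * Real.exp (-(Real.pi * s) * ‖y‖ ^ 2) := by
  have hy' : 0 < ‖y‖ := norm_pos_iff.2 hy
  have h := Real.integral_rpow_mul_exp_neg_mul_Ioi (a := γ / 2) (r := Real.pi * ‖y‖ ^ 2)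
    (by positivity) (by positivity)
  have e : ∀ s : ℝ, -(Real.pi * s) * ‖y‖ ^ 2 = -(Real.pi * ‖y‖ ^ 2 * s) := fun s => by ring
  simp only [e]
  rw [h, rieszConst, one_div (Real.pi * ‖y‖ ^ 2), Real.inv_rpow (by positivity),
    Real.mul_rpow (by positivity) (by positivity), ← Real.rpow_natCast ‖y‖ 2, ← Real.rpow_mul
    hy'.le]
  have hG := (Real.Gamma_pos_of_pos (by positivity : 0 < γ / 2)).ne'
  have e2 : ((2 : ℕ) : ℝ) * (γ / 2) = γ := by push_cast; ring
  rw [e2]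
  have : Real.pi ^ (γ / 2) ≠ 0 := by positivity
  field_simp

theorem integral_norm_gaussian_mul_le (f : Wiener d) (hf : Integrable f.val) {s : ℝ} (hs : 0 < s)
    (x : Rd d) :
    ∫ y, Real.exp (-(Real.pi * s) * ‖y‖ ^ 2) * ‖f.val (x - y)‖ ≤ ∫ y, ‖f.val y‖ := by
  rw [← integral_sub_left_eq_self (fun y => ‖f.val y‖) volume x]
  have hi := (hf.comp_sub_left x).norm
  refine integral_mono_of_nonneg (Eventually.of_forall fun y => by positivity) hi
    (Eventually.of_forall fun y => ?_)
  refine mul_le_of_le_one_left (norm_nonneg _) ?_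
  rw [Real.exp_le_one_iff, neg_mul]
  exact neg_nonpos.2 (by positivity)

theorem integral_norm_gaussian_mul_le' (f : Wiener d) {s : ℝ} (hs : 0 < s) (x : Rd d) :
    ∫ y, Real.exp (-(Real.pi * s) * ‖y‖ ^ 2) * ‖f.val (x - y)‖ ≤
      ‖f‖ * s ^ (-((d : ℝ) / 2)) := by
  have hb : 0 < Real.pi * s := by positivity
  refine (integral_mono_of_nonneg (Eventually.of_forall fun y => by positivity)
    ((integrable_gaussian hb).mul_const ‖f‖)
    (Eventually.of_forall fun y => mul_le_mul_of_nonneg_left (norm_val_le f _)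
      (Real.exp_pos _).le)).trans_eq ?_
  rw [integral_mul_const, integral_gaussian hb, mul_comm, Real.rpow_neg hs.le,
    ← Real.inv_rpow hs.le]
  congr 2
  field_simp

/-- Absolute convergence of the double integral in `s` and `y`. -/
theorem integrable_subordination (hγ : 0 < γ) (hγd : γ < d) (f : Wiener d)
    (hf : Integrable f.val) (x : Rd d) :
    Integrable (fun z : ℝ × Rd d => ((z.1 ^ (γ / 2 - 1) : ℝ) : ℂ) *
      (((Real.exp (-(Real.pi * z.1) * ‖z.2‖ ^ 2) : ℝ) : ℂ) * f.val (x - z.2)))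
      ((volume.restrict (Ioi 0)).prod volume) := by
  have hm : AEStronglyMeasurable (fun z : ℝ × Rd d => ((z.1 ^ (γ / 2 - 1) : ℝ) : ℂ) *
      (((Real.exp (-(Real.pi * z.1) * ‖z.2‖ ^ 2) : ℝ) : ℂ) * f.val (x - z.2)))
      ((volume.restrict (Ioi 0)).prod volume) := by
    refine AEStronglyMeasurable.mul ?_ ?_
    · exact (Complex.measurable_ofReal.comp
        (measurable_fst.pow_const _)).aestronglyMeasurable
    · have := continuous_val f
      exact Continuous.aestronglyMeasurable (by fun_prop)
  have hbound : ∀ (s : ℝ) (_ : 0 < s),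
      Integrable (fun y => ((Real.exp (-(Real.pi * s) * ‖y‖ ^ 2) : ℝ) : ℂ) * f.val (x - y)) := by
    intro s hs
    refine (hf.comp_sub_left x).mono ?_ (Eventually.of_forall fun y => ?_)
    · have := continuous_val f
      exact Continuous.aestronglyMeasurable (by fun_prop)
    · rw [norm_mul, Complex.norm_real, Real.norm_eq_abs, Real.abs_exp]
      refine mul_le_of_le_one_left (norm_nonneg _) ?_
      rw [Real.exp_le_one_iff, neg_mul]
      exact neg_nonpos.2 (by positivity)
  rw [integrable_prod_iff hm]
  refine ⟨(ae_restrict_iff' measurableSet_Ioi).2 (Eventually.of_forall fun s hs =>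
    (hbound s hs).const_mul ((s ^ (γ / 2 - 1) : ℝ) : ℂ)), ?_⟩
  have hn : ∀ s : ℝ, 0 < s → ‖∫ y, ‖((s ^ (γ / 2 - 1) : ℝ) : ℂ) *
      (((Real.exp (-(Real.pi * s) * ‖y‖ ^ 2) : ℝ) : ℂ) * f.val (x - y))‖‖ =
      s ^ (γ / 2 - 1) * ∫ y, Real.exp (-(Real.pi * s) * ‖y‖ ^ 2) * ‖f.val (x - y)‖ := by
    intro s hs
    rw [Real.norm_of_nonneg (integral_nonneg fun _ => norm_nonneg _), ← integral_const_mul]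
    refine integral_congr_ae (Eventually.of_forall fun y => ?_)
    simp only [norm_mul, Complex.norm_real, Real.norm_eq_abs, Real.abs_exp]
    rw [abs_of_nonneg (by positivity)]
  refine integrableOn_Ioi_of_norm_le_rpow (a := γ / 2 - 1) (b := γ / 2 - 1 - (d : ℝ) / 2)
    (A := ∫ y, ‖f.val y‖) (B := ‖f‖)
    (by linarith) (by linarith) hm.norm.integral_prod_right' (fun s hs => ?_) (fun s hs => ?_)
  · rw [hn s hs, mul_comm]
    exact mul_le_mul_of_nonneg_right (integral_norm_gaussian_mul_le f hf hs x) (by positivity)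
  · rw [hn s hs]
    refine (mul_le_mul_of_nonneg_left (integral_norm_gaussian_mul_le' f hs x)
      (by positivity)).trans_eq ?_
    rw [sub_eq_add_neg _ ((d : ℝ) / 2), Real.rpow_add hs]
    ring

theorem val_rieszPotential (hγ : 0 < γ) (hγd : γ < d) (f : Wiener d)
    (hf : Integrable f.val) (x : Rd d) :
    Integrable (fun y => ((1 / ‖y‖ ^ γ : ℝ) : ℂ) * f.val (x - y)) ∧
      (rieszPotential γ f).val x = ∫ y, ((1 / ‖y‖ ^ γ : ℝ) : ℂ) * f.val (x - y) := by
  have hd : 0 < d := by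
    rcases Nat.eq_zero_or_pos d with h | h
    · subst h; norm_num at hγd; linarith
    · exact h
  have : Nonempty (Fin d) := ⟨⟨0, hd⟩⟩
  have hsub := integrable_subordination hγ hγd f hf x
  have hae : (fun y : Rd d => (rieszConst γ : ℂ) * ∫ s in Ioi (0 : ℝ),
      ((s ^ (γ / 2 - 1) : ℝ) : ℂ) *
      (((Real.exp (-(Real.pi * s) * ‖y‖ ^ 2) : ℝ) : ℂ) * f.val (x - y)))
      =ᵐ[volume] fun y => ((1 / ‖y‖ ^ γ : ℝ) : ℂ) * f.val (x - y) := by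
    filter_upwards [compl_mem_ae_iff.2 (measure_singleton (0 : Rd d))] with y hy
    rw [norm_rpow_neg_eq_integral hγ hy, Complex.ofReal_mul, ← integral_complex_ofReal]
    simp only [← mul_assoc]
    rw [integral_mul_const, ← mul_assoc]
    simp only [Complex.ofReal_mul]
  refine ⟨(hsub.integral_prod_right.const_mul _).congr hae, ?_⟩
  rw [← integral_congr_ae hae, integral_const_mul, ← integral_integral_swap hsub]
  have h1 : (rieszPotential γ f).val x = (rieszConst γ : ℂ) *
      (∫ s in Ioi 0, rieszIntegrand γ f s).val x := by
    have : rieszPotential γ f = (rieszConst γ : ℂ) • ∫ s in Ioi 0, rieszIntegrand γ f s := rfl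
    rw [this, Wiener.val_smul]; rfl
  have h2 := ((BoundedContinuousFunction.evalCLM ℂ x).comp valBCF).integral_comp_comm
    (integrableOn_rieszIntegrand hγ hγd f hf)
  rw [h1]
  change _ * ((BoundedContinuousFunction.evalCLM ℂ x).comp valBCF) _ = _
  rw [← h2]
  congr 1
  refine setIntegral_congr_fun measurableSet_Ioi fun s hs => ?_
  have hs' : (0 : ℝ) < s := hs
  rw [integral_const_mul]
  have h3 : rieszIntegrand γ f s = ((s ^ (γ / 2 - 1 - (d : ℝ) / 2) : ℝ) : ℂ) •
    wienerMultiplier (gaussSymbol s) f := rfl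
  change (rieszIntegrand γ f s).val x = _
  rw [h3, Wiener.val_smul, Pi.smul_apply, smul_eq_mul, val_wienerMultiplier_gaussSymbol f hs',
    ← mul_assoc, ← Complex.ofReal_mul, ← Real.rpow_add hs', sub_add_cancel]

/-! ### The trilinear Hartree term -/

variable (d) in
/-- The potential `K ∗ (p conj(q))`, for the Hartree kernel `K`. -/
def hartreePotential (lam γ : ℝ) (p q : L2W d) : Wiener d :=
  lam • rieszPotential γ (density p q)

/-- The basic estimate: on the potential generated by `p` and `q`, a loss in the norms of `L²` is
made up for by a gain in the norms of `W`. -/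
theorem norm_hartreePotential_le (hγ : 0 < γ) (hγd : γ < d) (lam : ℝ) (p q : L2W d) (τ : ℝ) :
    ‖hartreePotential d lam γ p q‖ ≤ |lam| * rieszBound d γ *
      (Real.exp (-γ * τ) * (‖p.1.2‖ * ‖q.1.2‖)
        + Real.exp ((d - γ) * τ) * (‖p.1.1‖ * ‖q.1.1‖)) := by
  rw [hartreePotential, norm_smul, Real.norm_eq_abs, mul_assoc]
  refine mul_le_mul_of_nonneg_left ((norm_rieszPotential_le hγ hγd _
    (integrable_density p q) τ).trans ?_) (abs_nonneg _)
  refine mul_le_mul_of_nonneg_left ?_ (rieszBound_nonneg hγ hγd)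
  gcongr
  · exact integral_norm_density_le p q
  · exact norm_density_le p q

theorem hartreePotential_add_left (hγ : 0 < γ) (hγd : γ < d) (lam : ℝ) (p p' q : L2W d) :
    hartreePotential d lam γ (p + p') q =
      hartreePotential d lam γ p q + hartreePotential d lam γ p' q := by
  have h : density (p + p') q = density p q + density p' q := by
    simp only [density, Submodule.coe_add, Prod.fst_add, map_add, add_apply]
  rw [hartreePotential, h, rieszPotential_add hγ hγd (integrable_density _ _)
    (integrable_density _ _), smul_add]; rfl

theorem hartreePotential_add_right (hγ : 0 < γ) (hγd : γ < d) (lam : ℝ) (p q q' : L2W d) :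
    hartreePotential d lam γ p (q + q') =
      hartreePotential d lam γ p q + hartreePotential d lam γ p q' := by
  have h : density p (q + q') = density p q + density p q' := by
    simp only [density, Submodule.coe_add, Prod.fst_add, map_add]
  rw [hartreePotential, h, rieszPotential_add hγ hγd (integrable_density _ _)
    (integrable_density _ _), smul_add]; rfl

theorem hartreePotential_self (hγ : 0 < γ) (hγd : γ < d) (lam : ℝ) (p : L2W d) :
    ConvolutionExists (kernel d lam γ) (fun y => ‖p.1.1.val y‖ ^ 2)
      (ContinuousLinearMap.mul ℝ ℝ) volume ∧
    ∀ x, (hartreePotential d lam γ p p).val x =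
      (potential (kernel d lam γ) p.1.1 x : ℂ) := by
  have hv : ∀ y, (density p p).val y = ((‖p.1.1.val y‖ ^ 2 : ℝ) : ℂ) := fun y => by
    rw [val_density, Complex.mul_conj, Complex.normSq_eq_norm_sq]
  have hk : ∀ y : Rd d, kernel d lam γ y = lam * (1 / ‖y‖ ^ γ) := fun y => by
    rw [kernel]; ring
  constructor
  · intro x
    have h := (val_rieszPotential hγ hγd _ (integrable_density p p) x).1.re
    refine (h.const_mul lam).congr (Eventually.of_forall fun y => ?_)
    simp only [hv, ← Complex.ofReal_mul, RCLike.re_eq_complex_re, Complex.ofReal_re,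
      ContinuousLinearMap.mul_apply', hk]
    ring
  · intro x
    have h := (val_rieszPotential hγ hγd _ (integrable_density p p) x).2
    have h1 : hartreePotential d lam γ p p = (lam : ℂ) • rieszPotential γ (density p p) := rfl
    rw [h1, Wiener.val_smul, Pi.smul_apply, h, potential, convolution_def,
      ← integral_complex_ofReal, smul_eq_mul, ← integral_const_mul]
    refine integral_congr_ae (Eventually.of_forall fun y => ?_)
    simp only [hv, hk, ContinuousLinearMap.mul_apply']
    push_cast
    ring

theorem isNonlinearity_wienerAct (hγ : 0 < γ) (hγd : γ < d) (lam : ℝ) (p : L2W d) :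
    IsNonlinearity (kernel d lam γ) (L2W.toWiener d p)
      (L2W.toWiener d (wienerAct (hartreePotential d lam γ p p) p)) := by
  obtain ⟨h1, h2⟩ := hartreePotential_self hγ hγd lam p
  rw [toWiener_wienerAct]
  refine ⟨h1, fun x => ?_⟩
  rw [val_wienerMul, Pi.mul_apply, h2]
  rfl

theorem IsNonlinearity.unique {K : Rd d → ℝ} {f F G : Wiener d} (hF : IsNonlinearity K f F)
    (hG : IsNonlinearity K f G) : F = G :=
  val_injective (funext fun x => (hF.2 x).trans (hG.2 x).symm)

end Riesz

/-! ### Cubic evolution equations in the interaction picture -/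

/-- The Picard–Lindelöf theorem, with the information that the solution stays in the ball in which
the hypotheses hold. -/
theorem _root_.IsPicardLindelof.exists_hasDerivWithinAt_mem_closedBall {E : Type*}
    [NormedAddCommGroup E] [NormedSpace ℝ E] [CompleteSpace E] {f : ℝ → E → E} {tmin tmax : ℝ}
    {t₀ : Icc tmin tmax} {x₀ x : E} {a r L K : NNReal}
    (hf : IsPicardLindelof f t₀ x₀ a r L K) (hx : x ∈ Metric.closedBall x₀ r) :
    ∃ α : ℝ → E, α t₀ = x ∧
      (∀ t ∈ Icc tmin tmax, HasDerivWithinAt α (f t (α t)) (Icc tmin tmax) t) ∧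
      ∀ t, α t ∈ Metric.closedBall x₀ a := by
  obtain ⟨α, hα⟩ := ODE.FunSpace.exists_isFixedPt_next hf hx
  refine ⟨α.compProj, by rw [ODE.FunSpace.compProj_val, ← hα, ODE.FunSpace.next_apply₀],
    fun t ht => ?_, fun t => α.compProj_mem_closedBall hf.mul_max_le⟩
  refine (ODE.hasDerivWithinAt_picard_Icc t₀.2 hf.continuousOn_uncurry
    α.continuous_compProj.continuousOn
    (fun _ _ => α.compProj_mem_closedBall hf.mul_max_le) x ht).congr_of_mem (fun t' ht' => ?_) ht
  nth_rw 1 [← hα]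
  rw [ODE.FunSpace.compProj_of_mem ht', ODE.FunSpace.next_apply]

section Evolution

variable {E : Type*} [NormedAddCommGroup E] [NormedSpace ℂ E]

/-- The data of a semilinear equation `i ∂ₜu + Δu = N(u)` in a Banach space: a strongly continuous
group of contractions `T(t)`, which stands for `e^{itΔ}`, and a nonlinearity `N` which satisfies
cubic Lipschitz estimates with the constant `M`. -/
structure CubicEvolution (E : Type*) [NormedAddCommGroup E] [NormedSpace ℂ E] where
  /-- the linear group -/
  T : ℝ → E →L[ℂ] E
  /-- the nonlinearity -/
  N : E → E
  /-- the constant in the cubic estimates -/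
  M : ℝ
  M_nonneg : 0 ≤ M
  norm_T_le : ∀ t x, ‖T t x‖ ≤ ‖x‖
  T_zero : ∀ x, T 0 x = x
  T_add : ∀ s t x, T (s + t) x = T s (T t x)
  continuous_T : ∀ x, Continuous fun t => T t x
  N_zero : N 0 = 0
  norm_N_sub_le : ∀ x y, ‖N x - N y‖ ≤ M * (‖x‖ ^ 2 + ‖x‖ * ‖y‖ + ‖y‖ ^ 2) * ‖x - y‖

namespace CubicEvolution

variable (e : CubicEvolution E)

theorem norm_N_le (x : E) : ‖e.N x‖ ≤ e.M * ‖x‖ ^ 3 := by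
  have h := e.norm_N_sub_le x 0
  rw [e.N_zero, sub_zero, sub_zero, norm_zero] at h
  refine h.trans_eq ?_
  ring

theorem norm_N_sub_le_of_le {R : ℝ} {x y : E} (hx : ‖x‖ ≤ R) (hy : ‖y‖ ≤ R) :
    ‖e.N x - e.N y‖ ≤ 3 * e.M * R ^ 2 * ‖x - y‖ := by
  refine (e.norm_N_sub_le x y).trans (mul_le_mul_of_nonneg_right ?_ (norm_nonneg _))
  have hR : 0 ≤ R := (norm_nonneg _).trans hx
  have h : ‖x‖ ^ 2 + ‖x‖ * ‖y‖ + ‖y‖ ^ 2 ≤ 3 * R ^ 2 := by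
    have h1 : ‖x‖ ^ 2 ≤ R ^ 2 := by gcongr
    have h2 : ‖y‖ ^ 2 ≤ R ^ 2 := by gcongr
    have h3 : ‖x‖ * ‖y‖ ≤ R * R := by gcongr
    nlinarith
  exact (mul_le_mul_of_nonneg_left h e.M_nonneg).trans_eq (by ring)

theorem continuous_N : Continuous e.N := by
  refine continuous_iff_continuousAt.2 fun x => ?_
  rw [ContinuousAt, tendsto_iff_norm_sub_tendsto_zero]
  have h : Continuous fun y => e.M * (‖y‖ ^ 2 + ‖y‖ * ‖x‖ + ‖x‖ ^ 2) * ‖y - x‖ := by fun_prop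
  refine squeeze_zero (fun _ => norm_nonneg _) (fun y => e.norm_N_sub_le y x) ?_
  have := h.tendsto x
  simpa using this

theorem T_neg_T (t : ℝ) (x : E) : e.T (-t) (e.T t x) = x := by
  rw [← e.T_add, neg_add_cancel, e.T_zero]

theorem continuousWithinAt_T {s : Set ℝ} {a : ℝ} {τ : ℝ → ℝ} {g : ℝ → E}
    (hτ : ContinuousWithinAt τ s a) (hg : ContinuousWithinAt g s a) :
    ContinuousWithinAt (fun t => e.T (τ t) (g t)) s a := by
  rw [ContinuousWithinAt, tendsto_iff_norm_sub_tendsto_zero]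
  have h1 : Tendsto (fun t => ‖g t - g a‖ + ‖e.T (τ t) (g a) - e.T (τ a) (g a)‖) (𝓝[s] a)
      (𝓝 0) := by
    have h2 := tendsto_iff_norm_sub_tendsto_zero.1 hg
    have h3 := tendsto_iff_norm_sub_tendsto_zero.1
      (((e.continuous_T (g a)).tendsto (τ a)).comp hτ)
    simpa using h2.add h3
  refine squeeze_zero (fun _ => norm_nonneg _) (fun t => ?_) h1
  have : e.T (τ t) (g t) - e.T (τ a) (g a)
      = e.T (τ t) (g t - g a) + (e.T (τ t) (g a) - e.T (τ a) (g a)) := by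
    rw [map_sub]; abel
  rw [this]
  exact (norm_add_le _ _).trans (add_le_add (e.norm_T_le _ _) le_rfl)

theorem continuousOn_T {s : Set ℝ} {τ : ℝ → ℝ} {g : ℝ → E}
    (hτ : ContinuousOn τ s) (hg : ContinuousOn g s) :
    ContinuousOn (fun t => e.T (τ t) (g t)) s :=
  fun a ha => e.continuousWithinAt_T (hτ a ha) (hg a ha)

/-- The vector field of the interaction picture: `z(t) = T(-t) u(t)` solves `z' = F(t, z)` with
`F(t, z) = -i T(-t) N(T(t) z)`. -/
def field (t : ℝ) (x : E) : E := -Complex.I • e.T (-t) (e.N (e.T t x))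

theorem norm_neg_I_smul (x : E) : ‖-Complex.I • x‖ = ‖x‖ := by
  rw [norm_smul, norm_neg, Complex.norm_I, one_mul]

theorem norm_field_sub_le {R : ℝ} (t : ℝ) {x y : E} (hx : ‖x‖ ≤ R) (hy : ‖y‖ ≤ R) :
    ‖e.field t x - e.field t y‖ ≤ 3 * e.M * R ^ 2 * ‖x - y‖ := by
  rw [field, field, ← smul_sub, norm_neg_I_smul, ← map_sub]
  refine (e.norm_T_le _ _).trans ((e.norm_N_sub_le_of_le ((e.norm_T_le t x).trans hx)
    ((e.norm_T_le t y).trans hy)).trans ?_)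
  rw [← map_sub]
  exact mul_le_mul_of_nonneg_left (e.norm_T_le _ _)
    (mul_nonneg (mul_nonneg (by norm_num) e.M_nonneg) (sq_nonneg R))

theorem norm_field_le {R : ℝ} (t : ℝ) {x : E} (hx : ‖x‖ ≤ R) :
    ‖e.field t x‖ ≤ e.M * R ^ 3 := by
  rw [field, norm_neg_I_smul]
  refine (e.norm_T_le _ _).trans ((e.norm_N_le _).trans ?_)
  refine mul_le_mul_of_nonneg_left ?_ e.M_nonneg
  exact pow_le_pow_left₀ (norm_nonneg _) ((e.norm_T_le t x).trans hx) 3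

theorem continuousOn_field {s : Set ℝ} {z : ℝ → E} (hz : ContinuousOn z s) :
    ContinuousOn (fun t => e.field t (z t)) s :=
  (e.continuousOn_T continuousOn_id.neg
    (e.continuous_N.comp_continuousOn (e.continuousOn_T continuousOn_id hz))).const_smul _

/-- `z` solves the equation of the interaction picture on `[0,T]`. -/
def IsTrajectory (T : ℝ) (z : ℝ → E) : Prop :=
  ∀ t ∈ Icc 0 T, HasDerivWithinAt z (e.field t (z t)) (Icc 0 T) t

variable {e}

theorem IsTrajectory.continuousOn {T : ℝ} {z : ℝ → E} (hz : e.IsTrajectory T z) :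
    ContinuousOn z (Icc 0 T) := fun t ht => (hz t ht).continuousWithinAt

theorem IsTrajectory.mono {T T' : ℝ} {z : ℝ → E} (hz : e.IsTrajectory T z) (h : T' ≤ T) :
    e.IsTrajectory T' z := fun t ht =>
  (hz t ⟨ht.1, ht.2.trans h⟩).mono (Icc_subset_Icc_right h)

/-- Lipschitz dependence of trajectories on the initial datum, by Grönwall's inequality. -/
theorem IsTrajectory.dist_le {T R : ℝ} {z w : ℝ → E} (hz : e.IsTrajectory T z)
    (hw : e.IsTrajectory T w) (hzR : ∀ t ∈ Icc 0 T, ‖z t‖ ≤ R) (hwR : ∀ t ∈ Icc 0 T, ‖w t‖ ≤ R)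
    {t : ℝ} (ht : t ∈ Icc 0 T) :
    dist (z t) (w t) ≤ dist (z 0) (w 0) * Real.exp (3 * e.M * R ^ 2 * t) := by
  have hK : 0 ≤ 3 * e.M * R ^ 2 := mul_nonneg (mul_nonneg (by norm_num) e.M_nonneg) (sq_nonneg R)
  have hI : ∀ {v : ℝ → E}, e.IsTrajectory T v → ∀ t ∈ Ico 0 T,
      HasDerivWithinAt v (e.field t (v t)) (Ici t) t := fun hv t ht =>
    (hv t (Ico_subset_Icc_self ht)).mono_of_mem_nhdsWithin (Icc_mem_nhdsGE_of_mem ht)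
  have h := dist_le_of_trajectories_ODE_of_mem (v := e.field) (K := ⟨3 * e.M * R ^ 2, hK⟩)
    (s := fun _ => {x | ‖x‖ ≤ R}) (f := z) (g := w) (a := 0) (b := T) (δ := dist (z 0) (w 0))
    (fun t _ => LipschitzOnWith.of_dist_le_mul fun x hx y hy => by
      rw [dist_eq_norm, dist_eq_norm]
      exact e.norm_field_sub_le t hx hy)
    hz.continuousOn (hI hz) (fun t ht => hzR t (Ico_subset_Icc_self ht))
    hw.continuousOn (hI hw) (fun t ht => hwR t (Ico_subset_Icc_self ht)) le_rfl t ht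
  rwa [sub_zero] at h

/-- Trajectories are determined by their initial data. -/
theorem IsTrajectory.eqOn {T : ℝ} {z w : ℝ → E} (hz : e.IsTrajectory T z)
    (hw : e.IsTrajectory T w) (h0 : z 0 = w 0) : EqOn z w (Icc 0 T) := by
  obtain ⟨R₁, h₁⟩ := (isCompact_Icc.image_of_continuousOn hz.continuousOn).isBounded.exists_norm_le
  obtain ⟨R₂, h₂⟩ := (isCompact_Icc.image_of_continuousOn hw.continuousOn).isBounded.exists_norm_le
  intro t ht
  have h := hz.dist_le hw (R := max R₁ R₂)
    (fun t ht => (h₁ _ (mem_image_of_mem z ht)).trans (le_max_left _ _))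
    (fun t ht => (h₂ _ (mem_image_of_mem w ht)).trans (le_max_right _ _)) ht
  rw [h0, dist_self, zero_mul] at h
  exact dist_le_zero.1 h

/-- A time up to which trajectories from the ball of radius `R` exist, for a cubic equation with
the constant `M`. -/
def lifespan (M R : ℝ) : ℝ := 1 / (8 * M * R ^ 2 + 1)

theorem lifespan_pos {M R : ℝ} (hM : 0 ≤ M) : 0 < lifespan M R := by
  rw [lifespan]; positivity

/-- Existence of trajectories, from the Picard–Lindelöf theorem. -/
theorem exists_isTrajectory [CompleteSpace E] (e : CubicEvolution E) {R T : ℝ} (hR : 0 ≤ R)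
    (hT : 0 ≤ T) (hTR : T ≤ lifespan e.M R) {x : E} (hx : ‖x‖ ≤ R) :
    ∃ z : ℝ → E, z 0 = x ∧ e.IsTrajectory T z ∧ ∀ t, ‖z t‖ ≤ 2 * R := by
  have hM := e.M_nonneg
  obtain ⟨a, ha⟩ : ∃ a : NNReal, (a : ℝ) = 2 * R := ⟨⟨2 * R, by positivity⟩, rfl⟩
  obtain ⟨r, hr⟩ : ∃ r : NNReal, (r : ℝ) = R := ⟨⟨R, hR⟩, rfl⟩
  obtain ⟨L, hL⟩ : ∃ L : NNReal, (L : ℝ) = e.M * (2 * R) ^ 3 := ⟨⟨_, by positivity⟩, rfl⟩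
  obtain ⟨K, hK⟩ : ∃ K : NNReal, (K : ℝ) = 3 * e.M * (2 * R) ^ 2 := ⟨⟨_, by positivity⟩, rfl⟩
  have hpl : IsPicardLindelof e.field (⟨0, left_mem_Icc.2 hT⟩ : Icc (0 : ℝ) T) (0 : E) a r L K :=
    { lipschitzOnWith := fun t _ => LipschitzOnWith.of_dist_le_mul fun x hx y hy => by
        rw [mem_closedBall_zero_iff, ha] at hx hy
        rw [dist_eq_norm, dist_eq_norm, hK]
        exact e.norm_field_sub_le t hx hy
      continuousOn := fun x _ => e.continuousOn_field continuousOn_const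
      norm_le := fun t _ x hx => by
        rw [mem_closedBall_zero_iff, ha] at hx
        rw [hL]
        exact e.norm_field_le t hx
      mul_max_le := by
        simp only [ha, hr, hL, sub_zero, sub_self]
        rw [max_eq_left hT]
        have h1 : 8 * e.M * R ^ 2 * T ≤ 1 := by
          have h2 : T * (8 * e.M * R ^ 2 + 1) ≤ 1 := by
            rwa [lifespan, le_div_iff₀ (by positivity)] at hTR
          nlinarith
        nlinarith }
  obtain ⟨z, h0, hz, hb⟩ := hpl.exists_hasDerivWithinAt_mem_closedBall (x := x)
    (by rwa [mem_closedBall_zero_iff, hr])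
  refine ⟨z, h0, hz, fun t => ?_⟩
  have := hb t
  rwa [mem_closedBall_zero_iff, ha] at this

/-- Duhamel's formula in the interaction picture. -/
theorem IsTrajectory.eq_integral [CompleteSpace E] {T : ℝ} {z : ℝ → E} (hz : e.IsTrajectory T z)
    {t : ℝ} (ht : t ∈ Icc 0 T) : z t = z 0 + ∫ τ in (0 : ℝ)..t, e.field τ (z τ) := by
  have hz' := hz.mono ht.2
  have h := intervalIntegral.integral_eq_sub_of_hasDeriv_right_of_le ht.1 hz'.continuousOn
    (fun s hs => ((hz' s (Ioo_subset_Icc_self hs)).mono_of_mem_nhdsWithin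
      (Icc_mem_nhdsGT_of_mem (Ioo_subset_Ico_self hs))))
    ((e.continuousOn_field hz'.continuousOn).intervalIntegrable_of_Icc ht.1)
  rw [h]
  abel

section Duhamel

variable {F : Type*} [NormedAddCommGroup F] [NormedSpace ℂ F]

/-- The passage from the interaction picture to Duhamel's formula in a larger space `F` in which
`E` is embedded by `j`. -/
theorem map_T_add_integral [CompleteSpace E] [CompleteSpace F] (e : CubicEvolution E)
    {j : E →L[ℂ] F} {S : ℝ → F → F} (hS : ∀ t x, j (e.T t x) = S t (j x)) (φ : E) {G : ℝ → E}
    {t : ℝ} (ht : 0 ≤ t) (hG : ContinuousOn G (Icc 0 t)) :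
    j (e.T t (φ + ∫ τ in (0 : ℝ)..t, -Complex.I • e.T (-τ) (G τ))) =
      S t (j φ) - Complex.I • ∫ τ in (0 : ℝ)..t, S (t - τ) (j (G τ)) := by
  have hc : ContinuousOn (fun τ => -Complex.I • e.T (-τ) (G τ)) (Icc 0 t) :=
    (e.continuousOn_T continuous_neg.continuousOn hG).const_smul (-Complex.I)
  have h := (j.comp (e.T t)).intervalIntegral_comp_comm
    (hc.intervalIntegrable_of_Icc (μ := volume) ht)
  rw [map_add, map_add, hS, ← ContinuousLinearMap.comp_apply, ← h, sub_eq_add_neg, ← neg_smul,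
    ← intervalIntegral.integral_smul]
  congr 1
  refine intervalIntegral.integral_congr fun τ _ => ?_
  simp only [ContinuousLinearMap.comp_apply, map_smul]
  rw [← e.T_add, ← sub_eq_add_neg, hS]

/-- A trajectory satisfies Duhamel's formula. -/
theorem IsTrajectory.duhamel [CompleteSpace E] [CompleteSpace F] {T : ℝ} {z : ℝ → E}
    (hz : e.IsTrajectory T z) {j : E →L[ℂ] F} {S : ℝ → F → F}
    (hS : ∀ t x, j (e.T t x) = S t (j x)) {t : ℝ} (ht : t ∈ Icc 0 T) :
    j (e.T t (z t)) = S t (j (z 0)) -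
      Complex.I • ∫ τ in (0 : ℝ)..t, S (t - τ) (j (e.N (e.T τ (z τ)))) := by
  rw [hz.eq_integral ht]
  exact e.map_T_add_integral hS (z 0) ht.1 (e.continuous_N.comp_continuousOn
    (e.continuousOn_T continuousOn_id (hz.mono ht.2).continuousOn))

/-- Continuous functions which satisfy Duhamel's formula come from trajectories. -/
theorem exists_isTrajectory_of_duhamel [CompleteSpace E] [CompleteSpace F] (e : CubicEvolution E)
    {j : E →L[ℂ] F} (hj : Function.Injective j) {S : ℝ → F → F}
    (hS : ∀ t x, j (e.T t x) = S t (j x)) {T : ℝ} (hT : 0 ≤ T) {φ : E} {u : C(Icc (0 : ℝ) T, E)}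
    {f : ℝ → F} (hf : ∀ τ : Icc (0 : ℝ) T, f τ = j (e.N (u τ)))
    (hu : ∀ t : Icc (0 : ℝ) T,
      j (u t) = S t (j φ) - Complex.I • ∫ τ in (0 : ℝ)..t, S (t - τ) (f τ)) :
    ∃ z : ℝ → E, z 0 = φ ∧ e.IsTrajectory T z ∧ ∀ t : Icc (0 : ℝ) T, u t = e.T t (z t) := by
  have hG : Continuous fun τ : ℝ => e.N (u (projIcc 0 T hT τ)) :=
    e.continuous_N.comp (u.continuous.comp continuous_projIcc)
  set G := fun τ : ℝ => e.N (u (projIcc 0 T hT τ)) with hGdef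
  have hGu : ∀ τ : Icc (0 : ℝ) T, G τ = e.N (u τ) := fun τ => by
    rw [hGdef]
    simp only [projIcc_val]
  have hg : Continuous fun τ : ℝ => -Complex.I • e.T (-τ) (G τ) := by
    rw [← continuousOn_univ]
    exact (e.continuousOn_T continuous_neg.continuousOn hG.continuousOn).const_smul (-Complex.I)
  set z := fun t : ℝ => φ + ∫ τ in (0 : ℝ)..t, -Complex.I • e.T (-τ) (G τ) with hz
  have huz : ∀ t : Icc (0 : ℝ) T, u t = e.T t (z t) := by
    intro t
    refine hj ?_
    rw [hz, e.map_T_add_integral hS φ t.2.1 hG.continuousOn, hu t]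
    congr 2
    refine intervalIntegral.integral_congr fun τ hτ => ?_
    rw [uIcc_of_le t.2.1] at hτ
    have hτ' : τ ∈ Icc 0 T := ⟨hτ.1, hτ.2.trans t.2.2⟩
    simp only [hf ⟨τ, hτ'⟩, hGu ⟨τ, hτ'⟩]
  refine ⟨z, by simp [hz], fun t ht => ?_, huz⟩
  have h1 : e.field t (z t) = -Complex.I • e.T (-t) (G t) := by
    rw [field, ← huz ⟨t, ht⟩, hGu ⟨t, ht⟩]
  rw [h1]
  exact ((hg.integral_hasStrictDerivAt 0 t).hasDerivAt.const_add φ).hasDerivWithinAt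

end Duhamel

/-- The solution `u(t) = T(t) z(t)` which belongs to a trajectory `z`. -/
def orbit {T : ℝ} {z : ℝ → E} (hz : e.IsTrajectory T z) : C(Icc (0 : ℝ) T, E) where
  toFun t := e.T t (z t)
  continuous_toFun := continuousOn_iff_continuous_domRestrict.1
    (e.continuousOn_T continuousOn_id hz.continuousOn)

theorem orbit_apply {T : ℝ} {z : ℝ → E} (hz : e.IsTrajectory T z) (t : Icc (0 : ℝ) T) :
    orbit hz t = e.T t (z t) := rfl

/-- The solution map is Lipschitz on bounded sets of initial data. -/
theorem exists_solutionMap [CompleteSpace E] (e : CubicEvolution E) {B : Set E}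
    (hB : Bornology.IsBounded B) :
    ∃ T : ℝ, 0 < T ∧ ∃ Ψ : E → C(Icc (0 : ℝ) T, E), UniformContinuousOn Ψ B ∧
      ∀ φ ∈ B, ∃ (z : ℝ → E) (hz : e.IsTrajectory T z), z 0 = φ ∧ Ψ φ = orbit hz := by
  obtain ⟨R, hR, hBR⟩ : ∃ R : ℝ, 0 ≤ R ∧ ∀ φ ∈ B, ‖φ‖ ≤ R := by
    obtain ⟨R, hR⟩ := hB.exists_norm_le
    exact ⟨max R 0, le_max_right _ _, fun φ hφ => (hR φ hφ).trans (le_max_left _ _)⟩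
  set T := lifespan e.M R with hT
  have hT0 : 0 < T := lifespan_pos e.M_nonneg
  have hex : ∀ φ : E, ∃ u : C(Icc (0 : ℝ) T, E), φ ∈ B →
      ∃ (z : ℝ → E) (hz : e.IsTrajectory T z), z 0 = φ ∧ (∀ t, ‖z t‖ ≤ 2 * R) ∧
        u = orbit hz := by
    intro φ
    by_cases hφ : φ ∈ B
    · obtain ⟨z, hz0, hz, hzR⟩ := e.exists_isTrajectory hR hT0.le le_rfl (hBR φ hφ)
      exact ⟨_, fun _ => ⟨z, hz, hz0, hzR, rfl⟩⟩
    · exact ⟨0, fun h => absurd h hφ⟩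
  choose Ψ hΨ using hex
  refine ⟨T, hT0, Ψ, ?_, fun φ hφ => ?_⟩
  · obtain ⟨C, hC⟩ : ∃ C : NNReal, (C : ℝ) = Real.exp (3 * e.M * (2 * R) ^ 2 * T) :=
      ⟨⟨_, (Real.exp_pos _).le⟩, rfl⟩
    have hlip : LipschitzOnWith C Ψ B := by
      refine LipschitzOnWith.of_dist_le_mul fun φ hφ ψ hψ => ?_
      obtain ⟨z, hz, hz0, hzR, h⟩ := hΨ φ hφ
      obtain ⟨w, hw, hw0, hwR, h'⟩ := hΨ ψ hψ
      rw [hC, h, h', ContinuousMap.dist_le (mul_nonneg (Real.exp_pos _).le dist_nonneg)]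
      intro t
      rw [orbit_apply, orbit_apply, dist_eq_norm, ← map_sub]
      refine (e.norm_T_le _ _).trans ?_
      rw [← dist_eq_norm]
      refine (hz.dist_le hw (fun t _ => hzR t) (fun t _ => hwR t) t.2).trans ?_
      rw [hz0, hw0, mul_comm]
      refine mul_le_mul_of_nonneg_right (Real.exp_le_exp.2 ?_) dist_nonneg
      refine mul_le_mul_of_nonneg_left t.2.2 ?_
      exact mul_nonneg (mul_nonneg (by norm_num) e.M_nonneg) (sq_nonneg _)
    exact hlip.uniformContinuousOn
  · obtain ⟨z, hz, hz0, -, h⟩ := hΨ φ hφ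
    exact ⟨z, hz, hz0, h⟩

end CubicEvolution

end Evolution

/-! ### The Hartree equation as a cubic evolution -/

section HartreeEvolution

/-- The estimate behind local existence: a cubic expression `A(P(x, x)) x`, with `P` and `A`
biadditive and bounded, satisfies a cubic Lipschitz estimate. -/
theorem norm_cubic_sub_le {E F : Type*} [NormedAddCommGroup E] [NormedAddCommGroup F]
    {P : E → E → F} {A : F → E → E} {M : ℝ}
    (hP₁ : ∀ x y z, P (x + y) z = P x z + P y z) (hP₂ : ∀ x y z, P z (x + y) = P z x + P z y)
    (hA₁ : ∀ m n x, A (m + n) x = A m x + A n x) (hA₂ : ∀ m x y, A m (x + y) = A m x + A m y)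
    (hP : ∀ x y, ‖P x y‖ ≤ M * (‖x‖ * ‖y‖)) (hA : ∀ m x, ‖A m x‖ ≤ ‖m‖ * ‖x‖) (x y : E) :
    ‖A (P x x) x - A (P y y) y‖ ≤ M * (‖x‖ ^ 2 + ‖x‖ * ‖y‖ + ‖y‖ ^ 2) * ‖x - y‖ := by
  have hb : ∀ a b c, ‖A (P a b) c‖ ≤ M * (‖a‖ * ‖b‖) * ‖c‖ := fun a b c =>
    (hA _ _).trans (mul_le_mul_of_nonneg_right (hP a b) (norm_nonneg _))
  have h : A (P x x) x - A (P y y) y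
      = A (P (x - y) x) x + A (P y (x - y)) x + A (P y y) (x - y) := by
    have h1 : A (P x x) x = A (P (x - y) x) x + A (P y x) x := by
      rw [← hA₁, ← hP₁, sub_add_cancel]
    have h2 : A (P y x) x = A (P y (x - y)) x + A (P y y) x := by
      rw [← hA₁, ← hP₂, sub_add_cancel]
    have h3 : A (P y y) x = A (P y y) (x - y) + A (P y y) y := by
      rw [← hA₂, sub_add_cancel]
    rw [h1, h2, h3]
    abel
  rw [h]
  refine (norm_add₃_le).trans ((add_le_add (add_le_add (hb _ _ _) (hb _ _ _)) (hb _ _ _)).trans_eq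
    ?_)
  ring

variable {d : ℕ} {γ : ℝ}

/-- The norm `max (e^{(d-γ)s} ‖p‖_W, e^{-γs} ‖p‖_{L²})` on `L² ∩ W`. -/
def scaledNorm (γ s : ℝ) (p : L2W d) : ℝ :=
  max (Real.exp ((d - γ) * s) * ‖p.1.1‖) (Real.exp (-γ * s) * ‖p.1.2‖)

theorem scaledNorm_zero (p : L2W d) : scaledNorm γ 0 p = ‖p‖ := by
  rw [scaledNorm, mul_zero, mul_zero, Real.exp_zero, one_mul, one_mul, L2W.norm_eq_max]

theorem scaledNorm_nonneg (s : ℝ) (p : L2W d) : 0 ≤ scaledNorm γ s p :=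
  le_max_of_le_left (mul_nonneg (Real.exp_pos _).le (norm_nonneg _))

/-- The constant in the bound of Hartree potentials. -/
def potentialBound (d : ℕ) (lam γ : ℝ) : ℝ := 2 * (|lam| * rieszBound d γ)

theorem potentialBound_nonneg (hγ : 0 < γ) (hγd : γ < d) (lam : ℝ) :
    0 ≤ potentialBound d lam γ :=
  mul_nonneg zero_le_two (mul_nonneg (abs_nonneg _) (rieszBound_nonneg hγ hγd))

/-- The Hartree potential is bounded for any two norms of the family, with one constant. -/
theorem norm_hartreePotential_le_scaledNorm (hγ : 0 < γ) (hγd : γ < d) (lam s t : ℝ)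
    (p q : L2W d) :
    ‖hartreePotential d lam γ p q‖ ≤
      potentialBound d lam γ * (scaledNorm γ s p * scaledNorm γ t q) := by
  have hC : 0 ≤ |lam| * rieszBound d γ := mul_nonneg (abs_nonneg _) (rieszBound_nonneg hγ hγd)
  have h1 : Real.exp (-γ * (s + t)) * (‖p.1.2‖ * ‖q.1.2‖)
      ≤ scaledNorm γ s p * scaledNorm γ t q := by
    rw [mul_add, Real.exp_add, mul_mul_mul_comm]
    exact mul_le_mul (le_max_right _ _) (le_max_right _ _) (by positivity) (scaledNorm_nonneg s p)
  have h2 : Real.exp ((d - γ) * (s + t)) * (‖p.1.1‖ * ‖q.1.1‖)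
      ≤ scaledNorm γ s p * scaledNorm γ t q := by
    rw [mul_add, Real.exp_add, mul_mul_mul_comm]
    exact mul_le_mul (le_max_left _ _) (le_max_left _ _) (by positivity) (scaledNorm_nonneg s p)
  refine (norm_hartreePotential_le hγ hγd lam p q (s + t)).trans
    ((mul_le_mul_of_nonneg_left (add_le_add h1 h2) hC).trans_eq ?_)
  rw [potentialBound]
  ring

theorem scaledNorm_wienerAct_le (s : ℝ) (m : Wiener d) (p : L2W d) :
    scaledNorm γ s (wienerAct m p) ≤ ‖m‖ * scaledNorm γ s p := by
  refine max_le ?_ ?_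
  · refine (mul_le_mul_of_nonneg_left (norm_wienerAct_fst_le m p) (Real.exp_pos _).le).trans ?_
    rw [mul_left_comm]
    exact mul_le_mul_of_nonneg_left (le_max_left _ _) (norm_nonneg _)
  · refine (mul_le_mul_of_nonneg_left (norm_wienerAct_snd_le m p) (Real.exp_pos _).le).trans ?_
    rw [mul_left_comm]
    exact mul_le_mul_of_nonneg_left (le_max_right _ _) (norm_nonneg _)

theorem scaledNorm_freeGroup_le (s t : ℝ) (p : L2W d) :
    scaledNorm γ s (freeGroup t p) ≤ scaledNorm γ s p := by
  refine max_le_max ?_ ?_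
  · exact mul_le_mul_of_nonneg_left (norm_freeGroup_fst_le t p) (Real.exp_pos _).le
  · exact mul_le_mul_of_nonneg_left (norm_freeGroup_snd_le t p) (Real.exp_pos _).le

/-- The Hartree nonlinearity `(K ∗ |p|²) p` on `L² ∩ W`. -/
def hartreeTerm (lam γ : ℝ) (p : L2W d) : L2W d := wienerAct (hartreePotential d lam γ p p) p

/-- The Hartree equation in `L² ∩ W`. -/
def hartreeEvolution (hγ : 0 < γ) (hγd : γ < d) (lam : ℝ) : CubicEvolution (L2W d) where
  T := freeGroup
  N := hartreeTerm lam γ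
  M := potentialBound d lam γ
  M_nonneg := potentialBound_nonneg hγ hγd lam
  norm_T_le t p := by
    simp only [← scaledNorm_zero (γ := γ)]
    exact scaledNorm_freeGroup_le 0 t p
  T_zero := freeGroup_zero
  T_add := freeGroup_add
  continuous_T := continuous_freeGroup
  N_zero := wienerAct_zero _
  norm_N_sub_le x y := norm_cubic_sub_le (P := hartreePotential d lam γ)
    (A := wienerAct) (hartreePotential_add_left hγ hγd lam)
    (fun x y z => hartreePotential_add_right hγ hγd lam z x y)
    wienerAct_add_left wienerAct_add_right
    (fun x y => by
      simpa only [scaledNorm_zero] using norm_hartreePotential_le_scaledNorm hγ hγd lam 0 0 x y)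
    (fun m x => by simpa only [scaledNorm_zero] using scaledNorm_wienerAct_le (γ := γ) 0 m x) x y

end HartreeEvolution

/-! ### Well-posedness in `L² ∩ W` -/

section WellPosedness

variable {d : ℕ} {γ lam T : ℝ}

/-- A trajectory of the interaction picture gives a solution of the Hartree equation. -/
theorem isSolution_of_isTrajectory (hγ : 0 < γ) (hγd : γ < d) {z : ℝ → L2W d}
    (hz : (hartreeEvolution hγ hγd lam).IsTrajectory T z) :
    IsSolution (kernel d lam γ) T (L2W.toWiener d (z 0))
      (fun t => L2W.toWiener d (CubicEvolution.orbit hz t)) :=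
  ⟨fun τ => L2W.toWiener d (hartreeTerm lam γ (freeGroup τ (z τ))),
    ((L2W.toWiener d).continuous.comp_continuousOn
      ((hartreeEvolution hγ hγd lam).continuous_N.comp_continuousOn
        ((hartreeEvolution hγ hγd lam).continuousOn_T continuousOn_id
          hz.continuousOn))).integrableOn_compact isCompact_Icc,
    fun _ => isNonlinearity_wienerAct hγ hγd lam _,
    fun t => hz.duhamel toWiener_freeGroup t.2⟩

/-- A solution of the Hartree equation in `C([0,T]; L² ∩ W)` gives a trajectory of the interaction
picture. -/
theorem isTrajectory_of_isSolution (hγ : 0 < γ) (hγd : γ < d) (hT : 0 ≤ T) {φ : L2W d}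
    {u : C(Icc (0 : ℝ) T, L2W d)}
    (hu : IsSolution (kernel d lam γ) T (L2W.toWiener d φ) fun t => L2W.toWiener d (u t)) :
    ∃ z : ℝ → L2W d, z 0 = φ ∧ (hartreeEvolution hγ hγd lam).IsTrajectory T z ∧
      ∀ t : Icc (0 : ℝ) T, u t = (hartreeEvolution hγ hγd lam).T t (z t) := by
  obtain ⟨F, -, hF, hu⟩ := hu
  exact (hartreeEvolution hγ hγd lam).exists_isTrajectory_of_duhamel L2W.toWiener_injective
    toWiener_freeGroup hT (fun τ => (hF τ).unique (isNonlinearity_wienerAct hγ hγd lam (u τ))) hu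

theorem eq_of_isSolution (hγ : 0 < γ) (hγd : γ < d) (hT : 0 ≤ T) {φ : L2W d}
    {u v : C(Icc (0 : ℝ) T, L2W d)}
    (hu : IsSolution (kernel d lam γ) T (L2W.toWiener d φ) fun t => L2W.toWiener d (u t))
    (hv : IsSolution (kernel d lam γ) T (L2W.toWiener d φ) fun t => L2W.toWiener d (v t)) :
    u = v := by
  obtain ⟨z, hz0, hz, huz⟩ := isTrajectory_of_isSolution hγ hγd hT hu
  obtain ⟨w, hw0, hw, hvw⟩ := isTrajectory_of_isSolution hγ hγd hT hv
  ext1 t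
  rw [huz, hvw, hz.eqOn hw (hz0.trans hw0.symm) t.2]

/-- Local well-posedness with `X = C([0,T]; S)`. -/
theorem LocallyWellPosed.of_solutionMap {K : Rd d → ℝ} {S : Type} [NormedAddCommGroup S]
    [NormedSpace ℂ S] [CompleteSpace S] {j : S →L[ℂ] Wiener d}
    (huniq : ∀ T : ℝ, 0 < T → ∀ φ : S, ∀ u v : C(Icc (0 : ℝ) T, S),
      IsSolution K T (j φ) (fun t => j (u t)) → IsSolution K T (j φ) (fun t => j (v t)) → u = v)
    (h : ∀ B : Set S, Bornology.IsBounded B → ∃ T : ℝ, 0 < T ∧ ∃ Ψ : S → C(Icc (0 : ℝ) T, S),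
      UniformContinuousOn Ψ B ∧ ∀ φ ∈ B, IsSolution K T (j φ) (fun t => j (Ψ φ t))) :
    LocallyWellPosed K j := by
  intro B hB
  obtain ⟨T, hT0, Ψ, hΨ, hsol⟩ := h B hB
  exact ⟨T, hT0, C(Icc (0 : ℝ) T, S), inferInstance, inferInstance, inferInstance,
    ContinuousLinearMap.id ℂ _, Function.injective_id, fun φ hφ => ⟨Ψ φ, hsol φ hφ, fun v hv =>
      huniq T hT0 φ _ _ hv (hsol φ hφ)⟩, Ψ, hsol, hΨ⟩

theorem locallyWellPosed_L2W (hγ : 0 < γ) (hγd : γ < d) (lam : ℝ) :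
    LocallyWellPosed (kernel d lam γ) (L2W.toWiener d) := by
  refine LocallyWellPosed.of_solutionMap
    (fun T hT φ u v hu hv => eq_of_isSolution hγ hγd hT.le hu hv) fun B hB => ?_
  obtain ⟨T, hT0, Ψ, hΨ, hz⟩ := (hartreeEvolution hγ hγd lam).exists_solutionMap hB
  refine ⟨T, hT0, Ψ, hΨ, fun φ hφ => ?_⟩
  obtain ⟨z, hz, hz0, h⟩ := hz φ hφ
  rw [h, ← hz0]
  exact isSolution_of_isTrajectory hγ hγd hz

end WellPosedness

/-! ### Gaussians -/

section Gaussian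

variable {d : ℕ} {γ : ℝ}

/-- The Fourier transform of the Gaussian of width `e^s`. -/
def gaussianHat (d : ℕ) (s : ℝ) (ξ : Rd d) : ℝ :=
  Real.exp (d * s) * Real.exp (-(Real.pi * Real.exp (2 * s)) * ‖ξ‖ ^ 2)

theorem gaussianHat_pos (s : ℝ) (ξ : Rd d) : 0 < gaussianHat d s ξ := by
  rw [gaussianHat]; positivity

theorem integrable_gaussianHat (s : ℝ) : Integrable (gaussianHat d s) :=
  (integrable_gaussian (by positivity)).const_mul _

theorem integral_gaussianHat (s : ℝ) : ∫ ξ, gaussianHat d s ξ = 1 := by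
  simp only [gaussianHat]
  rw [integral_const_mul, integral_gaussian (by positivity), div_mul_cancel_left₀ Real.pi_ne_zero,
    ← Real.exp_neg, ← Real.exp_mul, ← Real.exp_add, Real.exp_eq_one_iff]
  ring

/-- The Gaussian `e^{-π e^{-2s} |x|²}` of width `e^s`, as an element of the Wiener algebra. -/
def wienerGaussian (d : ℕ) (s : ℝ) : Wiener d :=
  wienerOfHat (fun ξ => (gaussianHat d s ξ : ℂ)) (integrable_gaussianHat s).ofReal

theorem norm_wienerGaussian (s : ℝ) : ‖wienerGaussian d s‖ = 1 := by
  rw [wienerGaussian, norm_wienerOfHat, ← integral_gaussianHat (d := d) s]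
  refine integral_congr_ae (Eventually.of_forall fun ξ => ?_)
  simp only [Complex.norm_real, Real.norm_of_nonneg (gaussianHat_pos s ξ).le]

theorem val_wienerGaussian (s : ℝ) (x : Rd d) :
    (wienerGaussian d s).val x =
      ((Real.exp (-(Real.pi * Real.exp (-(2 * s))) * ‖x‖ ^ 2) : ℝ) : ℂ) := by
  have h : (fun ξ => (gaussianHat d s ξ : ℂ)) = (Real.exp (d * s) : ℂ) • fun ξ : Rd d =>
      ((Real.exp (-(Real.pi * Real.exp (2 * s)) * ‖ξ‖ ^ 2) : ℝ) : ℂ) := by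
    funext ξ
    rw [gaussianHat, Complex.ofReal_mul]; rfl
  rw [wienerGaussian, val_wienerOfHat, h, Real.fourierInv_eq_fourier_neg, Real.fourier_eq]
  simp only [Pi.smul_apply, smul_comm _ (Real.exp (d * s) : ℂ)]
  rw [integral_smul, ← Real.fourier_eq, fourier_gaussian (by positivity), smul_eq_mul,
    ← Complex.ofReal_mul, ← mul_assoc, div_mul_cancel_left₀ Real.pi_ne_zero, ← Real.exp_neg,
    ← Real.exp_mul, ← Real.exp_add, norm_neg]
  congr 1
  have h1 : (d : ℝ) * s + -(2 * s) * ((d : ℝ) / 2) = 0 := by ring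
  rw [h1, Real.exp_zero, one_mul, Real.exp_neg]
  congr 2
  field_simp

/-- The Gaussian of width `e^s` is at least `e^{-πr²}` at distance at most `r e^s`. -/
theorem exp_le_norm_val_wienerGaussian {r s : ℝ} {x : Rd d} (hx : ‖x‖ ≤ r * Real.exp s) :
    Real.exp (-(Real.pi * r ^ 2)) ≤ ‖(wienerGaussian d s).val x‖ := by
  rw [val_wienerGaussian, Complex.norm_real, Real.norm_eq_abs, Real.abs_exp, Real.exp_le_exp,
    neg_mul, neg_le_neg_iff, mul_assoc]
  refine mul_le_mul_of_nonneg_left ?_ Real.pi_pos.le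
  have h : ‖x‖ ^ 2 ≤ (r * Real.exp s) ^ 2 := pow_le_pow_left₀ (norm_nonneg x) hx 2
  rw [Real.exp_neg, ← div_eq_inv_mul, div_le_iff₀ (Real.exp_pos _)]
  refine h.trans_eq ?_
  rw [mul_pow, ← Real.exp_nat_mul]
  norm_num

/-- A lower bound of `|x|^{-γ} ∗ g` for nonnegative functions `g`. -/
theorem le_integral_kernel_mul (hγ : 0 < γ) (hγd : γ < d) {g : Rd d → ℝ} (hg0 : ∀ x, 0 ≤ g x)
    (hg : Integrable fun y : Rd d => 1 / ‖y‖ ^ γ * g y) {A S : ℝ} (hS : 0 < S) (hA : 0 ≤ A)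
    (h : ∀ y, ‖y‖ ≤ S → A ≤ g y) :
    A * S ^ ((d : ℝ) - γ) * volume.real (Metric.ball (0 : Rd d) 1) ≤
      ∫ y : Rd d, 1 / ‖y‖ ^ γ * g y := by
  have hd : 0 < d := by
    rcases Nat.eq_zero_or_pos d with h | h
    · subst h; norm_num at hγd; linarith
    · exact h
  have : Nonempty (Fin d) := ⟨⟨0, hd⟩⟩
  have h0 : ∀ y : Rd d, 0 ≤ 1 / ‖y‖ ^ γ * g y := fun y => mul_nonneg (by positivity) (hg0 y)
  have hvol : volume.real (Metric.ball (0 : Rd d) S)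
      = S ^ (d : ℝ) * volume.real (Metric.ball (0 : Rd d) 1) := by
    rw [measureReal_def, Measure.addHaar_ball _ _ hS.le, ENNReal.toReal_mul,
      ENNReal.toReal_ofReal (by positivity), finrank_euclideanSpace_fin, Real.rpow_natCast,
      measureReal_def]
  have h1 : ∫ y in Metric.ball (0 : Rd d) S, A * S ^ (-γ) ≤
      ∫ y in Metric.ball (0 : Rd d) S, 1 / ‖y‖ ^ γ * g y := by
    refine setIntegral_mono_ae_restrict (integrableOn_const (by finiteness)) hg.integrableOn ?_
    filter_upwards [ae_restrict_mem Metric.isOpen_ball.measurableSet,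
      ae_restrict_of_ae (compl_mem_ae_iff.2 (measure_singleton (0 : Rd d)))] with y hy hy0
    have hyS : ‖y‖ ≤ S := (mem_ball_zero_iff.1 hy).le
    have hy' : 0 < ‖y‖ := norm_pos_iff.2 hy0
    rw [mul_comm, Real.rpow_neg hS.le, one_div]
    refine mul_le_mul (inv_anti₀ (by positivity) ?_) (h y hyS) hA (by positivity)
    exact Real.rpow_le_rpow hy'.le hyS hγ.le
  rw [setIntegral_const, smul_eq_mul, hvol] at h1
  refine (le_trans (le_of_eq ?_) h1).trans
    (setIntegral_le_integral hg (Eventually.of_forall h0))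
  rw [sub_eq_add_neg, Real.rpow_add hS]
  ring

end Gaussian

/-! ### Data without solutions -/

section NoSolution

variable {d : ℕ} {γ lam T : ℝ}

/-- For a solution to exist, the potential of the initial datum has to be finite. -/
theorem IsSolution.integrable_of_kernel {φ : Wiener d} {u : Icc (0 : ℝ) T → Wiener d}
    (hT : 0 ≤ T) (hlam : lam ≠ 0) (hu : IsSolution (kernel d lam γ) T φ u) :
    Integrable fun y : Rd d => 1 / ‖y‖ ^ γ * ‖φ.val (-y)‖ ^ 2 := by
  obtain ⟨F, -, hF, hu⟩ := hu
  have h0 : u ⟨0, left_mem_Icc.2 hT⟩ = φ := by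
    rw [hu, intervalIntegral.integral_same, smul_zero, sub_zero, schrodinger_eq, phase_zero,
      wienerMultiplier_apply, bddMul_one, LinearIsometryEquiv.symm_apply_apply]
  have h := (hF ⟨0, left_mem_Icc.2 hT⟩).1 0
  rw [h0] at h
  refine (h.const_mul lam⁻¹).congr (Eventually.of_forall fun y => ?_)
  simp only [kernel, ContinuousLinearMap.mul_apply', zero_sub]
  field_simp

/-- A superposition of slowly decreasing amounts of ever wider Gaussians is a function in the
Wiener algebra the potential of which diverges. -/
theorem exists_not_integrable_kernel (hγ : 0 < γ) (hγd : γ < d) :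
    ∃ f : Wiener d, ¬ Integrable fun y : Rd d => 1 / ‖y‖ ^ γ * ‖f.val (-y)‖ ^ 2 := by
  -- the width `e^{s n}` is such that the potential of the `n`th term is of size `4^{-n} 8^n`
  set s : ℕ → ℝ := fun n => n * Real.log 8 / (d - γ) with hs
  have hsum : Summable fun n : ℕ => ((1 / 2 : ℂ) ^ n) • wienerGaussian d (s n) := by
    refine Summable.of_norm ?_
    simp only [norm_smul, norm_wienerGaussian, mul_one, norm_pow]
    exact summable_geometric_of_lt_one (norm_nonneg _) (by norm_num)
  refine ⟨∑' n : ℕ, ((1 / 2 : ℂ) ^ n) • wienerGaussian d (s n), fun hint => ?_⟩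
  set f := ∑' n : ℕ, ((1 / 2 : ℂ) ^ n) • wienerGaussian d (s n) with hf
  have hval : ∀ (n : ℕ) (x : Rd d),
      (1 / 2) ^ n * ‖(wienerGaussian d (s n)).val x‖ ≤ ‖f.val x‖ := by
    intro n x
    have h1 := (((BoundedContinuousFunction.evalCLM ℂ x).comp valBCF).hasSum hsum.hasSum)
    have h2 : HasSum (fun n : ℕ => (1 / 2) ^ n * ‖(wienerGaussian d (s n)).val x‖)
        (f.val x).re := by
      have h3 : ∀ n : ℕ, (((1 / 2 : ℂ) ^ n • wienerGaussian d (s n)).val x).re =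
          (1 / 2) ^ n * ‖(wienerGaussian d (s n)).val x‖ := by
        intro n
        have h4 : ((1 / 2 : ℂ)) ^ n = (((1 / 2) ^ n : ℝ) : ℂ) := by push_cast; rfl
        rw [Wiener.val_smul, Pi.smul_apply, smul_eq_mul, val_wienerGaussian, h4,
          Complex.norm_real, Real.norm_eq_abs, Real.abs_exp, ← Complex.ofReal_mul,
          Complex.ofReal_re]
      simp only [← h3]
      exact Complex.hasSum_re h1
    exact (le_hasSum h2 n fun m _ => by positivity).trans (Complex.re_le_norm _)
  set θ := Real.exp (-(Real.pi * 1 ^ 2)) ^ 2 * volume.real (Metric.ball (0 : Rd d) 1) with hθ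
  have hθ0 : 0 < θ := by
    have : 0 < volume.real (Metric.ball (0 : Rd d) 1) :=
      ENNReal.toReal_pos (Metric.measure_ball_pos _ _ one_pos).ne' (by finiteness)
    positivity
  have hlow : ∀ n : ℕ, 2 ^ n * θ ≤ ∫ y : Rd d, 1 / ‖y‖ ^ γ * ‖f.val (-y)‖ ^ 2 := by
    intro n
    refine le_trans (le_of_eq ?_) (le_integral_kernel_mul hγ hγd (fun _ => sq_nonneg _) hint
      (S := Real.exp (s n)) (A := ((1 / 2) ^ n * Real.exp (-(Real.pi * 1 ^ 2))) ^ 2)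
      (Real.exp_pos _) (sq_nonneg _) fun y hy => ?_)
    · have h8 : Real.exp (s n) ^ ((d : ℝ) - γ) = 8 ^ n := by
        have : (d : ℝ) - γ ≠ 0 := (sub_pos.2 hγd).ne'
        rw [← Real.exp_mul, hs]
        simp only
        rw [div_mul_cancel₀ _ this, Real.exp_nat_mul, Real.exp_log (by norm_num)]
      rw [h8, hθ]
      have h2 : (2 : ℝ) ^ n = ((1 / 2) ^ n) ^ 2 * 8 ^ n := by
        rw [← pow_mul, mul_comm n, pow_mul, ← mul_pow]
        norm_num
      rw [h2]
      ring
    · refine pow_le_pow_left₀ (by positivity) (le_trans ?_ (hval n (-y))) 2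
      refine mul_le_mul_of_nonneg_left (exp_le_norm_val_wienerGaussian ?_) (by positivity)
      rwa [norm_neg, one_mul]
  obtain ⟨n, hn⟩ := pow_unbounded_of_one_lt
    ((∫ y : Rd d, 1 / ‖y‖ ^ γ * ‖f.val (-y)‖ ^ 2) / θ) (one_lt_two (α := ℝ))
  rw [div_lt_iff₀ hθ0] at hn
  exact (hlow n).not_gt hn

/-- In each ball of the Wiener algebra there are initial data without a solution. -/
theorem exists_mem_ball_forall_not_isSolution (hγ : 0 < γ) (hγd : γ < d) (hlam : lam ≠ 0)
    (c : Wiener d) {r : ℝ} (hr : 0 < r) :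
    ∃ φ ∈ Metric.ball c r, ∀ T : ℝ, 0 ≤ T → ∀ u : Icc (0 : ℝ) T → Wiener d,
      ¬ IsSolution (kernel d lam γ) T φ u := by
  by_contra! hcon
  have hI : ∀ φ ∈ Metric.ball c r,
      Integrable fun y : Rd d => 1 / ‖y‖ ^ γ * ‖φ.val (-y)‖ ^ 2 := fun φ hφ => by
    obtain ⟨T, hT, u, hu⟩ := hcon φ hφ
    exact hu.integrable_of_kernel hT hlam
  obtain ⟨f, hf⟩ := exists_not_integrable_kernel hγ hγd
  obtain ⟨a, ha, har⟩ : ∃ a : ℝ, 0 < a ∧ a * ‖f‖ < r := by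
    refine ⟨r / (‖f‖ + 1), by positivity, ?_⟩
    rw [div_mul_eq_mul_div, div_lt_iff₀ (by positivity)]
    nlinarith
  have h1 := hI c (Metric.mem_ball_self hr)
  have h2 := hI (c + (a : ℂ) • f) (by
    rw [mem_ball_iff_norm, add_sub_cancel_left, norm_smul, Complex.norm_real,
      Real.norm_of_nonneg ha.le]
    exact har)
  -- `a² |f|² ≤ 2 |c + a f|² + 2 |c|²`
  refine hf ((((h1.add h2).const_mul (2 / a ^ 2))).mono ?_ (Eventually.of_forall fun y => ?_))
  · have : Measurable fun y : Rd d => ‖y‖ ^ γ := measurable_norm.pow_const γ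
    exact ((measurable_const.div this).mul
      (((continuous_val f).comp continuous_neg).norm.pow 2).measurable).aestronglyMeasurable
  · have h3 : a ^ 2 * ‖f.val (-y)‖ ^ 2 ≤
        2 * (‖c.val (-y)‖ ^ 2 + ‖(c + (a : ℂ) • f).val (-y)‖ ^ 2) := by
      have h4 : (a : ℂ) * f.val (-y) = (c + (a : ℂ) • f).val (-y) - c.val (-y) := by
        rw [Wiener.val_add, Wiener.val_smul]
        simp
      have h5 : a * ‖f.val (-y)‖ ≤ ‖(c + (a : ℂ) • f).val (-y)‖ + ‖c.val (-y)‖ := by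
        have ha' : ‖(a : ℂ)‖ = a := by rw [Complex.norm_real, Real.norm_of_nonneg ha.le]
        nth_rw 1 [← ha']
        rw [← norm_mul, h4]
        exact norm_sub_le _ _
      have h6 := pow_le_pow_left₀ (by positivity) h5 2
      nlinarith [sq_nonneg (‖(c + (a : ℂ) • f).val (-y)‖ - ‖c.val (-y)‖)]
    rw [Real.norm_of_nonneg (by positivity)]
    refine le_trans ?_ (le_abs_self _)
    simp only [Pi.add_apply]
    rw [← mul_add, mul_left_comm]
    refine mul_le_mul_of_nonneg_left ?_ (by positivity)
    rw [div_mul_eq_mul_div, le_div_iff₀ (by positivity), mul_comm]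
    exact h3

end NoSolution

/-! ### Equivalent norms -/

section Renorming

variable {E : Type*} [NormedAddCommGroup E] [NormedSpace ℂ E]

/-- A norm on `E` which is equivalent to the given one. -/
structure EquivalentNorm (E : Type*) [NormedAddCommGroup E] [NormedSpace ℂ E] where
  /-- the new norm -/
  norm : Seminorm ℂ E
  /-- the constant in the lower bound by the given norm -/
  lower : ℝ
  /-- the constant in the upper bound by the given norm -/
  upper : ℝ
  lower_pos : 0 < lower
  lower_mul_le : ∀ x, lower * ‖x‖ ≤ norm x
  le_upper_mul : ∀ x, norm x ≤ upper * ‖x‖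

/-- The space `E` with an equivalent norm. -/
def Renormed (_ : EquivalentNorm E) : Type _ := E

namespace Renormed

variable {n : EquivalentNorm E}

instance : AddCommGroup (Renormed n) := inferInstanceAs (AddCommGroup E)

instance : Module ℂ (Renormed n) := inferInstanceAs (Module ℂ E)

instance : NormedAddCommGroup (Renormed n) :=
  AddGroupNorm.toNormedAddCommGroup (E := Renormed n)
    { toFun := n.norm
      map_zero' := map_zero n.norm
      add_le' := map_add_le_add n.norm
      neg' := map_neg_eq_map n.norm
      eq_zero_of_map_eq_zero' := fun x hx => by
        have h := n.lower_mul_le x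
        rw [hx] at h
        exact norm_le_zero_iff.1 (nonpos_of_mul_nonpos_right h n.lower_pos) }

variable (n) in
/-- The identity map from `E` with the new norm to `E`. -/
def toBase : Renormed n ≃ₗ[ℂ] E := LinearEquiv.refl ℂ E

theorem norm_def (x : Renormed n) : ‖x‖ = n.norm (toBase n x) := rfl

instance : NormedSpace ℂ (Renormed n) where
  norm_smul_le c x := (map_smul_eq_mul n.norm c (toBase n x)).le

variable (n) in
/-- The identity map from `E` with the new norm to `E`, as a topological isomorphism. -/
def toBaseL : Renormed n ≃L[ℂ] E :=
  (toBase n).toContinuousLinearEquivOfBounds n.lower⁻¹ n.upper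
    (fun x => by
      rw [← div_eq_inv_mul, le_div_iff₀ n.lower_pos, mul_comm]
      exact n.lower_mul_le _)
    (fun x => n.le_upper_mul x)

theorem norm_eq (x : Renormed n) : ‖x‖ = n.norm (toBaseL n x) := rfl

instance [CompleteSpace E] : CompleteSpace (Renormed n) :=
  (completeSpace_congr (e := (toBaseL n).toEquiv) (toBaseL n).isUniformEmbedding).2 inferInstance

end Renormed

end Renorming

namespace CubicEvolution

section Functional

variable {E E' : Type*} [NormedAddCommGroup E] [NormedSpace ℂ E] [NormedAddCommGroup E']
  [NormedSpace ℂ E'] {e : CubicEvolution E} {T : ℝ} {z : ℝ → E}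

/-- Linear maps which intertwine two evolutions map trajectories to trajectories. -/
theorem IsTrajectory.map (hz : e.IsTrajectory T z) {e' : CubicEvolution E'} (σ : E →L[ℂ] E')
    (hT : ∀ t x, σ (e.T t x) = e'.T t (σ x)) (hN : ∀ x, σ (e.N x) = e'.N (σ x)) :
    e'.IsTrajectory T fun t => σ (z t) := by
  intro t ht
  have h := (σ.restrictScalars ℝ).hasFDerivAt.comp_hasDerivWithinAt t (hz t ht)
  have h1 : σ (e.field t (z t)) = e'.field t (σ (z t)) := by
    rw [field, field, map_smul, hT, hN, hT]
  rw [← h1]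
  exact h

theorem IsTrajectory.norm_sub_initial_le {R : ℝ} (hz : e.IsTrajectory T z)
    (hR : ∀ t ∈ Icc 0 T, ‖z t‖ ≤ R) {t : ℝ} (ht : t ∈ Icc 0 T) :
    ‖z t - z 0‖ ≤ e.M * R ^ 3 * t := by
  have h := norm_image_sub_le_of_norm_deriv_le_segment' (f := z)
    (f' := fun t => e.field t (z t)) (a := 0) (b := T) hz
    (fun s hs => e.norm_field_le s (hR s (Ico_subset_Icc_self hs))) t ht
  rwa [sub_zero] at h

/-- The first Picard iterate, tested with a functional `L` which hardly changes along the linear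
group, is accurate up to second order in time. -/
theorem IsTrajectory.norm_functional_le {R c : ℝ} (hz : e.IsTrajectory T z)
    (hR : ∀ t ∈ Icc 0 T, ‖z t‖ ≤ R) {L : E →L[ℂ] ℂ} (hL : ∀ x, ‖L x‖ ≤ c * ‖x‖)
    (hLT : ∀ t x, ‖L (e.T t x) - L x‖ ≤ c * |t| * ‖x‖)
    (h0 : ∀ t, 0 ≤ t → ‖e.T t (z 0) - z 0‖ ≤ c * t) (hc : 0 ≤ c) {t : ℝ} (ht : t ∈ Icc 0 T) :
    ‖L (z t) - L (z 0) + Complex.I * t * L (e.N (z 0))‖ ≤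
      c * (e.M * R ^ 3 + 3 * e.M * R ^ 2 * (e.M * R ^ 3 + c)) * t ^ 2 := by
  have hM := e.M_nonneg
  have hT : (0 : ℝ) ≤ T := ht.1.trans ht.2
  have hz0 : ‖z 0‖ ≤ R := hR 0 ⟨le_rfl, hT⟩
  have hR0 : 0 ≤ R := (norm_nonneg _).trans hz0
  set C := c * (e.M * R ^ 3 + 3 * e.M * R ^ 2 * (e.M * R ^ 3 + c)) with hC
  have hC0 : 0 ≤ C := by positivity
  have hz' := hz.mono ht.2
  have hb : ∀ τ ∈ Icc 0 t,
      ‖L (e.field τ (z τ)) + Complex.I * L (e.N (z 0))‖ ≤ C * t := by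
    intro τ hτ
    have hτT : τ ∈ Icc 0 T := ⟨hτ.1, hτ.2.trans ht.2⟩
    have h1 : L (e.field τ (z τ)) + Complex.I * L (e.N (z 0)) =
        -Complex.I * ((L (e.T (-τ) (e.N (e.T τ (z τ)))) - L (e.N (e.T τ (z τ)))) +
          L (e.N (e.T τ (z τ)) - e.N (z 0))) := by
      rw [field, map_smul, smul_eq_mul, map_sub]
      ring
    have h2 : ‖e.T τ (z τ)‖ ≤ R := (e.norm_T_le _ _).trans (hR τ hτT)
    have h3 : ‖e.N (e.T τ (z τ))‖ ≤ e.M * R ^ 3 :=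
      (e.norm_N_le _).trans (by gcongr)
    have h4 : ‖e.T τ (z τ) - z 0‖ ≤ (e.M * R ^ 3 + c) * τ := by
      have : e.T τ (z τ) - z 0 = e.T τ (z τ - z 0) + (e.T τ (z 0) - z 0) := by
        rw [map_sub]; abel
      rw [this, add_mul]
      exact (norm_add_le _ _).trans (add_le_add
        ((e.norm_T_le _ _).trans (hz.norm_sub_initial_le hR hτT)) (h0 τ hτ.1))
    have h5 : ‖e.N (e.T τ (z τ)) - e.N (z 0)‖ ≤ 3 * e.M * R ^ 2 * ((e.M * R ^ 3 + c) * τ) :=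
      (e.norm_N_sub_le_of_le h2 hz0).trans (by gcongr)
    rw [h1, norm_mul, norm_neg, Complex.norm_I, one_mul]
    calc _ ≤ c * |-τ| * (e.M * R ^ 3) + c * (3 * e.M * R ^ 2 * ((e.M * R ^ 3 + c) * τ)) :=
          (norm_add_le _ _).trans (add_le_add ((hLT _ _).trans (by gcongr))
            ((hL _).trans (by gcongr)))
      _ = C * τ := by rw [abs_neg, abs_of_nonneg hτ.1, hC]; ring
      _ ≤ C * t := mul_le_mul_of_nonneg_left hτ.2 hC0
  have hder : ∀ τ ∈ Icc 0 t, HasDerivWithinAt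
      (fun τ : ℝ => L (z τ) + Complex.I * τ * L (e.N (z 0)))
      (L (e.field τ (z τ)) + Complex.I * L (e.N (z 0))) (Icc 0 t) τ := by
    intro τ hτ
    have h1 := (L.restrictScalars ℝ).hasFDerivAt.comp_hasDerivWithinAt τ (hz' τ hτ)
    have h2 : HasDerivAt (fun τ : ℝ => Complex.I * τ * L (e.N (z 0)))
        (Complex.I * L (e.N (z 0))) τ := by
      have := ((Complex.ofRealCLM.hasDerivAt (x := τ)).const_mul Complex.I).mul_const
        (L (e.N (z 0)))
      simpa using this
    exact h1.add h2.hasDerivWithinAt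
  have h := norm_image_sub_le_of_norm_deriv_le_segment' hder
    (fun τ hτ => hb τ (Ico_subset_Icc_self hτ)) t ⟨ht.1, le_rfl⟩
  simp only [Complex.ofReal_zero, mul_zero, zero_mul, add_zero, sub_zero] at h
  rw [add_sub_right_comm] at h
  exact h.trans_eq (by ring)

end Functional

end CubicEvolution

/-! ### Two scales at once -/

section TwoScales

variable {d : ℕ} {γ : ℝ}

theorem max_mul_le_add {a b x y x₁ y₁ x₂ y₂ : ℝ} (ha : 0 ≤ a) (hb : 0 ≤ b) (hx : x ≤ x₁ + x₂)
    (hy : y ≤ y₁ + y₂) : max (a * x) (b * y) ≤ max (a * x₁) (b * y₁) + max (a * x₂) (b * y₂) :=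
  max_le
    ((mul_le_mul_of_nonneg_left hx ha).trans (by
      rw [mul_add]; exact add_le_add (le_max_left _ _) (le_max_left _ _)))
    ((mul_le_mul_of_nonneg_left hy hb).trans (by
      rw [mul_add]; exact add_le_add (le_max_right _ _) (le_max_right _ _)))

theorem min_mul_max_le {a b x y : ℝ} (ha : 0 ≤ a) (hb : 0 ≤ b) (hx : 0 ≤ x) (hy : 0 ≤ y) :
    min a b * max x y ≤ max (a * x) (b * y) := by
  rw [mul_max_of_nonneg _ _ (le_min ha hb)]
  exact max_le_max (mul_le_mul_of_nonneg_right (min_le_left _ _) hx)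
    (mul_le_mul_of_nonneg_right (min_le_right _ _) hy)

theorem max_mul_le_max_mul {a b x y : ℝ} (ha : 0 ≤ a) (hx : 0 ≤ x) (hy : 0 ≤ y) :
    max (a * x) (b * y) ≤ max a b * max x y := by
  rw [mul_max_of_nonneg _ _ (le_max_of_le_left ha)]
  exact max_le_max (mul_le_mul_of_nonneg_right (le_max_left _ _) hx)
    (mul_le_mul_of_nonneg_right (le_max_right _ _) hy)

theorem scaledNorm_add_le (s : ℝ) (p q : L2W d) :
    scaledNorm γ s (p + q) ≤ scaledNorm γ s p + scaledNorm γ s q :=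
  max_mul_le_add (Real.exp_pos _).le (Real.exp_pos _).le (norm_add_le p.1.1 q.1.1)
    (norm_add_le p.1.2 q.1.2)

theorem scaledNorm_smul (s : ℝ) (c : ℂ) (p : L2W d) :
    scaledNorm γ s (c • p) = ‖c‖ * scaledNorm γ s p := by
  have h1 : ‖(c • p).1.1‖ = ‖c‖ * ‖p.1.1‖ := norm_smul c p.1.1
  have h2 : ‖(c • p).1.2‖ = ‖c‖ * ‖p.1.2‖ := norm_smul c p.1.2
  rw [scaledNorm, scaledNorm, h1, h2, mul_max_of_nonneg _ _ (norm_nonneg c), mul_left_comm,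
    mul_left_comm _ ‖c‖]

variable (d γ) in
/-- The norm `scaledNorm γ s` as an equivalent norm on `L² ∩ W`. -/
def scaledEquivalentNorm (s : ℝ) : EquivalentNorm (L2W d) where
  norm := Seminorm.of (scaledNorm γ s) (scaledNorm_add_le s) (scaledNorm_smul s)
  lower := min (Real.exp ((d - γ) * s)) (Real.exp (-γ * s))
  upper := max (Real.exp ((d - γ) * s)) (Real.exp (-γ * s))
  lower_pos := lt_min (Real.exp_pos _) (Real.exp_pos _)
  lower_mul_le p := min_mul_max_le (Real.exp_pos _).le (Real.exp_pos _).le (norm_nonneg p.1.1)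
    (norm_nonneg p.1.2)
  le_upper_mul p := max_mul_le_max_mul (Real.exp_pos _).le (norm_nonneg p.1.1)
    (norm_nonneg p.1.2)

variable (d γ) in
/-- The space `L² ∩ W` with the norm `max (e^{(d-γ)s} ‖p‖_W, e^{-γs} ‖p‖_{L²})`. -/
abbrev ScaledL2W (s : ℝ) : Type := Renormed (scaledEquivalentNorm d γ s)

variable (d γ) in
/-- The identity map from `ScaledL2W d γ s` to `L² ∩ W`. -/
abbrev unscale (s : ℝ) : ScaledL2W d γ s ≃L[ℂ] L2W d := Renormed.toBaseL _

theorem norm_scaledL2W (s : ℝ) (w : ScaledL2W d γ s) : ‖w‖ = scaledNorm γ s (unscale d γ s w) :=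
  rfl

/-- The function `v + w` which is represented by a pair `(v, w)`. -/
def pairSum (d : ℕ) (γ s : ℝ) : L2W d × ScaledL2W d γ s →L[ℂ] L2W d :=
  (ContinuousLinearMap.id ℂ (L2W d)).coprod (unscale d γ s : ScaledL2W d γ s →L[ℂ] L2W d)

theorem pairSum_apply (s : ℝ) (x : L2W d × ScaledL2W d γ s) :
    pairSum d γ s x = x.1 + unscale d γ s x.2 := rfl

theorem pairSum_add (s : ℝ) (x y : L2W d × ScaledL2W d γ s) :
    pairSum d γ s (x + y) = pairSum d γ s x + pairSum d γ s y :=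
  (pairSum d γ s).map_add x y

/-- The free group on pairs. -/
def pairGroup (d : ℕ) (γ s t : ℝ) : L2W d × ScaledL2W d γ s →L[ℂ] L2W d × ScaledL2W d γ s :=
  (freeGroup t).prodMap (((unscale d γ s).symm : L2W d →L[ℂ] ScaledL2W d γ s).comp
    ((freeGroup t).comp (unscale d γ s : ScaledL2W d γ s →L[ℂ] L2W d)))

/-- The product of an element of the Wiener algebra and a pair. -/
def pairAct (d : ℕ) (γ s : ℝ) (m : Wiener d) (x : L2W d × ScaledL2W d γ s) :
    L2W d × ScaledL2W d γ s :=
  (wienerAct m x.1, (unscale d γ s).symm (wienerAct m (unscale d γ s x.2)))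

theorem norm_pair (s : ℝ) (x : L2W d × ScaledL2W d γ s) :
    ‖x‖ = max (scaledNorm γ 0 x.1) (scaledNorm γ s (unscale d γ s x.2)) := by
  rw [scaledNorm_zero]; rfl

theorem pairSum_pairGroup (s t : ℝ) (x : L2W d × ScaledL2W d γ s) :
    pairSum d γ s (pairGroup d γ s t x) = freeGroup t (pairSum d γ s x) := by
  rw [pairSum_apply, pairSum_apply, map_add]
  rfl

theorem pairSum_pairAct (s : ℝ) (m : Wiener d) (x : L2W d × ScaledL2W d γ s) :
    pairSum d γ s (pairAct d γ s m x) = wienerAct m (pairSum d γ s x) := by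
  rw [pairSum_apply, pairSum_apply, wienerAct_add_right]
  rfl

theorem norm_hartreePotential_pairSum_le (hγ : 0 < γ) (hγd : γ < d) (lam s : ℝ)
    (x y : L2W d × ScaledL2W d γ s) :
    ‖hartreePotential d lam γ (pairSum d γ s x) (pairSum d γ s y)‖ ≤
      4 * potentialBound d lam γ * (‖x‖ * ‖y‖) := by
  have hM := potentialBound_nonneg hγ hγd lam
  have h : ∀ a b : ℝ, ∀ p q : L2W d, scaledNorm γ a p ≤ ‖x‖ → scaledNorm γ b q ≤ ‖y‖ →
      ‖hartreePotential d lam γ p q‖ ≤ potentialBound d lam γ * (‖x‖ * ‖y‖) :=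
    fun a b p q hp hq => (norm_hartreePotential_le_scaledNorm hγ hγd lam a b p q).trans
      (mul_le_mul_of_nonneg_left (mul_le_mul hp hq (scaledNorm_nonneg _ _) (norm_nonneg _)) hM)
  have hx1 := (le_max_left _ _).trans_eq (norm_pair s x).symm
  have hx2 := (le_max_right _ _).trans_eq (norm_pair s x).symm
  have hy1 := (le_max_left _ _).trans_eq (norm_pair s y).symm
  have hy2 := (le_max_right _ _).trans_eq (norm_pair s y).symm
  rw [pairSum_apply, pairSum_apply, hartreePotential_add_left hγ hγd,
    hartreePotential_add_right hγ hγd, hartreePotential_add_right hγ hγd]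
  refine (norm_add_le _ _).trans ((add_le_add
    ((norm_add_le _ _).trans (add_le_add (h _ _ _ _ hx1 hy1) (h _ _ _ _ hx1 hy2)))
    ((norm_add_le _ _).trans (add_le_add (h _ _ _ _ hx2 hy1) (h _ _ _ _ hx2 hy2)))).trans_eq ?_)
  ring

theorem norm_pairGroup_le (s t : ℝ) (x : L2W d × ScaledL2W d γ s) :
    ‖pairGroup d γ s t x‖ ≤ ‖x‖ := by
  rw [norm_pair, norm_pair]
  exact max_le_max (scaledNorm_freeGroup_le 0 t _) (scaledNorm_freeGroup_le s t _)

theorem pairGroup_zero (s : ℝ) (x : L2W d × ScaledL2W d γ s) : pairGroup d γ s 0 x = x :=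
  Prod.ext (freeGroup_zero x.1)
    ((unscale d γ s).injective (freeGroup_zero (unscale d γ s x.2)))

theorem pairGroup_add (s t t' : ℝ) (x : L2W d × ScaledL2W d γ s) :
    pairGroup d γ s (t + t') x = pairGroup d γ s t (pairGroup d γ s t' x) :=
  Prod.ext (freeGroup_add t t' x.1)
    ((unscale d γ s).injective (freeGroup_add t t' (unscale d γ s x.2)))

theorem continuous_pairGroup (s : ℝ) (x : L2W d × ScaledL2W d γ s) :
    Continuous fun t => pairGroup d γ s t x := by
  have h1 := continuous_freeGroup x.1
  have h2 := (unscale d γ s).symm.continuous.comp (continuous_freeGroup (unscale d γ s x.2))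
  exact Continuous.prodMk h1 h2

theorem pairAct_add_left (s : ℝ) (m n : Wiener d) (x : L2W d × ScaledL2W d γ s) :
    pairAct d γ s (m + n) x = pairAct d γ s m x + pairAct d γ s n x := by
  simp only [pairAct, wienerAct_add_left, map_add, Prod.mk_add_mk]

theorem pairAct_add_right (s : ℝ) (m : Wiener d) (x y : L2W d × ScaledL2W d γ s) :
    pairAct d γ s m (x + y) = pairAct d γ s m x + pairAct d γ s m y := by
  simp only [pairAct, wienerAct_add_right, map_add, Prod.mk_add_mk, Prod.fst_add, Prod.snd_add]

theorem pairAct_zero (s : ℝ) (m : Wiener d) :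
    pairAct d γ s m (0 : L2W d × ScaledL2W d γ s) = 0 := by
  simp only [pairAct, wienerAct_zero, map_zero, Prod.fst_zero, Prod.snd_zero, Prod.mk_zero_zero]

theorem norm_pairAct_le (s : ℝ) (m : Wiener d) (x : L2W d × ScaledL2W d γ s) :
    ‖pairAct d γ s m x‖ ≤ ‖m‖ * ‖x‖ := by
  rw [norm_pair, norm_pair, mul_max_of_nonneg _ _ (norm_nonneg _)]
  exact max_le_max (scaledNorm_wienerAct_le 0 m _) (scaledNorm_wienerAct_le s m _)

/-- The Hartree nonlinearity for pairs. -/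
def pairTerm (d : ℕ) (lam γ s : ℝ) (x : L2W d × ScaledL2W d γ s) : L2W d × ScaledL2W d γ s :=
  pairAct d γ s (hartreePotential d lam γ (pairSum d γ s x) (pairSum d γ s x)) x

theorem norm_pairTerm_sub_le (hγ : 0 < γ) (hγd : γ < d) (lam s : ℝ)
    (x y : L2W d × ScaledL2W d γ s) :
    ‖pairTerm d lam γ s x - pairTerm d lam γ s y‖ ≤
      4 * potentialBound d lam γ * (‖x‖ ^ 2 + ‖x‖ * ‖y‖ + ‖y‖ ^ 2) * ‖x - y‖ :=
  norm_cubic_sub_le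
    (P := fun x y => hartreePotential d lam γ (pairSum d γ s x) (pairSum d γ s y))
    (A := pairAct d γ s)
    (fun x y z => (congrArg (hartreePotential d lam γ · (pairSum d γ s z))
      (pairSum_add s x y)).trans (hartreePotential_add_left hγ hγd lam _ _ _))
    (fun x y z => (congrArg (hartreePotential d lam γ (pairSum d γ s z))
      (pairSum_add s x y)).trans (hartreePotential_add_right hγ hγd lam _ _ _))
    (pairAct_add_left s) (pairAct_add_right s)
    (norm_hartreePotential_pairSum_le hγ hγd lam s) (norm_pairAct_le s) x y

/-- The Hartree equation for `v + w`, as a system for the pair `(v, w)`. The constant of this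
evolution does not depend on the scale of the second component. -/
def pairEvolution (hγ : 0 < γ) (hγd : γ < d) (lam s : ℝ) :
    CubicEvolution (L2W d × ScaledL2W d γ s) where
  T := pairGroup d γ s
  N := pairTerm d lam γ s
  M := 4 * potentialBound d lam γ
  M_nonneg := mul_nonneg (by norm_num) (potentialBound_nonneg hγ hγd lam)
  norm_T_le := norm_pairGroup_le s
  T_zero := pairGroup_zero s
  T_add := pairGroup_add s
  continuous_T := continuous_pairGroup s
  N_zero := pairAct_zero s _
  norm_N_sub_le := norm_pairTerm_sub_le hγ hγd lam s

theorem pairSum_pairEvolution_N (hγ : 0 < γ) (hγd : γ < d) (lam s : ℝ)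
    (x : L2W d × ScaledL2W d γ s) :
    pairSum d γ s ((pairEvolution hγ hγd lam s).N x) = hartreeTerm lam γ (pairSum d γ s x) :=
  pairSum_pairAct s _ x

/-- A trajectory of pairs gives a trajectory of the Hartree equation. -/
theorem isTrajectory_pairSum {hγ : 0 < γ} {hγd : γ < d} {lam s T : ℝ}
    {z : ℝ → L2W d × ScaledL2W d γ s} (hz : (pairEvolution hγ hγd lam s).IsTrajectory T z) :
    (hartreeEvolution hγ hγd lam).IsTrajectory T fun t => pairSum d γ s (z t) :=
  hz.map (pairSum d γ s) (pairSum_pairGroup s) (pairSum_pairEvolution_N hγ hγd lam s)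

end TwoScales

/-! ### Short-time behaviour of the free group -/

section ShortTime

variable {d : ℕ} {γ : ℝ}

theorem norm_phase_sub_one_le (t : ℝ) (ξ : Rd d) :
    ‖phase t ξ - 1‖ ≤ 4 * Real.pi ^ 2 * |t| * ‖ξ‖ ^ 2 := by
  have h : phase t ξ = Complex.exp (Complex.I * ((-(t * (2 * Real.pi * ‖ξ‖) ^ 2) : ℝ) : ℂ)) := by
    rw [phase_apply, Complex.ofReal_neg, mul_neg]
  rw [h]
  refine Real.norm_exp_I_mul_ofReal_sub_one_le.trans_eq ?_
  rw [norm_neg, Real.norm_eq_abs, abs_mul, abs_of_nonneg (sq_nonneg (2 * Real.pi * ‖ξ‖))]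
  ring

theorem hat_sub_ae_eq (f g : Wiener d) :
    (f - g).hat =ᵐ[volume] fun ξ => f.hat ξ - g.hat ξ := by
  have h : (f - g).hat = f.hat - g.hat := map_sub hatIso f g
  rw [h]
  exact Lp.coeFn_sub _ _

theorem hat_wienerMultiplier_phase_sub_ae_eq (t : ℝ) (f : Wiener d) :
    (wienerMultiplier (phase t) f - f).hat =ᵐ[volume] fun ξ => (phase t ξ - 1) * f.hat ξ := by
  have h := hat_wienerMultiplier (phase t) f
  filter_upwards [hat_sub_ae_eq (wienerMultiplier (phase t) f) f,
    coeFn_bddMul (phase t) f.hat] with ξ h1 h2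
  rw [h1, h, h2]
  ring

/-- A pointwise bound of Fourier transforms implies a bound of the norms. -/
theorem scaledNorm_le_of_hat_le {c : ℝ} {p q : L2W d}
    (h : ∀ᵐ ξ, ‖p.1.1.hat ξ‖ ≤ c * ‖q.1.1.hat ξ‖) (s : ℝ) :
    scaledNorm γ s p ≤ c * scaledNorm γ s q := by
  have h1 : ‖p.1.1‖ ≤ c * ‖q.1.1‖ := Lp.norm_le_mul_norm_of_ae_le_mul h
  have h2 : ‖p.1.2‖ ≤ c * ‖q.1.2‖ := by
    rw [← Lp.norm_fourier_eq p.1.2, ← Lp.norm_fourier_eq q.1.2]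
    refine Lp.norm_le_mul_norm_of_ae_le_mul ?_
    filter_upwards [h, L2W.hat_ae_eq p, L2W.hat_ae_eq q] with ξ h3 h4 h5
    rwa [← h4, ← h5]
  by_cases hc : 0 ≤ c
  · rw [scaledNorm, scaledNorm, mul_max_of_nonneg _ _ hc, mul_left_comm, mul_left_comm c]
    exact max_le_max (mul_le_mul_of_nonneg_left h1 (Real.exp_pos _).le)
      (mul_le_mul_of_nonneg_left h2 (Real.exp_pos _).le)
  · -- then all norms vanish
    have h3 : ‖q.1.1‖ = 0 := by
      have := norm_nonneg q.1.1
      nlinarith [norm_nonneg p.1.1]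
    have h4 : ‖q.1.2‖ = 0 := by
      have := norm_nonneg q.1.2
      nlinarith [norm_nonneg p.1.2]
    rw [h3, mul_zero] at h1
    rw [h4, mul_zero] at h2
    rw [scaledNorm, scaledNorm, h3, h4, mul_zero, mul_zero, max_self, mul_zero]
    exact max_le (mul_nonpos_of_nonneg_of_nonpos (Real.exp_pos _).le h1)
      (mul_nonpos_of_nonneg_of_nonpos (Real.exp_pos _).le h2)

/-- The free evolution is Lipschitz in time for data with two derivatives, the size of which is
measured here by comparison with the Fourier transform of some `q`. -/
theorem scaledNorm_freeGroup_sub_le {c : ℝ} {p q : L2W d}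
    (h : ∀ᵐ ξ, ‖ξ‖ ^ 2 * ‖p.1.1.hat ξ‖ ≤ c * ‖q.1.1.hat ξ‖) (s t : ℝ) :
    scaledNorm γ s (freeGroup t p - p) ≤ 4 * Real.pi ^ 2 * |t| * c * scaledNorm γ s q := by
  refine scaledNorm_le_of_hat_le ?_ s
  filter_upwards [h, hat_wienerMultiplier_phase_sub_ae_eq t p.1.1] with ξ h1 h2
  have h3 : (freeGroup t p - p).1.1.hat ξ = (phase t ξ - 1) * p.1.1.hat ξ := h2
  rw [h3, norm_mul]
  calc _ ≤ 4 * Real.pi ^ 2 * |t| * ‖ξ‖ ^ 2 * ‖p.1.1.hat ξ‖ :=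
        mul_le_mul_of_nonneg_right (norm_phase_sub_one_le t ξ) (norm_nonneg _)
    _ = 4 * Real.pi ^ 2 * |t| * (‖ξ‖ ^ 2 * ‖p.1.1.hat ξ‖) := by ring
    _ ≤ 4 * Real.pi ^ 2 * |t| * (c * ‖q.1.1.hat ξ‖) :=
        mul_le_mul_of_nonneg_left h1 (by positivity)
    _ = _ := by ring

/-- The element of `L² ∩ W` which belongs to a square-integrable element of `W`. -/
def l2wOfMemLp (f : Wiener d) (hf : MemLp f.val 2) : L2W d := ⟨(f, hf.toLp), hf.coeFn_toLp.symm⟩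

/-- The element of `L² ∩ W` with a given Schwartz function as its Fourier transform. -/
def l2wOfSchwartzHat (Q : 𝓢(Rd d, ℂ)) : L2W d :=
  l2wOfMemLp (wienerOfHat Q Q.integrable) (by
    rw [val_wienerOfHat, ← SchwartzMap.fourierInv_coe]
    exact (𝓕⁻ Q).memLp 2 volume)

theorem hat_l2wOfSchwartzHat (Q : 𝓢(Rd d, ℂ)) :
    (l2wOfSchwartzHat Q).1.1.hat =ᵐ[volume] Q := hat_wienerOfHat Q Q.integrable

theorem val_l2wOfSchwartzHat (Q : 𝓢(Rd d, ℂ)) :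
    (l2wOfSchwartzHat Q).1.1.val = 𝓕⁻ Q := by
  rw [SchwartzMap.fourierInv_coe]
  exact val_wienerOfHat Q Q.integrable

theorem exists_norm_freeGroup_sub_le (Q : 𝓢(Rd d, ℂ)) :
    ∃ C : ℝ, 0 ≤ C ∧ ∀ t, ‖freeGroup t (l2wOfSchwartzHat Q) - l2wOfSchwartzHat Q‖ ≤ C * |t| := by
  obtain ⟨R, hR⟩ : ∃ R : 𝓢(Rd d, ℂ), ∀ ξ, ‖R ξ‖ = ‖ξ‖ ^ 2 * ‖Q ξ‖ :=
    ⟨SchwartzMap.smulLeftCLM ℂ (fun ξ : Rd d => ‖ξ‖ ^ 2) Q, fun ξ => by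
      rw [SchwartzMap.smulLeftCLM_apply_apply (Function.hasTemperateGrowth_norm_sq _), norm_smul,
        Real.norm_of_nonneg (sq_nonneg _)]⟩
  refine ⟨4 * Real.pi ^ 2 * ‖l2wOfSchwartzHat R‖, by positivity, fun t => ?_⟩
  have h := scaledNorm_freeGroup_sub_le (γ := 0) (c := 1) (p := l2wOfSchwartzHat Q)
    (q := l2wOfSchwartzHat R) (by
      filter_upwards [hat_l2wOfSchwartzHat Q, hat_l2wOfSchwartzHat R] with ξ h1 h2
      rw [h1, h2, hR, one_mul]) 0 t
  rw [scaledNorm_zero, scaledNorm_zero] at h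
  exact h.trans_eq (by ring)

end ShortTime

/-! ### Gaussians in `L² ∩ W` -/

section Gaussian

variable {d : ℕ} {γ : ℝ}

theorem sq_norm_val_wienerGaussian (s : ℝ) (x : Rd d) : ‖(wienerGaussian d s).val x‖ ^ 2
    = Real.exp (-(2 * (Real.pi * Real.exp (-(2 * s)))) * ‖x‖ ^ 2) := by
  rw [val_wienerGaussian, Complex.norm_real, Real.norm_eq_abs, Real.abs_exp, ← Real.exp_nat_mul]
  congr 1
  push_cast
  ring

theorem integrable_sq_norm_wienerGaussian (s : ℝ) :
    Integrable fun x => ‖(wienerGaussian d s).val x‖ ^ 2 := by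
  simp only [sq_norm_val_wienerGaussian]
  exact integrable_gaussian (by positivity)

theorem integral_sq_norm_wienerGaussian_le (s : ℝ) :
    ∫ x, ‖(wienerGaussian d s).val x‖ ^ 2 ≤ Real.exp (d * s) := by
  simp only [sq_norm_val_wienerGaussian]
  rw [integral_gaussian (by positivity)]
  have h1 : Real.pi / (2 * (Real.pi * Real.exp (-(2 * s)))) ≤ Real.exp (2 * s) := by
    rw [div_le_iff₀ (by positivity), Real.exp_neg]
    field_simp
    norm_num
  refine (Real.rpow_le_rpow (by positivity) h1 (by positivity)).trans_eq ?_
  rw [← Real.exp_mul]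
  congr 1
  ring

/-- The Gaussian `e^{-π e^{-2s} |x|²}` of width `e^s`, as an element of `L² ∩ W`. -/
def gaussian (d : ℕ) (s : ℝ) : L2W d :=
  l2wOfMemLp (wienerGaussian d s) ((memLp_two_iff_integrable_sq_norm
    (continuous_val _).aestronglyMeasurable).2 (integrable_sq_norm_wienerGaussian s))

theorem norm_gaussian_snd_le (s : ℝ) : ‖(gaussian d s).1.2‖ ≤ Real.exp (d * s / 2) := by
  have h : ‖(gaussian d s).1.2‖ = (∫ x, ‖(wienerGaussian d s).val x‖ ^ 2) ^ (1 / 2 : ℝ) := by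
    have hm : MemLp (wienerGaussian d s).val 2 := (memLp_two_iff_integrable_sq_norm
      (continuous_val _).aestronglyMeasurable).2 (integrable_sq_norm_wienerGaussian s)
    change ‖hm.toLp‖ = _
    rw [Lp.norm_toLp _ hm, hm.eLpNorm_eq_integral_rpow_norm (by norm_num) (by norm_num),
      ENNReal.toReal_ofReal (by positivity)]
    norm_num
  rw [h]
  refine (Real.rpow_le_rpow (by positivity) (integral_sq_norm_wienerGaussian_le s)
    (by norm_num)).trans_eq ?_
  rw [← Real.exp_mul]
  congr 1
  ring

theorem scaledNorm_gaussian_le {s r : ℝ} (h : r ≤ 2 * s) :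
    scaledNorm γ s (gaussian d r) ≤ Real.exp ((d - γ) * s) := by
  refine max_le ?_ ?_
  · have : ‖(gaussian d r).1.1‖ = 1 := norm_wienerGaussian r
    rw [this, mul_one]
  · refine (mul_le_mul_of_nonneg_left (norm_gaussian_snd_le r) (Real.exp_pos _).le).trans ?_
    rw [← Real.exp_add, Real.exp_le_exp]
    have : (d : ℝ) * r ≤ d * (2 * s) := by gcongr
    linarith

/-- Two derivatives of a wide Gaussian are bounded by a slightly narrower Gaussian, on the side of
the Fourier transforms. -/
theorem sq_norm_mul_gaussianHat_le {r : ℝ} (hr : 0 ≤ r) (ξ : Rd d) :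
    ‖ξ‖ ^ 2 * gaussianHat d r ξ ≤
      Real.exp (d * (Real.log 2 / 2)) * gaussianHat d (r - Real.log 2 / 2) ξ := by
  have h1 : Real.exp (2 * (r - Real.log 2 / 2)) = Real.exp (2 * r) / 2 := by
    rw [mul_sub, mul_div_cancel₀ _ (two_ne_zero), Real.exp_sub, Real.exp_log two_pos]
  have h2 : ‖ξ‖ ^ 2 ≤ Real.exp (Real.pi * (Real.exp (2 * r) / 2) * ‖ξ‖ ^ 2) := by
    have h3 : 1 ≤ Real.exp (2 * r) := Real.one_le_exp (by positivity)
    have h4 : 1 ≤ Real.pi * (Real.exp (2 * r) / 2) := by nlinarith [Real.pi_gt_three]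
    have h5 := Real.add_one_le_exp (Real.pi * (Real.exp (2 * r) / 2) * ‖ξ‖ ^ 2)
    nlinarith [sq_nonneg ‖ξ‖]
  have h6 : gaussianHat d r ξ = Real.exp (-(Real.pi * (Real.exp (2 * r) / 2) * ‖ξ‖ ^ 2)) *
      (Real.exp (d * (Real.log 2 / 2)) * gaussianHat d (r - Real.log 2 / 2) ξ) := by
    rw [gaussianHat, gaussianHat, h1, ← Real.exp_add, ← Real.exp_add, ← Real.exp_add,
      ← Real.exp_add]
    congr 1
    ring
  rw [h6, ← mul_assoc]
  refine mul_le_of_le_one_left (mul_nonneg (Real.exp_pos _).le (gaussianHat_pos _ _).le) ?_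
  rw [Real.exp_neg, ← div_eq_mul_inv]
  exact (div_le_one (Real.exp_pos _)).2 h2

theorem scaledNorm_freeGroup_gaussian_sub_le {s : ℝ} (hs : 0 ≤ s) (t : ℝ) :
    scaledNorm γ s (freeGroup t (gaussian d (2 * s)) - gaussian d (2 * s)) ≤
      4 * Real.pi ^ 2 * |t| * Real.exp (d * (Real.log 2 / 2)) * Real.exp ((d - γ) * s) := by
  have hhat : ∀ r, (gaussian d r).1.1.hat =ᵐ[volume] fun ξ => (gaussianHat d r ξ : ℂ) :=
    fun r => hat_wienerOfHat _ (integrable_gaussianHat r).ofReal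
  refine (scaledNorm_freeGroup_sub_le (q := gaussian d (2 * s - Real.log 2 / 2))
    (c := Real.exp (d * (Real.log 2 / 2))) ?_ s t).trans
    (mul_le_mul_of_nonneg_left (scaledNorm_gaussian_le ?_) (by positivity))
  · filter_upwards [hhat (2 * s), hhat (2 * s - Real.log 2 / 2)] with ξ h1 h2
    rw [h1, h2, Complex.norm_real, Complex.norm_real,
      Real.norm_of_nonneg (gaussianHat_pos _ _).le, Real.norm_of_nonneg (gaussianHat_pos _ _).le]
    exact sq_norm_mul_gaussianHat_le (by positivity) ξ
  · have := Real.log_nonneg (one_le_two (α := ℝ))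
    linarith

end Gaussian

/-! ### Schwartz functions as functionals on the Wiener algebra -/

section TestFunctional

variable {d : ℕ}

/-- Integration against a Schwartz function, as a functional on the Wiener algebra. -/
def testFunctional (η : 𝓢(Rd d, ℂ)) : Wiener d →L[ℂ] ℂ :=
  LinearMap.mkContinuous
    { toFun := fun f => Wiener.toDistribution f η
      map_add' := fun f g => by rw [map_add]; rfl
      map_smul' := fun c f => by rw [map_smul]; rfl } (∫ x, ‖η x‖)
    (fun f => by
      change ‖Wiener.toDistribution f η‖ ≤ _
      rw [Wiener.toDistribution_apply, ← integral_mul_const]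
      refine norm_integral_le_of_norm_le (η.integrable.norm.mul_const _)
        (Eventually.of_forall fun x => ?_)
      rw [norm_mul]
      exact mul_le_mul_of_nonneg_left (norm_val_le f x) (norm_nonneg _))

theorem testFunctional_apply (η : 𝓢(Rd d, ℂ)) (f : Wiener d) :
    testFunctional η f = ∫ x, η x * f.val x := Wiener.toDistribution_apply f η

theorem exists_testFunctional_bound (η : 𝓢(Rd d, ℂ)) :
    ∃ c : ℝ, 0 < c ∧ (∀ f : Wiener d, ‖testFunctional η f‖ ≤ c * ‖f‖) ∧
      ∀ (t : ℝ) (f : Wiener d),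
        ‖testFunctional η (wienerMultiplier (phase t) f) - testFunctional η f‖
          ≤ c * |t| * ‖f‖ := by
  obtain ⟨C, hC0, hC⟩ := (𝓕⁻ η).decay 2 0
  refine ⟨max (‖testFunctional η‖) (4 * Real.pi ^ 2 * C), lt_max_of_lt_right (by positivity),
    fun f => ?_, fun t f => ?_⟩
  · exact (ContinuousLinearMap.le_opNorm _ _).trans
      (mul_le_mul_of_nonneg_right (le_max_left _ _) (norm_nonneg _))
  · have h1 : ∀ g : Wiener d, testFunctional η g = ∫ ξ, (𝓕⁻ η) ξ * g.hat ξ := fun g => by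
      rw [testFunctional_apply, integral_schwartz_mul_hat, FourierTransform.fourier_fourierInv_eq]
    rw [← map_sub, h1, wiener_norm_eq_integral, ← integral_const_mul]
    refine norm_integral_le_of_norm_le (f.integrable_hat.norm.const_mul _) ?_
    filter_upwards [hat_wienerMultiplier_phase_sub_ae_eq t f] with ξ h2
    rw [h2, norm_mul, norm_mul, ← mul_assoc]
    refine mul_le_mul_of_nonneg_right ?_ (norm_nonneg _)
    have h3 : ‖ξ‖ ^ 2 * ‖(𝓕⁻ η) ξ‖ ≤ C := by simpa using hC ξ
    calc _ ≤ ‖(𝓕⁻ η) ξ‖ * (4 * Real.pi ^ 2 * |t| * ‖ξ‖ ^ 2) :=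
          mul_le_mul_of_nonneg_left (norm_phase_sub_one_le t ξ) (norm_nonneg _)
      _ = 4 * Real.pi ^ 2 * |t| * (‖ξ‖ ^ 2 * ‖(𝓕⁻ η) ξ‖) := by ring
      _ ≤ 4 * Real.pi ^ 2 * |t| * C := mul_le_mul_of_nonneg_left h3 (by positivity)
      _ = 4 * Real.pi ^ 2 * C * |t| := by ring
      _ ≤ _ := mul_le_mul_of_nonneg_right (le_max_right _ _) (abs_nonneg _)

end TestFunctional

/-! ### Growth of the Hartree term under small perturbations -/

section Growth

variable {d : ℕ} {γ : ℝ}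

/-- The function `|x|^{-γ} ∗ |p|²`. -/
def rieszFun (γ : ℝ) (p : L2W d) (x : Rd d) : ℝ :=
  ∫ y : Rd d, 1 / ‖y‖ ^ γ * ‖p.1.1.val (x - y)‖ ^ 2

theorem integrable_rieszFun (hγ : 0 < γ) (hγd : γ < d) (p : L2W d) (x : Rd d) :
    Integrable fun y : Rd d => 1 / ‖y‖ ^ γ * ‖p.1.1.val (x - y)‖ ^ 2 :=
  (hartreePotential_self hγ hγd 1 p).1 x

theorem val_hartreePotential_self (hγ : 0 < γ) (hγd : γ < d) (lam : ℝ) (p : L2W d) (x : Rd d) :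
    (hartreePotential d lam γ p p).val x = ((lam * rieszFun γ p x : ℝ) : ℂ) := by
  rw [(hartreePotential_self hγ hγd lam p).2, potential, convolution_def, rieszFun,
    ← integral_const_mul]
  congr 1
  refine integral_congr_ae (Eventually.of_forall fun y => ?_)
  simp only [kernel, ContinuousLinearMap.mul_apply']
  ring

theorem continuous_rieszFun (hγ : 0 < γ) (hγd : γ < d) (p : L2W d) :
    Continuous (rieszFun γ p) := by
  have h : rieszFun γ p = fun x => ((hartreePotential d 1 γ p p).val x).re := by
    funext x
    rw [val_hartreePotential_self hγ hγd, Complex.ofReal_re, one_mul]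
  rw [h]
  exact Complex.continuous_re.comp (continuous_val _)

theorem norm_rieszFun_le (hγ : 0 < γ) (hγd : γ < d) (p : L2W d) (x : Rd d) :
    ‖rieszFun γ p x‖ ≤ ‖hartreePotential d 1 γ p p‖ := by
  have h := norm_val_le (hartreePotential d 1 γ p p) x
  rwa [val_hartreePotential_self hγ hγd, Complex.norm_real, one_mul] at h

theorem rieszFun_nonneg (p : L2W d) (x : Rd d) : 0 ≤ rieszFun γ p x :=
  integral_nonneg fun y => by positivity

/-- The pointwise bound `|a + b|² ≥ |b|²/2 - |a|²`, integrated against the kernel. -/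
theorem rieszFun_add_ge (hγ : 0 < γ) (hγd : γ < d) (p w : L2W d) (x : Rd d) :
    rieszFun γ w x / 2 - rieszFun γ p x ≤ rieszFun γ (p + w) x := by
  have hw := integrable_rieszFun hγ hγd w x
  have hp := integrable_rieszFun hγ hγd p x
  have h := integral_mono ((hw.div_const 2).sub hp) (integrable_rieszFun hγ hγd (p + w) x)
    (fun y => ?_)
  · rwa [integral_sub' (hw.div_const 2) hp, integral_div] at h
  · have h1 : (p + w).1.1.val (x - y) = p.1.1.val (x - y) + w.1.1.val (x - y) :=
      congrFun (Wiener.val_add p.1.1 w.1.1) (x - y)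
    have h2 : ‖w.1.1.val (x - y)‖ ≤ ‖(p + w).1.1.val (x - y)‖ + ‖p.1.1.val (x - y)‖ := by
      have h3 : w.1.1.val (x - y) = (p + w).1.1.val (x - y) - p.1.1.val (x - y) := by
        rw [h1]; ring
      rw [h3]
      exact norm_sub_le _ _
    have h4 : ‖w.1.1.val (x - y)‖ ^ 2 / 2 - ‖p.1.1.val (x - y)‖ ^ 2 ≤
        ‖(p + w).1.1.val (x - y)‖ ^ 2 := by
      have h5 := pow_le_pow_left₀ (norm_nonneg _) h2 2
      nlinarith [sq_nonneg (‖(p + w).1.1.val (x - y)‖ - ‖p.1.1.val (x - y)‖)]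
    have h5 : 0 ≤ 1 / ‖y‖ ^ γ := by positivity
    simp only [Pi.sub_apply]
    rw [mul_div_assoc, ← mul_sub]
    exact mul_le_mul_of_nonneg_left h4 h5

/-- A small multiple of a wide Gaussian generates a potential of size one in a large ball. -/
theorem exists_le_rieszFun_gaussian (hγ : 0 < γ) (hγd : γ < d) :
    ∃ θ : ℝ, 0 < θ ∧ ∀ (a s : ℝ) (x : Rd d), ‖x‖ ≤ Real.exp (2 * s) →
      θ * a ^ 2 ≤
        rieszFun γ (((a * Real.exp (-((d - γ) * s)) : ℝ) : ℂ) • gaussian d (2 * s)) x := by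
  refine ⟨Real.exp (-(Real.pi * 2 ^ 2)) ^ 2 * volume.real (Metric.ball (0 : Rd d) 1), ?_,
    fun a s x hx => ?_⟩
  · have : 0 < volume.real (Metric.ball (0 : Rd d) 1) :=
      ENNReal.toReal_pos (Metric.measure_ball_pos _ _ one_pos).ne' (by finiteness)
    positivity
  · refine le_trans (le_of_eq ?_) (le_integral_kernel_mul hγ hγd (fun _ => sq_nonneg _)
      (integrable_rieszFun hγ hγd _ x) (S := Real.exp (2 * s))
      (A := (|a * Real.exp (-((d - γ) * s))| * Real.exp (-(Real.pi * 2 ^ 2))) ^ 2)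
      (Real.exp_pos _) (sq_nonneg _) fun y hy => ?_)
    · have h1 : Real.exp (-((d - γ) * s)) ^ 2 * Real.exp (2 * s) ^ ((d : ℝ) - γ) = 1 := by
        rw [← Real.exp_mul, ← Real.exp_nat_mul, ← Real.exp_add, Real.exp_eq_one_iff]
        push_cast
        ring
      rw [mul_pow, sq_abs, mul_pow]
      linear_combination (-a ^ 2 * Real.exp (-(Real.pi * 2 ^ 2)) ^ 2 *
        volume.real (Metric.ball (0 : Rd d) 1)) * h1
    · have h1 : ((((a * Real.exp (-((d - γ) * s)) : ℝ) : ℂ)) • gaussian d (2 * s)).1.1.val (x - y)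
          = ((a * Real.exp (-((d - γ) * s)) : ℝ) : ℂ) * (wienerGaussian d (2 * s)).val (x - y) :=
        congrFun (Wiener.val_smul _ (wienerGaussian d (2 * s))) (x - y)
      rw [h1, norm_mul, Complex.norm_real, Real.norm_eq_abs]
      refine pow_le_pow_left₀ (by positivity) ?_ 2
      refine mul_le_mul_of_nonneg_left (exp_le_norm_val_wienerGaussian ?_) (abs_nonneg _)
      exact (norm_sub_le x y).trans (by linarith)

/-- The complex conjugate of a Schwartz function. -/
def conjSchwartz (P : 𝓢(Rd d, ℂ)) : 𝓢(Rd d, ℂ) :=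
  P.postcompCLM (Complex.conjCLE : ℂ →L[ℝ] ℂ)

theorem conjSchwartz_apply (P : 𝓢(Rd d, ℂ)) (x : Rd d) : conjSchwartz P x = conj (P x) := rfl

theorem integrable_sq_norm_mul_rieszFun (hγ : 0 < γ) (hγd : γ < d) (P : 𝓢(Rd d, ℂ)) (p : L2W d) :
    Integrable fun x => ‖P x‖ ^ 2 * rieszFun γ p x :=
  ((P.memLp 2 volume).integrable_norm_pow (by norm_num)).mul_bdd
    (c := ‖hartreePotential d 1 γ p p‖) (continuous_rieszFun hγ hγd p).aestronglyMeasurable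
    (Eventually.of_forall (norm_rieszFun_le hγ hγd p))

/-- The change of the potential, tested with `|p|²`. -/
theorem le_norm_testFunctional_wienerMul (hγ : 0 < γ) (hγd : γ < d) (lam : ℝ) (Q : 𝓢(Rd d, ℂ))
    (w : L2W d) {A X : ℝ} (hw : ∀ x, ‖x‖ ≤ X → A ≤ rieszFun γ w x) :
    |lam| * (A / 2 * (∫ x in Metric.ball (0 : Rd d) X, ‖(𝓕⁻ Q) x‖ ^ 2)
        - 2 * ∫ x, ‖(𝓕⁻ Q) x‖ ^ 2 * rieszFun γ (l2wOfSchwartzHat Q) x) ≤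
      ‖testFunctional (conjSchwartz (𝓕⁻ Q))
        (wienerMul (hartreePotential d lam γ (l2wOfSchwartzHat Q + w) (l2wOfSchwartzHat Q + w)
          - hartreePotential d lam γ (l2wOfSchwartzHat Q) (l2wOfSchwartzHat Q))
          (l2wOfSchwartzHat Q).1.1)‖ := by
  have hval := val_l2wOfSchwartzHat Q
  set P := 𝓕⁻ Q with hP
  set p := l2wOfSchwartzHat Q with hp
  have h1 : testFunctional (conjSchwartz P) (wienerMul (hartreePotential d lam γ (p + w) (p + w)
      - hartreePotential d lam γ p p) p.1.1) =
      ((lam * ∫ x, ‖P x‖ ^ 2 * (rieszFun γ (p + w) x - rieszFun γ p x) : ℝ) : ℂ) := by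
    rw [testFunctional_apply, ← integral_const_mul, ← integral_complex_ofReal]
    refine integral_congr_ae (Eventually.of_forall fun x => ?_)
    simp only
    rw [val_wienerMul, Pi.mul_apply, val_sub, val_hartreePotential_self hγ hγd,
      val_hartreePotential_self hγ hγd, hval, conjSchwartz_apply, mul_left_comm,
      ← Complex.normSq_eq_conj_mul_self, Complex.normSq_eq_norm_sq]
    push_cast
    ring
  have hi := integrable_sq_norm_mul_rieszFun hγ hγd P
  have hi2 : Integrable fun x => ‖P x‖ ^ 2 := (P.memLp 2 volume).integrable_norm_pow (by norm_num)
  have h2 : A / 2 * (∫ x in Metric.ball (0 : Rd d) X, ‖P x‖ ^ 2)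
      ≤ ∫ x, ‖P x‖ ^ 2 * (rieszFun γ w x / 2) := by
    have hi3 : Integrable fun x => ‖P x‖ ^ 2 * (rieszFun γ w x / 2) := by
      simpa only [mul_div_assoc] using (hi w).div_const 2
    rw [← integral_const_mul]
    refine (setIntegral_mono_on (hi2.const_mul _).integrableOn hi3.integrableOn
      Metric.isOpen_ball.measurableSet fun x hx => ?_).trans
      (setIntegral_le_integral hi3 (Eventually.of_forall fun x =>
        mul_nonneg (sq_nonneg _) (div_nonneg (rieszFun_nonneg w x) zero_le_two)))
    rw [mul_comm]
    exact mul_le_mul_of_nonneg_left (div_le_div_of_nonneg_right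
      (hw x (mem_ball_zero_iff.1 hx).le) zero_le_two) (sq_nonneg _)
  have h3 : (∫ x, ‖P x‖ ^ 2 * (rieszFun γ w x / 2)) - 2 * ∫ x, ‖P x‖ ^ 2 * rieszFun γ p x ≤
      ∫ x, ‖P x‖ ^ 2 * (rieszFun γ (p + w) x - rieszFun γ p x) := by
    have hi3 : Integrable fun x => ‖P x‖ ^ 2 * (rieszFun γ w x / 2) := by
      simpa only [mul_div_assoc] using (hi w).div_const 2
    rw [← integral_const_mul, ← integral_sub hi3 ((hi p).const_mul 2)]
    refine integral_mono (hi3.sub ((hi p).const_mul 2)) ?_ fun x => ?_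
    · simp only [mul_sub]
      exact (hi (p + w)).sub (hi p)
    · have := mul_le_mul_of_nonneg_left (rieszFun_add_ge hγ hγd p w x) (sq_nonneg ‖P x‖)
      simp only
      linarith
  rw [h1, Complex.norm_real, Real.norm_eq_abs, abs_mul]
  exact mul_le_mul_of_nonneg_left (((sub_le_sub_right h2 _).trans h3).trans (le_abs_self _))
    (abs_nonneg _)

end Growth

/-! ### Failure of uniform continuity in the Wiener algebra -/

section Instability

variable {d : ℕ} {γ : ℝ}

/-- Schwartz functions are dense in the Wiener algebra. -/
theorem exists_schwartz_norm_sub_lt (f : Wiener d) {r : ℝ} (hr : 0 < r) :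
    ∃ Q : 𝓢(Rd d, ℂ), ‖(l2wOfSchwartzHat Q).1.1 - f‖ < r := by
  obtain ⟨Q, hQ⟩ := (SchwartzMap.denseRange_toLpCLM (F := ℂ) (μ := (volume : Measure (Rd d)))
    ENNReal.one_ne_top).exists_dist_lt f.hat hr
  refine ⟨Q, ?_⟩
  have h : (l2wOfSchwartzHat Q).1.1.hat = SchwartzMap.toLpCLM ℝ ℂ 1 volume Q :=
    Lp.ext ((hat_l2wOfSchwartzHat Q).trans (SchwartzMap.coeFn_toLp Q 1 volume).symm)
  rw [dist_comm, dist_eq_norm, ← h] at hQ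
  have h2 : ((l2wOfSchwartzHat Q).1.1 - f).hat = (l2wOfSchwartzHat Q).1.1.hat - f.hat :=
    map_sub hatIso _ _
  rwa [Wiener.norm_eq, h2]

/-- The nonzero elements of `W` with a Schwartz function as Fourier transform are dense; a nonzero
function has positive mass in a large ball. -/
theorem exists_schwartz_mem_ball (f : Wiener d) {r : ℝ} (hr : 0 < r) :
    ∃ (Q : 𝓢(Rd d, ℂ)) (X : ℝ), ‖(l2wOfSchwartzHat Q).1.1 - f‖ < r ∧
      0 < ∫ x in Metric.ball (0 : Rd d) X, ‖(𝓕⁻ Q) x‖ ^ 2 := by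
  obtain ⟨g, hg0, hg⟩ : ∃ g : Wiener d, g ≠ 0 ∧ ‖g - f‖ < r / 2 := by
    by_cases hf : f = 0
    · refine ⟨((r / 4 : ℝ) : ℂ) • wienerGaussian d 0, ?_, ?_⟩
      · rw [← norm_ne_zero_iff, norm_smul, norm_wienerGaussian, Complex.norm_real, mul_one]
        exact norm_ne_zero_iff.2 (by positivity)
      · rw [hf, sub_zero, norm_smul, norm_wienerGaussian, Complex.norm_real,
          Real.norm_of_nonneg (by positivity)]
        linarith
    · exact ⟨f, hf, by rw [sub_self, norm_zero]; positivity⟩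
  obtain ⟨Q, hQ⟩ := exists_schwartz_norm_sub_lt g (lt_min (half_pos hr) (norm_pos_iff.2 hg0))
  have hQf : ‖(l2wOfSchwartzHat Q).1.1 - f‖ < r := by
    rw [← sub_add_sub_cancel _ g f]
    refine (norm_add_le _ _).trans_lt ?_
    linarith [hQ.trans_le (min_le_left _ _)]
  have hp0 : (l2wOfSchwartzHat Q).1.1 ≠ 0 := by
    intro h
    rw [h, zero_sub, norm_neg] at hQ
    exact (hQ.trans_le (min_le_right _ _)).false
  obtain ⟨x₀, hx₀⟩ : ∃ x, (𝓕⁻ Q) x ≠ 0 := by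
    by_contra! h
    refine hp0 (val_injective (funext fun x => ?_))
    have h0 : (0 : Wiener d).val = 0 := by
      simpa using Wiener.val_smul (0 : ℂ) (0 : Wiener d)
    rw [val_l2wOfSchwartzHat, h, h0, Pi.zero_apply]
  refine ⟨Q, ‖x₀‖ + 1, hQf, ?_⟩
  have hc : Continuous fun x => ‖(𝓕⁻ Q) x‖ ^ 2 := (𝓕⁻ Q).continuous.norm.pow 2
  rw [setIntegral_pos_iff_support_of_nonneg_ae (Eventually.of_forall fun x => sq_nonneg _)
    (((𝓕⁻ Q).memLp 2 volume).integrable_norm_pow (by norm_num)).integrableOn]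
  refine (hc.isOpen_support.inter Metric.isOpen_ball).measure_pos _ ⟨x₀, ?_, ?_⟩
  · exact pow_ne_zero 2 (norm_ne_zero_iff.2 hx₀)
  · rw [mem_ball_zero_iff]
    linarith

theorem norm_pairSum_fst_le (hγd : γ < d) {s : ℝ} (hs : 0 ≤ s) (x : L2W d × ScaledL2W d γ s) :
    ‖(pairSum d γ s x).1.1‖ ≤ 2 * ‖x‖ := by
  have h1 : ‖x.1.1.1‖ ≤ ‖x‖ := (le_max_left _ _).trans (norm_fst_le x)
  have h2 : ‖(unscale d γ s x.2).1.1‖ ≤ ‖x‖ := by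
    refine le_trans ?_ (norm_snd_le x)
    rw [norm_scaledL2W]
    refine le_trans ?_ (le_max_left _ _)
    exact le_mul_of_one_le_left (norm_nonneg _)
      (Real.one_le_exp (mul_nonneg (sub_nonneg.2 hγd.le) hs))
  have h3 : (pairSum d γ s x).1.1 = x.1.1.1 + (unscale d γ s x.2).1.1 := rfl
  rw [h3, two_mul]
  exact (norm_add_le _ _).trans (add_le_add h1 h2)

/-- The expansion of tested trajectories of pairs, with constants which do not depend on the scale
of the second component. -/
theorem norm_testFunctional_pairSum_le (hγ : 0 < γ) (hγd : γ < d) {lam s T R b c : ℝ} (hs : 0 ≤ s)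
    {η : 𝓢(Rd d, ℂ)} (hη : ∀ f : Wiener d, ‖testFunctional η f‖ ≤ b * ‖f‖)
    (hη' : ∀ (t : ℝ) (f : Wiener d),
      ‖testFunctional η (wienerMultiplier (phase t) f) - testFunctional η f‖ ≤ b * |t| * ‖f‖)
    (hb : 0 ≤ b) (hbc : 2 * b ≤ c) {z : ℝ → L2W d × ScaledL2W d γ s}
    (hz : (pairEvolution hγ hγd lam s).IsTrajectory T z) (hR : ∀ t, ‖z t‖ ≤ R)
    (h0 : ∀ t, 0 ≤ t → ‖pairGroup d γ s t (z 0) - z 0‖ ≤ c * t) {t : ℝ} (ht : t ∈ Icc 0 T) :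
    ‖testFunctional η (pairSum d γ s (z t)).1.1 - testFunctional η (pairSum d γ s (z 0)).1.1
        + Complex.I * t * testFunctional η (hartreeTerm lam γ (pairSum d γ s (z 0))).1.1‖ ≤
      c * (4 * potentialBound d lam γ * R ^ 3 + 3 * (4 * potentialBound d lam γ) * R ^ 2 *
        (4 * potentialBound d lam γ * R ^ 3 + c)) * t ^ 2 := by
  have hL : ∀ x : L2W d × ScaledL2W d γ s,
      ‖testFunctional η (pairSum d γ s x).1.1‖ ≤ c * ‖x‖ := fun x =>
    (hη _).trans ((mul_le_mul_of_nonneg_left (norm_pairSum_fst_le hγd hs x) hb).trans (by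
      rw [← mul_assoc, mul_comm b]
      exact mul_le_mul_of_nonneg_right hbc (norm_nonneg _)))
  have hLT : ∀ t, ∀ x : L2W d × ScaledL2W d γ s,
      ‖testFunctional η (pairSum d γ s (pairGroup d γ s t x)).1.1 -
        testFunctional η (pairSum d γ s x).1.1‖ ≤ c * |t| * ‖x‖ := fun t x => by
    rw [pairSum_pairGroup]
    refine (hη' t _).trans ((mul_le_mul_of_nonneg_left (norm_pairSum_fst_le hγd hs x)
      (mul_nonneg hb (abs_nonneg t))).trans ?_)
    rw [mul_left_comm, ← mul_assoc, ← mul_assoc]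
    exact mul_le_mul_of_nonneg_right (mul_le_mul_of_nonneg_right hbc (abs_nonneg _))
      (norm_nonneg _)
  have h := hz.norm_functional_le (L := (testFunctional η).comp ((L2W.toWiener d).comp
    (pairSum d γ s))) (fun t _ => hR t) hL hLT h0 (by linarith) ht
  have hN := congrArg (fun q : L2W d => testFunctional η q.1.1)
    (pairSum_pairEvolution_N hγ hγd lam s (z 0))
  rw [← hN]
  exact h

/-- The change of the Hartree term under a perturbation `w` of the datum, tested with the datum. -/
theorem le_norm_testFunctional_hartreeTerm_sub (hγ : 0 < γ) (hγd : γ < d) (lam : ℝ)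
    (Q : 𝓢(Rd d, ℂ)) (w : L2W d) {A X b H κ : ℝ} (hw : ∀ x, ‖x‖ ≤ X → A ≤ rieszFun γ w x)
    (hb : ∀ f : Wiener d, ‖testFunctional (conjSchwartz (𝓕⁻ Q)) f‖ ≤ b * ‖f‖) (hb0 : 0 ≤ b)
    (hH : ‖hartreePotential d lam γ (l2wOfSchwartzHat Q + w) (l2wOfSchwartzHat Q + w)‖ ≤ H)
    (hκ : κ ≤ A / 2 * (∫ x in Metric.ball (0 : Rd d) X, ‖(𝓕⁻ Q) x‖ ^ 2)
        - 2 * ∫ x, ‖(𝓕⁻ Q) x‖ ^ 2 * rieszFun γ (l2wOfSchwartzHat Q) x) :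
    |lam| * κ - b * (H * ‖w.1.1‖) ≤
      ‖testFunctional (conjSchwartz (𝓕⁻ Q)) (hartreeTerm lam γ (l2wOfSchwartzHat Q + w)).1.1
        - testFunctional (conjSchwartz (𝓕⁻ Q)) (hartreeTerm lam γ (l2wOfSchwartzHat Q)).1.1‖ := by
  have h1 := (mul_le_mul_of_nonneg_left hκ (abs_nonneg lam)).trans
    (le_norm_testFunctional_wienerMul hγ hγd lam Q w hw)
  set p := l2wOfSchwartzHat Q
  set ℓ := testFunctional (conjSchwartz (𝓕⁻ Q))
  set V := hartreePotential d lam γ (p + w) (p + w)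
  have h2 : ‖ℓ (wienerMul V w.1.1)‖ ≤ b * (H * ‖w.1.1‖) :=
    (hb _).trans (mul_le_mul_of_nonneg_left ((norm_wienerMul_le _ _).trans
      (mul_le_mul_of_nonneg_right hH (norm_nonneg _))) hb0)
  have h3 : (hartreeTerm lam γ (p + w)).1.1 - (hartreeTerm lam γ p).1.1
      = wienerMul (V - hartreePotential d lam γ p p) p.1.1 + wienerMul V w.1.1 := by
    have h4 : (hartreeTerm lam γ (p + w)).1.1 = wienerMul V (p.1.1 + w.1.1) := rfl
    have h5 : (hartreeTerm lam γ p).1.1 = wienerMul (hartreePotential d lam γ p p) p.1.1 := rfl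
    rw [h4, h5, map_add, map_sub, sub_apply]
    abel
  rw [← map_sub, h3, map_add]
  have h6 := norm_sub_le (ℓ (wienerMul (V - hartreePotential d lam γ p p) p.1.1)
    + ℓ (wienerMul V w.1.1)) (ℓ (wienerMul V w.1.1))
  rw [add_sub_cancel_right] at h6
  linarith

/-- A function with a second-order expansion at time zero moves at a definite speed. -/
theorem le_norm_of_expansion {f₁ f₂ f₁₀ f₂₀ a₁ a₂ : ℂ} {C t μ : ℝ} (ht : 0 ≤ t)
    (h₁ : ‖f₁ - f₁₀ + Complex.I * t * a₁‖ ≤ C * t ^ 2)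
    (h₂ : ‖f₂ - f₂₀ + Complex.I * t * a₂‖ ≤ C * t ^ 2) (ha : μ ≤ ‖a₁ - a₂‖)
    (hC : 2 * C * t ≤ μ / 2) (h0 : ‖f₁₀ - f₂₀‖ ≤ μ * t / 4) :
    μ * t / 4 ≤ ‖f₁ - f₂‖ := by
  have h3 : Complex.I * t * (a₁ - a₂) = (f₁ - f₁₀ + Complex.I * t * a₁)
      - (f₂ - f₂₀ + Complex.I * t * a₂) + (f₁₀ - f₂₀) - (f₁ - f₂) := by ring
  have h4 : ‖Complex.I * t * (a₁ - a₂)‖ = t * ‖a₁ - a₂‖ := by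
    rw [norm_mul, norm_mul, Complex.norm_I, one_mul, Complex.norm_real, Real.norm_of_nonneg ht]
  have h5 : t * ‖a₁ - a₂‖ ≤ C * t ^ 2 + C * t ^ 2 + μ * t / 4 + ‖f₁ - f₂‖ := by
    rw [← h4, h3]
    refine (norm_sub_le _ _).trans (add_le_add ((norm_add_le _ _).trans
      (add_le_add ((norm_sub_le _ _).trans (add_le_add h₁ h₂)) h0)) le_rfl)
  nlinarith [mul_le_mul_of_nonneg_left ha ht, mul_le_mul_of_nonneg_left hC ht]

/-- The small wide perturbation of width `e^{2s}` and size `α e^{-(d-γ)s}` in the Wiener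
algebra. -/
def perturbation (d : ℕ) (γ α s : ℝ) : L2W d :=
  ((α * Real.exp (-((d - γ) * s)) : ℝ) : ℂ) • gaussian d (2 * s)

theorem norm_perturbation_fst {α : ℝ} (hα : 0 ≤ α) (s : ℝ) :
    ‖(perturbation d γ α s).1.1‖ = α * Real.exp (-((d - γ) * s)) := by
  have h : (perturbation d γ α s).1.1 =
    ((α * Real.exp (-((d - γ) * s)) : ℝ) : ℂ) • wienerGaussian d (2 * s) := rfl
  rw [h, norm_smul, norm_wienerGaussian, mul_one, Complex.norm_real,
    Real.norm_of_nonneg (by positivity)]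

theorem scaledNorm_perturbation_le {α : ℝ} (hα : 0 ≤ α) (s : ℝ) :
    scaledNorm γ s (perturbation d γ α s) ≤ α := by
  rw [perturbation, scaledNorm_smul, Complex.norm_real, Real.norm_of_nonneg (by positivity)]
  refine (mul_le_mul_of_nonneg_left (scaledNorm_gaussian_le le_rfl) (by positivity)).trans_eq ?_
  rw [mul_assoc, ← Real.exp_add, neg_add_cancel, Real.exp_zero, mul_one]

theorem scaledNorm_freeGroup_perturbation_sub_le {α s : ℝ} (hα : 0 ≤ α) (hs : 0 ≤ s) (t : ℝ) :
    scaledNorm γ s (freeGroup t (perturbation d γ α s) - perturbation d γ α s) ≤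
      4 * Real.pi ^ 2 * Real.exp (d * (Real.log 2 / 2)) * α * |t| := by
  have h : freeGroup t (perturbation d γ α s) - perturbation d γ α s =
      ((α * Real.exp (-((d - γ) * s)) : ℝ) : ℂ) •
        (freeGroup t (gaussian d (2 * s)) - gaussian d (2 * s)) := by
    rw [perturbation, map_smul, smul_sub]
  rw [h, scaledNorm_smul, Complex.norm_real, Real.norm_of_nonneg (by positivity)]
  refine (mul_le_mul_of_nonneg_left (scaledNorm_freeGroup_gaussian_sub_le hs t)
    (by positivity)).trans_eq ?_
  have h2 : Real.exp (-((d - γ) * s)) * Real.exp ((d - γ) * s) = 1 := by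
    rw [← Real.exp_add, neg_add_cancel, Real.exp_zero]
  linear_combination (α * (4 * Real.pi ^ 2 * |t| * Real.exp (d * (Real.log 2 / 2)))) * h2

theorem exists_scale (hγd : γ < d) (α X : ℝ) {ρ : ℝ} (hρ : 0 < ρ) :
    ∃ s : ℝ, 0 ≤ s ∧ X ≤ Real.exp (2 * s) ∧ α * Real.exp (-((d - γ) * s)) < ρ := by
  have h1 : Tendsto (fun s : ℝ => α * Real.exp (-((d - γ) * s))) atTop (𝓝 (α * 0)) :=
    (Real.tendsto_exp_neg_atTop_nhds_zero.comp
      (tendsto_id.const_mul_atTop (sub_pos.2 hγd))).const_mul α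
  rw [mul_zero] at h1
  have h2 : Tendsto (fun s : ℝ => Real.exp (2 * s)) atTop atTop :=
    Real.tendsto_exp_atTop.comp (tendsto_id.const_mul_atTop two_pos)
  obtain ⟨s, hs⟩ := ((eventually_ge_atTop 0).and
    ((h2.eventually_ge_atTop X).and (h1.eventually_lt_const hρ))).exists
  exact ⟨s, hs.1, hs.2.1, hs.2.2⟩

theorem norm_pairGroup_sub_le {s c t : ℝ} {x : L2W d × ScaledL2W d γ s}
    (h₁ : ‖freeGroup t x.1 - x.1‖ ≤ c)
    (h₂ : scaledNorm γ s (freeGroup t (unscale d γ s x.2) - unscale d γ s x.2) ≤ c) :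
    ‖pairGroup d γ s t x - x‖ ≤ c := by
  rw [norm_pair, scaledNorm_zero]
  exact max_le h₁ h₂

/-- Trajectories with data `p + w`, where the size of `w` is measured by `scaledNorm γ s`: their
life span and their expansion at time zero are controlled independently of `s`. -/
theorem exists_isTrajectory_expansion (hγ : 0 < γ) (hγd : γ < d) {lam s T R b c : ℝ} (hs : 0 ≤ s)
    {η : 𝓢(Rd d, ℂ)} (hη : ∀ f : Wiener d, ‖testFunctional η f‖ ≤ b * ‖f‖)
    (hη' : ∀ (t : ℝ) (f : Wiener d),
      ‖testFunctional η (wienerMultiplier (phase t) f) - testFunctional η f‖ ≤ b * |t| * ‖f‖)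
    (hb : 0 ≤ b) (hbc : 2 * b ≤ c) {p w : L2W d} (hp : ‖p‖ ≤ R) (hw : scaledNorm γ s w ≤ R)
    (hpt : ∀ t, 0 ≤ t → ‖freeGroup t p - p‖ ≤ c * t)
    (hwt : ∀ t, 0 ≤ t → scaledNorm γ s (freeGroup t w - w) ≤ c * t) (hT : 0 ≤ T)
    (hTR : T ≤ CubicEvolution.lifespan (4 * potentialBound d lam γ) R) :
    ∃ z : ℝ → L2W d, z 0 = p + w ∧ (hartreeEvolution hγ hγd lam).IsTrajectory T z ∧
      ∀ t ∈ Icc 0 T,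
        ‖testFunctional η (z t).1.1 - testFunctional η (p + w).1.1
            + Complex.I * t * testFunctional η (hartreeTerm lam γ (p + w)).1.1‖ ≤
          c * (4 * potentialBound d lam γ * (2 * R) ^ 3 +
            3 * (4 * potentialBound d lam γ) * (2 * R) ^ 2 *
              (4 * potentialBound d lam γ * (2 * R) ^ 3 + c)) * t ^ 2 := by
  have hx : ‖((p, (unscale d γ s).symm w) : L2W d × ScaledL2W d γ s)‖ ≤ R := by
    rw [norm_pair, scaledNorm_zero]
    exact max_le hp hw
  obtain ⟨z, hz0, hz, hzR⟩ := (pairEvolution hγ hγd lam s).exists_isTrajectory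
    ((norm_nonneg p).trans hp) hT hTR hx
  have hσ : pairSum d γ s (z 0) = p + w := by rw [hz0]; rfl
  refine ⟨fun t => pairSum d γ s (z t), hσ, isTrajectory_pairSum hz, fun t ht => ?_⟩
  have h := norm_testFunctional_pairSum_le hγ hγd hs hη hη' hb hbc hz hzR (fun t ht => by
    rw [hz0]
    exact norm_pairGroup_sub_le (hpt t ht) (hwt t ht)) ht
  rw [hσ] at h
  exact h

/-- The distance of two solutions in the Wiener algebra, from below by the distance of the tested
trajectories. -/
theorem norm_testFunctional_sub_le_orbit {hγ : 0 < γ} {hγd : γ < d} {lam T b : ℝ} {η : 𝓢(Rd d, ℂ)}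
    (hη : ∀ f : Wiener d, ‖testFunctional η f‖ ≤ b * ‖f‖) (hb : 0 ≤ b) {z w : ℝ → L2W d}
    (hz : (hartreeEvolution hγ hγd lam).IsTrajectory T z)
    (hw : (hartreeEvolution hγ hγd lam).IsTrajectory T w) (t : Icc (0 : ℝ) T) :
    ‖testFunctional η (z t).1.1 - testFunctional η (w t).1.1‖ ≤
      b * ‖L2W.toWiener d (CubicEvolution.orbit hz t) -
        L2W.toWiener d (CubicEvolution.orbit hw t)‖ := by
  have h1 : freeGroup (-t) (freeGroup t (z t - w t)) = z t - w t :=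
    (hartreeEvolution hγ hγd lam).T_neg_T t _
  have h2 : ‖(z t - w t).1.1‖ ≤ ‖(freeGroup (t : ℝ) (z t - w t)).1.1‖ := by
    conv_lhs => rw [← h1]
    exact norm_freeGroup_fst_le _ _
  rw [map_sub] at h2
  rw [← map_sub]
  exact (hη _).trans (mul_le_mul_of_nonneg_left h2 hb)

/-- The size `α` of the perturbation can be chosen such that, at sufficiently large scales, it
changes the tested Hartree term by at least `|lam|`. -/
theorem exists_growth (hγ : 0 < γ) (hγd : γ < d) {lam : ℝ} (hlam : lam ≠ 0) {Q : 𝓢(Rd d, ℂ)}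
    {X b : ℝ} (hm : 0 < ∫ x in Metric.ball (0 : Rd d) X, ‖(𝓕⁻ Q) x‖ ^ 2)
    (hb : ∀ f : Wiener d, ‖testFunctional (conjSchwartz (𝓕⁻ Q)) f‖ ≤ b * ‖f‖) (hb0 : 0 < b) :
    ∃ α ρ : ℝ, 0 ≤ α ∧ 0 < ρ ∧ ∀ s, X ≤ Real.exp (2 * s) →
      ‖(perturbation d γ α s).1.1‖ < ρ → |lam| ≤
        ‖testFunctional (conjSchwartz (𝓕⁻ Q))
            (hartreeTerm lam γ (l2wOfSchwartzHat Q + perturbation d γ α s)).1.1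
          - testFunctional (conjSchwartz (𝓕⁻ Q)) (hartreeTerm lam γ (l2wOfSchwartzHat Q)).1.1‖ := by
  obtain ⟨m, hm_def⟩ : ∃ m, m = ∫ x in Metric.ball (0 : Rd d) X, ‖(𝓕⁻ Q) x‖ ^ 2 := ⟨_, rfl⟩
  obtain ⟨κ, hκ_def⟩ : ∃ κ, κ = ∫ x, ‖(𝓕⁻ Q) x‖ ^ 2 * rieszFun γ (l2wOfSchwartzHat Q) x :=
    ⟨_, rfl⟩
  have hκ : 0 ≤ κ := by
    rw [hκ_def]
    exact integral_nonneg fun x => mul_nonneg (sq_nonneg _) (rieszFun_nonneg _ _)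
  rw [← hm_def] at hm
  obtain ⟨θ, hθ0, hθ⟩ := exists_le_rieszFun_gaussian hγ hγd
  -- the potential of the perturbation dominates that of the datum where the datum lives
  obtain ⟨α, hα0, hα⟩ : ∃ α : ℝ, 0 ≤ α ∧ 2 ≤ θ * α ^ 2 / 2 * m - 2 * κ := by
    refine ⟨Real.sqrt ((2 + 2 * κ) * 2 / (θ * m)), Real.sqrt_nonneg _, le_of_eq ?_⟩
    rw [Real.sq_sqrt (by positivity)]
    field_simp
    ring
  rw [hm_def, hκ_def] at hα
  obtain ⟨M, hM⟩ : ∃ M, M = 4 * potentialBound d lam γ := ⟨_, rfl⟩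
  have hM0 : 0 ≤ M := by
    rw [hM]
    exact mul_nonneg (by norm_num) (potentialBound_nonneg hγ hγd lam)
  obtain ⟨R, hR⟩ : ∃ R, R = max ‖l2wOfSchwartzHat Q‖ α := ⟨_, rfl⟩
  refine ⟨α, |lam| / (b * (M * R ^ 2 + 1)), hα0, div_pos (abs_pos.2 hlam) (by positivity),
    fun s hsX hs => ?_⟩
  rw [lt_div_iff₀ (by positivity)] at hs
  have hxR : ‖((l2wOfSchwartzHat Q, (unscale d γ s).symm (perturbation d γ α s)) :
      L2W d × ScaledL2W d γ s)‖ ≤ R := by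
    rw [norm_pair, scaledNorm_zero, hR]
    exact max_le_max le_rfl (scaledNorm_perturbation_le hα0 s)
  have hH : ‖hartreePotential d lam γ (l2wOfSchwartzHat Q + perturbation d γ α s)
      (l2wOfSchwartzHat Q + perturbation d γ α s)‖ ≤ M * R ^ 2 := by
    refine (norm_hartreePotential_pairSum_le hγ hγd lam s
      (l2wOfSchwartzHat Q, (unscale d γ s).symm (perturbation d γ α s))
      (l2wOfSchwartzHat Q, (unscale d γ s).symm (perturbation d γ α s))).trans ?_
    rw [← hM, sq]
    exact mul_le_mul_of_nonneg_left
      (mul_le_mul hxR hxR (norm_nonneg _) ((norm_nonneg _).trans hxR)) hM0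
  refine le_trans ?_ (le_norm_testFunctional_hartreeTerm_sub hγ hγd lam Q (perturbation d γ α s)
    (fun x hx => hθ α s x (hx.trans hsX)) hb hb0.le hH hα)
  nlinarith [norm_nonneg (perturbation d γ α s).1.1]

/-- Two solutions with data `p + w` and `p` separate at a speed which is controlled from below by
the tested difference of the Hartree terms. -/
theorem exists_solutions_separating (hγ : 0 < γ) (hγd : γ < d) {lam s T R b c t μ : ℝ}
    (hs : 0 ≤ s) {η : 𝓢(Rd d, ℂ)} (hη : ∀ f : Wiener d, ‖testFunctional η f‖ ≤ b * ‖f‖)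
    (hη' : ∀ (t : ℝ) (f : Wiener d),
      ‖testFunctional η (wienerMultiplier (phase t) f) - testFunctional η f‖ ≤ b * |t| * ‖f‖)
    (hb : 0 < b) (hbc : 2 * b ≤ c) {p w : L2W d} (hp : ‖p‖ ≤ R) (hw : scaledNorm γ s w ≤ R)
    (hpt : ∀ t, 0 ≤ t → ‖freeGroup t p - p‖ ≤ c * t)
    (hwt : ∀ t, 0 ≤ t → scaledNorm γ s (freeGroup t w - w) ≤ c * t)
    (hTR : T ≤ CubicEvolution.lifespan (4 * potentialBound d lam γ) R) (ht : t ∈ Icc 0 T)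
    (hμ : μ ≤ ‖testFunctional η (hartreeTerm lam γ (p + w)).1.1
      - testFunctional η (hartreeTerm lam γ p).1.1‖)
    (htμ : 2 * (c * (4 * potentialBound d lam γ * (2 * R) ^ 3 +
      3 * (4 * potentialBound d lam γ) * (2 * R) ^ 2 *
        (4 * potentialBound d lam γ * (2 * R) ^ 3 + c))) * t ≤ μ / 2)
    (hwμ : b * ‖w.1.1‖ ≤ μ * t / 4) :
    ∃ u v : C(Icc (0 : ℝ) T, L2W d),
      IsSolution (kernel d lam γ) T (L2W.toWiener d (p + w)) (fun t => L2W.toWiener d (u t)) ∧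
      IsSolution (kernel d lam γ) T (L2W.toWiener d p) (fun t => L2W.toWiener d (v t)) ∧
      μ * t / 4 / b ≤ ‖L2W.toWiener d (u ⟨t, ht⟩) - L2W.toWiener d (v ⟨t, ht⟩)‖ := by
  have hT : 0 ≤ T := ht.1.trans ht.2
  have h00 : scaledNorm γ s (0 : L2W d) = 0 := by
    rw [← zero_smul ℂ p, scaledNorm_smul, norm_zero, zero_mul]
  obtain ⟨z₁, hz₁0, hz₁, hE₁⟩ := exists_isTrajectory_expansion hγ hγd hs hη hη' hb.le hbc hp hw
    hpt hwt hT hTR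
  obtain ⟨z₂, hz₂0, hz₂, hE₂⟩ := exists_isTrajectory_expansion (w := 0) hγ hγd hs hη hη' hb.le
    hbc hp (h00.trans_le ((norm_nonneg p).trans hp)) hpt
    (fun t ht => by
      rw [map_zero, sub_zero, h00]
      exact mul_nonneg (by linarith) ht) hT hTR
  rw [add_zero] at hz₂0 hE₂
  have h0 : ‖testFunctional η (p + w).1.1 - testFunctional η p.1.1‖ ≤ μ * t / 4 := by
    have h1 : (p + w).1.1 - p.1.1 = w.1.1 := add_sub_cancel_left p.1.1 w.1.1
    rw [← map_sub, h1]
    exact (hη _).trans hwμ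
  refine ⟨CubicEvolution.orbit hz₁, CubicEvolution.orbit hz₂, ?_, ?_, ?_⟩
  · rw [← hz₁0]
    exact isSolution_of_isTrajectory hγ hγd hz₁
  · rw [← hz₂0]
    exact isSolution_of_isTrajectory hγ hγd hz₂
  · rw [div_le_iff₀' hb]
    exact (le_norm_of_expansion ht.1 (hE₁ t ht) (hE₂ t ht) hμ htμ h0).trans
      (norm_testFunctional_sub_le_orbit hη hb.le hz₁ hz₂ ⟨t, ht⟩)

set_option maxHeartbeats 1000000 in
/-- On short time intervals, the solutions with data in a ball of the Wiener algebra do not depend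
uniformly continuously on the data. -/
theorem exists_instability (hγ : 0 < γ) (hγd : γ < d) {lam : ℝ} (hlam : lam ≠ 0) (c : Wiener d)
    {r : ℝ} (hr : 0 < r) :
    ∃ T₀ : ℝ, 0 < T₀ ∧ ∀ T : ℝ, 0 < T → T ≤ T₀ → ∃ ε : ℝ, 0 < ε ∧ ∀ δ : ℝ, 0 < δ →
      ∃ (φ₁ φ₂ : L2W d) (u₁ u₂ : C(Icc (0 : ℝ) T, L2W d)),
        L2W.toWiener d φ₁ ∈ Metric.ball c r ∧ L2W.toWiener d φ₂ ∈ Metric.ball c r ∧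
        IsSolution (kernel d lam γ) T (L2W.toWiener d φ₁) (fun t => L2W.toWiener d (u₁ t)) ∧
        IsSolution (kernel d lam γ) T (L2W.toWiener d φ₂) (fun t => L2W.toWiener d (u₂ t)) ∧
        ‖L2W.toWiener d φ₁ - L2W.toWiener d φ₂‖ < δ ∧
        ∃ t : Icc (0 : ℝ) T, ε ≤ ‖L2W.toWiener d (u₁ t) - L2W.toWiener d (u₂ t)‖ := by
  have hlam' : 0 < |lam| := abs_pos.2 hlam
  obtain ⟨Q, X, hQ, hm⟩ := exists_schwartz_mem_ball c hr
  obtain ⟨b, hb0, hb, hb'⟩ := exists_testFunctional_bound (conjSchwartz (𝓕⁻ Q))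
  obtain ⟨Cp, hCp0, hCp⟩ := exists_norm_freeGroup_sub_le Q
  obtain ⟨α, ρ, hα0, hρ0, hgrow⟩ := exists_growth hγ hγd hlam hm hb hb0
  obtain ⟨R, hpR, hαR⟩ : ∃ R, ‖l2wOfSchwartzHat Q‖ ≤ R ∧ α ≤ R :=
    ⟨_, le_max_left _ _, le_max_right _ _⟩
  obtain ⟨q, hq1, hq2, hq3⟩ : ∃ q, 2 * b ≤ q ∧ Cp ≤ q ∧
      4 * Real.pi ^ 2 * Real.exp (d * (Real.log 2 / 2)) * α ≤ q :=
    ⟨max (2 * b) (max Cp (4 * Real.pi ^ 2 * Real.exp (d * (Real.log 2 / 2)) * α)),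
      le_max_left _ _, (le_max_left _ _).trans (le_max_right _ _),
      (le_max_right _ _).trans (le_max_right _ _)⟩
  have hM0 : 0 ≤ 4 * potentialBound d lam γ :=
    mul_nonneg (by norm_num) (potentialBound_nonneg hγ hγd lam)
  obtain ⟨C, hC⟩ : ∃ C, C = q * (4 * potentialBound d lam γ * (2 * R) ^ 3 +
      3 * (4 * potentialBound d lam γ) * (2 * R) ^ 2 *
        (4 * potentialBound d lam γ * (2 * R) ^ 3 + q)) := ⟨_, rfl⟩
  have hC0 : 0 ≤ C := by
    have hR0 : 0 ≤ R := hα0.trans hαR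
    have hq0 : 0 ≤ q := hCp0.trans hq2
    rw [hC]
    positivity
  refine ⟨CubicEvolution.lifespan (4 * potentialBound d lam γ) R,
    CubicEvolution.lifespan_pos hM0, fun T hT hTR => ?_⟩
  obtain ⟨t, ht0, htT, hCt⟩ : ∃ t, 0 < t ∧ t ≤ T ∧ 2 * C * t ≤ |lam| / 2 := by
    refine ⟨min T (|lam| / (4 * C + 1)), lt_min hT (by positivity), min_le_left _ _, ?_⟩
    have h1 : min T (|lam| / (4 * C + 1)) * (4 * C + 1) ≤ |lam| := by
      rw [← le_div_iff₀ (by positivity)]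
      exact min_le_right _ _
    have h2 : 0 < min T (|lam| / (4 * C + 1)) := lt_min hT (by positivity)
    nlinarith
  refine ⟨|lam| * t / 4 / b, by positivity, fun δ hδ => ?_⟩
  obtain ⟨s, hs0, hsX, hs⟩ := exists_scale hγd α X
    (ρ := min (min δ (r - ‖(l2wOfSchwartzHat Q).1.1 - c‖)) (min (|lam| * t / 4 / b) ρ))
    (lt_min (lt_min hδ (sub_pos.2 hQ)) (lt_min (by positivity) hρ0))
  rw [← norm_perturbation_fst (d := d) (γ := γ) hα0 s, lt_min_iff, lt_min_iff, lt_min_iff,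
    lt_div_iff₀' hb0] at hs
  obtain ⟨⟨hs1, hs2⟩, hs3, hs4⟩ := hs
  rw [hC] at hCt
  obtain ⟨u, v, hu, hv, huv⟩ := exists_solutions_separating hγ hγd hs0 hb hb' hb0 hq1 hpR
    ((scaledNorm_perturbation_le hα0 s).trans hαR)
    (fun t ht => (hCp t).trans (by
      rw [abs_of_nonneg ht]
      exact mul_le_mul_of_nonneg_right hq2 ht))
    (fun t ht => (scaledNorm_freeGroup_perturbation_sub_le hα0 hs0 t).trans (by
      rw [abs_of_nonneg ht]
      exact mul_le_mul_of_nonneg_right hq3 ht)) hTR ⟨ht0.le, htT⟩ (hgrow s hsX hs4) hCt hs3.le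
  have h1 : L2W.toWiener d (l2wOfSchwartzHat Q + perturbation d γ α s) ∈ Metric.ball c r := by
    rw [mem_ball_iff_norm, map_add, add_sub_right_comm]
    exact (norm_add_le _ _).trans_lt (add_lt_of_lt_sub_left hs2)
  have h2 : L2W.toWiener d (l2wOfSchwartzHat Q) ∈ Metric.ball c r := mem_ball_iff_norm.2 hQ
  have h3 : ‖L2W.toWiener d (l2wOfSchwartzHat Q + perturbation d γ α s) -
      L2W.toWiener d (l2wOfSchwartzHat Q)‖ < δ := by
    rw [map_add, add_sub_cancel_left]
    exact hs1
  exact ⟨l2wOfSchwartzHat Q + perturbation d γ α s, l2wOfSchwartzHat Q, u, v, h1, h2, hu, hv, h3,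
    ⟨t, ht0.le, htT⟩, huv⟩

end Instability

end

end Hartree

theorem theorem1p3 (d : ℕ) (hd : 1 ≤ d) (lam γ : ℝ) (hγ : 0 < γ) (hγd : γ < d) :
    -- local well-posedness in `L² ∩ W`, with uniqueness among all solutions in `C([0,T]; L² ∩ W)`
    Hartree.LocallyWellPosed (Hartree.kernel d lam γ) (Hartree.L2W.toWiener d) ∧
    (∀ T : ℝ, 0 < T → ∀ φ : Hartree.L2W d, ∀ u v : C(Set.Icc (0 : ℝ) T, Hartree.L2W d),
      Hartree.IsSolution (Hartree.kernel d lam γ) T (Hartree.L2W.toWiener d φ)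
        (fun t => Hartree.L2W.toWiener d (u t)) →
      Hartree.IsSolution (Hartree.kernel d lam γ) T (Hartree.L2W.toWiener d φ)
        (fun t => Hartree.L2W.toWiener d (v t)) → u = v) ∧
    (lam ≠ 0 →
      -- no local well-posedness in `W`
      ¬ Hartree.LocallyWellPosed (Hartree.kernel d lam γ)
          (ContinuousLinearMap.id ℂ (Hartree.Wiener d)) ∧
      ∀ (c : Hartree.Wiener d) (r : ℝ), 0 < r →
        -- for all balls `B` of `W` and all `T > 0`, no solution map from `B` to `C([0,T]; W)` is
        -- uniformly continuous
        (∀ T : ℝ, 0 < T →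
          ¬ ∃ Ψ : Hartree.Wiener d → C(Set.Icc (0 : ℝ) T, Hartree.Wiener d),
            (∀ φ ∈ Metric.ball c r, Hartree.IsSolution (Hartree.kernel d lam γ) T φ (Ψ φ)) ∧
            UniformContinuousOn Ψ (Metric.ball c r)) ∧
        -- this is not due to a lack of solutions: on `[0,T]`, for every small `T`, uniform
        -- continuity in the norm of `W` fails along the solutions in `C([0,T]; L² ∩ W)` with data
        -- in `B ∩ L²`
        ∃ T₀ : ℝ, 0 < T₀ ∧ ∀ T : ℝ, 0 < T → T ≤ T₀ → ∃ ε : ℝ, 0 < ε ∧ ∀ δ : ℝ, 0 < δ →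
          ∃ (φ₁ φ₂ : Hartree.L2W d) (u₁ u₂ : C(Set.Icc (0 : ℝ) T, Hartree.L2W d)),
            Hartree.L2W.toWiener d φ₁ ∈ Metric.ball c r ∧
            Hartree.L2W.toWiener d φ₂ ∈ Metric.ball c r ∧
            Hartree.IsSolution (Hartree.kernel d lam γ) T (Hartree.L2W.toWiener d φ₁)
              (fun t => Hartree.L2W.toWiener d (u₁ t)) ∧
            Hartree.IsSolution (Hartree.kernel d lam γ) T (Hartree.L2W.toWiener d φ₂)
              (fun t => Hartree.L2W.toWiener d (u₂ t)) ∧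
            ‖Hartree.L2W.toWiener d φ₁ - Hartree.L2W.toWiener d φ₂‖ < δ ∧
            ∃ t : Set.Icc (0 : ℝ) T,
              ε ≤ ‖Hartree.L2W.toWiener d (u₁ t) - Hartree.L2W.toWiener d (u₂ t)‖) := by
  refine ⟨Hartree.locallyWellPosed_L2W hγ hγd lam,
    fun T hT φ u v hu hv => Hartree.eq_of_isSolution hγ hγd hT.le hu hv,
    fun hlam => ⟨fun h => ?_, fun c r hr => ⟨fun T hT h => ?_,
      Hartree.exists_instability hγ hγd hlam c hr⟩⟩⟩
  · obtain ⟨φ, hφ, hno⟩ :=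
      Hartree.exists_mem_ball_forall_not_isSolution hγ hγd hlam (0 : Hartree.Wiener d) one_pos
    obtain ⟨T, hT, X, _, _, _, ι, -, hex, -⟩ := h _ Metric.isBounded_ball
    obtain ⟨ψ, hψ, -⟩ := hex φ hφ
    exact hno T hT.le _ hψ
  · obtain ⟨φ, hφ, hno⟩ := Hartree.exists_mem_ball_forall_not_isSolution hγ hγd hlam c hr
    obtain ⟨Ψ, hΨ, -⟩ := h
    exact hno T hT.le _ (hΨ φ hφ)
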